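/- Let $T>0$ and let $\sigma_1,\sigma_2:[0,T]\to\mathbb{C}$ be functions of bounded variation, continuous from the right on $(0,T)$, with $H_1:=\sigma_1(+0)-\sigma_1(0)\neq 0$. Put $U_j(y):=\int_0^T y(t)\,d\sigma_j(t)$ (Stieltjes integral over $[0,T]$, jumps at both end points included). For complex-valued $p\in AC[0,T]$ and $q\in L(0,T)$ consider $$y''(x)+[\lambda^2-2\lambda p(x)-q(x)]\,y(x)=0,\qquad x\in(0,T). \tag{1}$$ Let $X_1(x,\lambda),X_2(x,\lambda)$ be the solutions of (1) with $X_1(0,\lambda)=X_2'(0,\lambda)=1$, $X_1'(0,\lambda)=X_2(0,\lambda)=0$; let $\omega(\lambda):=\det[U_j(X_k)]_{j,k=1,2}$ and assume $\omega\not\equiv0$. Let $\Lambda_1$ be the set of $\lambda\in\mathbb{C}$ for which (1) has a nontrivial solution with $U_1(y)=0$ and $y(T)=0$. For $\lambda\notin\Lambda_1$ let $\Phi(x,\lambda)$ be the solution of (1) with $U_1(\Phi)=1$, $\Phi(T,\lambda)=0$, and let $M(\lambda):=U_2(\Phi(\cdot,\lambda))$ be the Weyl-type function. Let $(\tilde p,\tilde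 q)$ be another pair of the same kind, with the same $\sigma_1,\sigma_2$ and with $\int_0^T\tilde p(x)\,dx=\int_0^T p(x)\,dx$, and denote the corresponding objects with a tilde. Theorem 1. Assume condition S for $(p,q)$: $\omega(\lambda)\ne0$ for every $\lambda\in\Lambda_1$. If $M(\lambda)=\tilde M(\lambda)$ for all $\lambda\notin\Lambda_1\cup\tilde\Lambda_1$ and $\omega(\lambda)=\tilde\omega(\lambda)$ for all $\lambda\in\mathbb{C}$, then $p(x)=\tilde p(x)$ for all $x\in(0,T)$ and $q(x)=\tilde q(x)$ for almost every $x\in(0,T)$. -/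

import Mathlib

open Set MeasureTheory

noncomputable section

namespace NonlocalPencil

/-- `y` solves `y'' + (z² - 2 z p(x) - q(x)) y = 0` on `(0, T)`: `y` is differentiable on `[0, T]`,
`y'` is absolutely continuous on `[0, T]`, and the equation holds almost everywhere. -/
structure IsSolution (T : ℝ) (p q : ℝ → ℂ) (z : ℂ) (y : ℝ → ℂ) : Prop where
  differentiableOn : DifferentiableOn ℝ y (Icc 0 T)
  absolutelyContinuous : AbsolutelyContinuousOnInterval (derivWithin y (Icc 0 T)) 0 T
  equation : ∀ᵐ x ∂(volume.restrict (Ioo 0 T)),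
    HasDerivAt (derivWithin y (Icc 0 T)) (-((z ^ 2 - 2 * z * p x - q x) * y x)) x

/-- The function on the line that agrees with `σ` on `[0, T]` and is constant on `(-∞, 0]` and on
`[T, ∞)` (for `0 ≤ T`). -/
def clamp (T : ℝ) (σ : ℝ → ℂ) : ℝ → ℂ := fun t => σ (max 0 (min t T))

theorem boundedVariationOn_clamp {T : ℝ} (hT : 0 ≤ T) {σ : ℝ → ℂ}
    (hσ : BoundedVariationOn σ (Icc 0 T)) : BoundedVariationOn (clamp T σ) univ := by
  refine ne_top_of_le_ne_top hσ ?_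
  refine eVariationOn.comp_le_of_monotoneOn σ (fun t => max 0 (min t T)) ?_ ?_
  · intro a _ b _ hab
    exact max_le_max le_rfl (min_le_min hab le_rfl)
  · intro t _
    exact ⟨le_max_left _ _, max_le hT (min_le_right _ _)⟩

open Classical in
/-- The Stieltjes integral `∫₀ᵀ y(t) dσ(t)` for `σ` of bounded variation on `[0, T]`, over the closed
interval: possible jumps of `σ` at `0` and at `T` contribute. -/
def stieltjesIntegral (T : ℝ) (σ y : ℝ → ℂ) : ℂ :=
  if h : BoundedVariationOn (clamp T σ) univ then
    (h.vectorMeasure.restrict (Icc 0 T)).integral y (ContinuousLinearMap.mul ℝ ℂ)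
  else 0

/-- The jump `H = σ(+0) - σ(0)`. -/
def jumpAtZero (σ : ℝ → ℂ) : ℂ := Function.rightLim σ 0 - σ 0

/-- The solution of the Cauchy problem `y(0) = a`, `y'(0) = b` (unique on `[0, T]`). -/
def cauchySolution (T : ℝ) (p q : ℝ → ℂ) (z a b : ℂ) : ℝ → ℂ :=
  Classical.epsilon fun y => IsSolution T p q z y ∧ y 0 = a ∧ derivWithin y (Icc 0 T) 0 = b

/-- `X₁(·, z)`: the solution with `X₁(0) = 1`, `X₁'(0) = 0`. -/
def X₁ (T : ℝ) (p q : ℝ → ℂ) (z : ℂ) : ℝ → ℂ := cauchySolution T p q z 1 0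

/-- `X₂(·, z)`: the solution with `X₂(0) = 0`, `X₂'(0) = 1`. -/
def X₂ (T : ℝ) (p q : ℝ → ℂ) (z : ℂ) : ℝ → ℂ := cauchySolution T p q z 0 1

/-- The characteristic function `ω(z) = det [U_j(X_k)]`, where `U_j(y) = ∫₀ᵀ y dσ_j`. -/
def omega (T : ℝ) (σ₁ σ₂ p q : ℝ → ℂ) (z : ℂ) : ℂ :=
  Matrix.det !![stieltjesIntegral T σ₁ (X₁ T p q z), stieltjesIntegral T σ₁ (X₂ T p q z);
                stieltjesIntegral T σ₂ (X₁ T p q z), stieltjesIntegral T σ₂ (X₂ T p q z)]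

/-- The spectrum `Λ₁`: those `z` for which there is a nontrivial solution with `U₁(y) = 0` and
`y(T) = 0`. -/
def spectrum₁ (T : ℝ) (σ₁ p q : ℝ → ℂ) : Set ℂ :=
  {z | ∃ y, IsSolution T p q z y ∧ (∃ x ∈ Icc 0 T, y x ≠ 0) ∧
    stieltjesIntegral T σ₁ y = 0 ∧ y T = 0}

/-- The Weyl-type solution `Φ(·, z)`, with `U₁(Φ) = 1` and `Φ(T) = 0` (it exists and is unique on
`[0, T]` for `z ∉ Λ₁`). -/
def weylSolution (T : ℝ) (σ₁ p q : ℝ → ℂ) (z : ℂ) : ℝ → ℂ :=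
  Classical.epsilon fun y => IsSolution T p q z y ∧ stieltjesIntegral T σ₁ y = 1 ∧ y T = 0

/-- The Weyl-type function `M(z) = U₂(Φ(·, z))`, meaningful for `z ∉ Λ₁`. -/
def weylM (T : ℝ) (σ₁ σ₂ p q : ℝ → ℂ) (z : ℂ) : ℂ :=
  stieltjesIntegral T σ₂ (weylSolution T σ₁ p q z)

end NonlocalPencil

end

open NonlocalPencil

open Set MeasureTheory Filter Topology
open NonlocalPencil

namespace NonlocalPencil

/-! ### Primitives of locally integrable functions -/

/-! Let v₁, v₂ be the solutions with Cauchy data (1, 0) and (0, 1) at T, put Γ_j = U_j(v₁), Δ_j =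
U_j(v₂), and let primes mark the second pencil. A solution vanishing at T is a multiple of v₂, so Λ₁
is the zero set of Δ₁ and M = Δ₂/Δ₁; since the passage between the fundamental systems at 0 and at T
has determinant one, ω = Γ₁Δ₂ − Δ₁Γ₂ (`mem_spectrum₁_iff`, `weylM_mul_eq`, `omega_eq`). Condition S
therefore keeps Δ₁ and Δ₂ from vanishing together.

The nonzero jump at 0 fixes the growth of Δ₁. Along a non-real ray v₂ is exponentially larger at 0
than at any t > 0, so Δ₁ behaves like H₁ v₂(0), whose leading term sees p only through its integral
(`tendsto_leadingFactor_functional`). Equality of M gives Δ₂Δ₁' = Δ₂'Δ₁, hence Δ₁' = EΔ₁ with E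
entire. E is of exponential type and tends to 1 on the four diagonal rays, so E = 1 by
Phragmén–Lindelöf and Liouville (`ExpType.of_mul`, `ExpType.eq_of_tendsto`). Thus Δ_j = Δ_j', and
equality of ω gives Γ₁ − Γ₁' = FΔ₁ with F entire.

For x in [T/2, T] consider P = v₂(v₁' + Fv₂') − v₁v₂' at x. The product PΔ₁ involves only v₂(x),
v₂'(x) and U₁ of the solutions vanishing at x. Because x ≥ T/2, the latter are O(e^{|Im z| x}/|z|),
so P = O(1/|z|) on the diagonals and P = 0 (`cross_eq_zero`). Formally, v₁/v₂ − v₁'/v₂' = F does not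
depend on x. Its x-derivative gives v₂² = v₂'², so the potentials agree on (T/2, T), and two values
of z separate p from q (`coeff_eq_of_cross`).

Now F = 0, and solutions based at T/2 have equal values under U₁ truncated to [0, T/2] (`step`,
`functional_eq_descend`). The same argument runs on [0, T/2], then on [0, T/4], and so on; the
half-intervals exhaust (0, T) up to a null set. -/

theorem _root_.AbsolutelyContinuousOnInterval.of_dist_le {X Y : Type*} [PseudoMetricSpace X]
    [PseudoMetricSpace Y] {f : ℝ → X} {g : ℝ → Y} {a b : ℝ}
    (hg : AbsolutelyContinuousOnInterval g a b)
    (h : ∀ x ∈ uIcc a b, ∀ y ∈ uIcc a b, dist (f x) (f y) ≤ dist (g x) (g y)) :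
    AbsolutelyContinuousOnInterval f a b := by
  rw [absolutelyContinuousOnInterval_iff] at hg ⊢
  intro ε hε
  obtain ⟨δ, hδ, H⟩ := hg ε hε
  refine ⟨δ, hδ, fun E hE hlt => lt_of_le_of_lt (Finset.sum_le_sum fun i hi => ?_) (H E hE hlt)⟩
  exact h _ (hE.1 i hi).1 _ (hE.1 i hi).2

/-- The difference of `f` and the primitive of `α` is absolutely continuous with derivative zero
almost everywhere, hence constant. The primitive is absolutely continuous because its increments are
dominated by those of the primitive of `‖α‖`. -/
theorem _root_.AbsolutelyContinuousOnInterval.sub_eq_integral {f α : ℝ → ℂ} {a b : ℝ}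
    (hf : AbsolutelyContinuousOnInterval f a b)
    (hα : IntervalIntegrable α volume a b)
    (h : ∀ᵐ x, x ∈ uIcc a b → HasDerivAt f (α x) x) :
    ∀ x ∈ uIcc a b, f x - f a = ∫ t in a..x, α t := by
  have hint : AbsolutelyContinuousOnInterval (fun x => ∫ t in a..x, α t) a b := by
    refine (hα.norm.absolutelyContinuousOnInterval_intervalIntegral left_mem_uIcc).of_dist_le ?_
    intro x hx y hy
    have h1 : IntervalIntegrable α volume a x := hα.mono_set (uIcc_subset_uIcc left_mem_uIcc hx)
    have h2 : IntervalIntegrable α volume a y := hα.mono_set (uIcc_subset_uIcc left_mem_uIcc hy)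
    rw [dist_comm, dist_comm (∫ v in a..x, ‖α v‖), dist_eq_norm, dist_eq_norm,
      intervalIntegral.integral_interval_sub_left h2 h1,
      intervalIntegral.integral_interval_sub_left h2.norm h1.norm, Real.norm_eq_abs]
    exact intervalIntegral.norm_integral_le_abs_integral_norm
  have hd : AbsolutelyContinuousOnInterval (fun x => f x - ∫ t in a..x, α t) a b := hf.sub hint
  obtain ⟨C, hC⟩ := hd.const_of_ae_hasDerivAt_zero (by
    filter_upwards [h, hα.ae_hasDerivAt_integral] with x h1 h2 hx
    simpa using (h1 hx).fun_sub (h2 hx a left_mem_uIcc))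
  intro x hx
  have h1 := hC x hx
  have h2 := hC a left_mem_uIcc
  simp only [intervalIntegral.integral_same, sub_zero] at h2
  rw [← h2] at h1
  linear_combination h1

/-- `f` is a primitive on the line of the locally integrable function `α`. -/
structure Prim (f α : ℝ → ℂ) : Prop where
  intervalIntegrable : ∀ a b, IntervalIntegrable α volume a b
  sub_eq : ∀ a b, f b - f a = ∫ t in a..b, α t

namespace Prim

variable {f g α β : ℝ → ℂ}

theorem eq_add (h : Prim f α) (a x : ℝ) : f x = f a + ∫ t in a..x, α t := by
  rw [← h.sub_eq]; ring

theorem continuous (h : Prim f α) : Continuous f := by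
  have : f = fun x => f 0 + ∫ t in (0 : ℝ)..x, α t := funext fun x => h.eq_add 0 x
  rw [this]
  exact continuous_const.add (intervalIntegral.continuous_primitive h.intervalIntegrable 0)

theorem dist_le (h : Prim f α) (a x y : ℝ) :
    dist (f x) (f y) ≤ dist (∫ t in a..x, ‖α t‖) (∫ t in a..y, ‖α t‖) := by
  have h1 := h.intervalIntegrable
  rw [dist_comm, dist_comm (∫ v in a..x, ‖α v‖), dist_eq_norm, dist_eq_norm, h.sub_eq,
      intervalIntegral.integral_interval_sub_left (h1 _ _).norm (h1 _ _).norm, Real.norm_eq_abs]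
  exact intervalIntegral.norm_integral_le_abs_integral_norm

theorem ac (h : Prim f α) (a b : ℝ) : AbsolutelyContinuousOnInterval f a b :=
  ((h.intervalIntegrable a b).norm.absolutelyContinuousOnInterval_intervalIntegral
    left_mem_uIcc).of_dist_le fun x _ y _ => h.dist_le a x y

theorem locallyIntegrable (h : Prim f α) : LocallyIntegrable α volume := by
  intro x
  refine ⟨Ioc (x - 1) (x + 1), Ioc_mem_nhds (by linarith) (by linarith), ?_⟩
  exact (intervalIntegrable_iff_integrableOn_Ioc_of_le (by linarith)).1 (h.intervalIntegrable _ _)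

theorem ae_hasDerivAt (h : Prim f α) : ∀ᵐ x, HasDerivAt f (α x) x := by
  filter_upwards [LocallyIntegrable.ae_hasDerivAt_integral h.locallyIntegrable] with x hx
  have : f = fun x => f 0 + ∫ t in (0 : ℝ)..x, α t := funext fun x => h.eq_add 0 x
  rw [this]
  exact (hx 0).const_add _

theorem hasDerivAt (h : Prim f α) (hα : Continuous α) (x : ℝ) : HasDerivAt f (α x) x := by
  have : f = fun x => f 0 + ∫ t in (0 : ℝ)..x, α t := funext fun x => h.eq_add 0 x
  rw [this]
  exact (intervalIntegral.integral_hasDerivAt_right (h.intervalIntegrable _ _)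
    (hα.stronglyMeasurableAtFilter _ _) hα.continuousAt).const_add _

theorem of_ac (hα : ∀ a b, IntervalIntegrable α volume a b)
    (hf : ∀ a b, AbsolutelyContinuousOnInterval f a b) (h : ∀ᵐ x, HasDerivAt f (α x) x) :
    Prim f α :=
  ⟨hα, fun a b => (hf a b).sub_eq_integral (hα a b) (h.mono fun _ hx _ => hx) b right_mem_uIcc⟩

theorem of_hasDerivAt (h : ∀ x, HasDerivAt f (α x) x) (hα : Continuous α) : Prim f α :=
  ⟨fun a b => hα.intervalIntegrable a b, fun a b =>
    (intervalIntegral.integral_eq_sub_of_hasDerivAt (fun x _ => h x)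
      (hα.intervalIntegrable a b)).symm⟩

theorem const (c : ℂ) : Prim (fun _ => c) (fun _ => 0) :=
  of_hasDerivAt (fun x => hasDerivAt_const x c) continuous_const

theorem of_integral (hα : ∀ a b, IntervalIntegrable α volume a b) (c : ℂ) (a : ℝ) :
    Prim (fun x => c + ∫ t in a..x, α t) α :=
  ⟨hα, fun x y => by
    rw [← intervalIntegral.integral_interval_sub_left (hα a y) (hα a x)]; ring⟩

theorem congr (h : Prim f α) (hαβ : α =ᵐ[volume] β) : Prim f β :=
  ⟨fun a b => (h.intervalIntegrable a b).congr_ae (ae_restrict_of_ae hαβ), fun a b => by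
    rw [h.sub_eq, intervalIntegral.integral_congr_ae (hαβ.mono fun x hx _ => hx)]⟩

theorem add (hf : Prim f α) (hg : Prim g β) :
    Prim (fun x => f x + g x) (fun x => α x + β x) :=
  ⟨fun a b => (hf.intervalIntegrable a b).add (hg.intervalIntegrable a b), fun a b => by
    rw [intervalIntegral.integral_add (hf.intervalIntegrable a b) (hg.intervalIntegrable a b),
      ← hf.sub_eq, ← hg.sub_eq]; ring⟩

theorem const_mul (hf : Prim f α) (c : ℂ) : Prim (fun x => c * f x) (fun x => c * α x) :=
  ⟨fun a b => (hf.intervalIntegrable a b).const_mul c, fun a b => by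
    rw [intervalIntegral.integral_const_mul, ← hf.sub_eq]; ring⟩

theorem neg (hf : Prim f α) : Prim (fun x => -f x) (fun x => -α x) := by
  simpa using hf.const_mul (-1)

theorem sub (hf : Prim f α) (hg : Prim g β) :
    Prim (fun x => f x - g x) (fun x => α x - β x) := by
  simpa [sub_eq_add_neg] using hf.add hg.neg

theorem mul (hf : Prim f α) (hg : Prim g β) :
    Prim (fun x => f x * g x) (fun x => α x * g x + f x * β x) := by
  refine of_ac (fun a b => ?_) (fun a b => (hf.ac a b).fun_smul (hg.ac a b)) ?_
  · exact ((hf.intervalIntegrable a b).mul_continuousOn hg.continuous.continuousOn).add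
      ((hg.intervalIntegrable a b).continuousOn_mul hf.continuous.continuousOn)
  · filter_upwards [hf.ae_hasDerivAt, hg.ae_hasDerivAt] with x h1 h2 using h1.mul h2

theorem comp_const_add (hf : Prim f α) (c : ℝ) :
    Prim (fun x => f (c + x)) (fun x => α (c + x)) :=
  ⟨fun a b => by simpa using (hf.intervalIntegrable (c + a) (c + b)).comp_add_left c, fun a b => by
    rw [intervalIntegral.integral_comp_add_left, hf.sub_eq]⟩

theorem comp_const_sub (hf : Prim f α) (c : ℝ) :
    Prim (fun x => f (c - x)) (fun x => -α (c - x)) :=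
  ⟨fun a b => by
    have := ((hf.intervalIntegrable (c - a) (c - b)).comp_sub_left c).neg
    rw [sub_sub_cancel, sub_sub_cancel] at this
    exact this,
  fun a b => by
    rw [intervalIntegral.integral_neg, intervalIntegral.integral_comp_sub_left (fun x => α x),
      ← intervalIntegral.integral_symm, hf.sub_eq]⟩

end Prim

/-- An absolutely continuous function on `[0, T]`, extended by constants, is a primitive of its
almost everywhere derivative, extended by zero. -/
theorem Prim.clamp {T : ℝ} (hT : 0 ≤ T) {f α : ℝ → ℂ} (hf : AbsolutelyContinuousOnInterval f 0 T)
    (hα : IntegrableOn α (Ioo 0 T))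
    (h : ∀ᵐ x ∂(volume.restrict (Ioo 0 T)), HasDerivAt f (α x) x) :
    Prim (NonlocalPencil.clamp T f) ((Ioo 0 T).indicator α) := by
  have hi : Integrable ((Ioo 0 T).indicator α) := hα.integrable_indicator measurableSet_Ioo
  have hii : ∀ a b, IntervalIntegrable ((Ioo 0 T).indicator α) volume a b :=
    fun a b => hi.intervalIntegrable
  have key : ∀ x ∈ Icc 0 T, f x - f 0 = ∫ t in (0 : ℝ)..x, (Ioo 0 T).indicator α t := by
    have := hf.sub_eq_integral (α := (Ioo 0 T).indicator α) (hii 0 T) ?_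
    · simpa [uIcc_of_le hT] using this
    · rw [ae_restrict_iff' measurableSet_Ioo] at h
      have h0 : ∀ᵐ x : ℝ, x ≠ 0 := by simp [ae_iff, measure_singleton]
      have h1 : ∀ᵐ x : ℝ, x ≠ T := by simp [ae_iff, measure_singleton]
      filter_upwards [h, h0, h1] with x hx h0 h1 hxT
      rw [uIcc_of_le hT] at hxT
      have hx' : x ∈ Ioo 0 T := ⟨lt_of_le_of_ne hxT.1 (Ne.symm h0), lt_of_le_of_ne hxT.2 h1⟩
      simpa [hx'] using hx hx'
  have key2 : ∀ x, NonlocalPencil.clamp T f x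
      = f 0 + ∫ t in (0 : ℝ)..x, (Ioo 0 T).indicator α t := by
    intro x
    unfold NonlocalPencil.clamp
    rcases le_total x 0 with hx | hx
    · rw [max_eq_left (min_le_of_left_le hx), intervalIntegral.integral_symm,
        intervalIntegral.integral_of_le hx, setIntegral_eq_zero_of_forall_eq_zero]
      · simp
      · intro t ht
        exact indicator_of_notMem (fun h => absurd h.1 (not_lt.2 ht.2)) _
    rcases le_total x T with hxT | hxT
    · rw [min_eq_left hxT, max_eq_right hx, ← key x ⟨hx, hxT⟩]; ring
    · rw [min_eq_right hxT, max_eq_right hT,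
        ← intervalIntegral.integral_add_adjacent_intervals (hii 0 T) (hii T x),
        intervalIntegral.integral_of_le hxT,
        setIntegral_eq_zero_of_forall_eq_zero (t := Ioc T x), ← key T ⟨hT, le_rfl⟩]
      · ring
      · intro t ht
        exact indicator_of_notMem (fun h => absurd h.2 (not_lt.2 ht.1.le)) _
  have := Prim.of_integral hii (f 0) 0
  exact ⟨hii, fun a b => by rw [key2 a, key2 b]; exact this.sub_eq a b⟩

/-- Real and imaginary parts are real absolutely continuous functions, so each is differentiable
almost everywhere with integrable derivative. -/
theorem _root_.AbsolutelyContinuousOnInterval.exists_ae_hasDerivAt {f : ℝ → ℂ} {T : ℝ}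
    (hT : 0 ≤ T) (hf : AbsolutelyContinuousOnInterval f 0 T) :
    ∃ α : ℝ → ℂ, IntegrableOn α (Ioo 0 T) ∧
      ∀ᵐ x ∂(volume.restrict (Ioo 0 T)), HasDerivAt f (α x) x := by
  have hre : AbsolutelyContinuousOnInterval (fun x => (f x).re) 0 T :=
    hf.of_dist_le fun x _ y _ => by
      rw [dist_eq_norm, dist_eq_norm, ← Complex.sub_re, Real.norm_eq_abs]
      exact Complex.abs_re_le_norm _
  have him : AbsolutelyContinuousOnInterval (fun x => (f x).im) 0 T :=
    hf.of_dist_le fun x _ y _ => by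
      rw [dist_eq_norm, dist_eq_norm, ← Complex.sub_im, Real.norm_eq_abs]
      exact Complex.abs_im_le_norm _
  refine ⟨fun x => ((deriv (fun x => (f x).re) x : ℝ) : ℂ)
    + ((deriv (fun x => (f x).im) x : ℝ) : ℂ) * Complex.I, ?_, ?_⟩
  · have h1 := (intervalIntegrable_iff_integrableOn_Ioo_of_le hT).1 hre.intervalIntegrable_deriv
    have h2 := (intervalIntegrable_iff_integrableOn_Ioo_of_le hT).1 him.intervalIntegrable_deriv
    exact h1.ofReal.add (h2.ofReal.mul_const _)
  · rw [ae_restrict_iff' measurableSet_Ioo]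
    filter_upwards [hre.ae_differentiableAt, him.ae_differentiableAt] with x h1 h2 hx
    have hx' : x ∈ uIcc 0 T := by rw [uIcc_of_le hT]; exact Ioo_subset_Icc_self hx
    have := (h1 hx').hasDerivAt.ofReal_comp.add ((h2 hx').hasDerivAt.ofReal_comp.mul_const Complex.I)
    refine this.congr_of_eventuallyEq (Eventually.of_forall fun y => ?_)
    simp [Complex.re_add_im]

theorem _root_.AbsolutelyContinuousOnInterval.integrableOn_Ioo {T : ℝ} {p : ℝ → ℂ} (hT : 0 ≤ T)
    (hp : AbsolutelyContinuousOnInterval p 0 T) : IntegrableOn p (Ioo 0 T) := by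
  have := (hp.continuousOn).integrableOn_compact (μ := volume) isCompact_uIcc
  rw [uIcc_of_le hT] at this
  exact this.mono_set Ioo_subset_Icc_self

/-! ### Entire functions of exponential type -/

section Jensen

open Metric

/-- Jensen's formula: the average exceeds the value at the centre by a sum over the zeros in the
disc, each term being nonnegative. -/
theorem log_norm_le_circleAverage {h : ℂ → ℂ} (hh : Differentiable ℂ h) {c : ℂ} (hc : h c ≠ 0)
    {R : ℝ} (hR : 0 < R) :
    Real.log ‖h c‖ ≤ Real.circleAverage (fun z => Real.log ‖h z‖) c R := by
  have ha : AnalyticOnNhd ℂ h (closedBall c |R|) := fun z _ => hh.analyticAt z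
  rw [ha.circleAverage_log_norm hR.ne' hc]
  refine le_add_of_nonneg_left (finsum_nonneg fun u => ?_)
  by_cases hu : u ∈ closedBall c |R|
  · refine mul_nonneg (mod_cast MeromorphicOn.AnalyticOnNhd.divisor_nonneg ha u) ?_
    rw [mem_closedBall, abs_of_pos hR, dist_comm, dist_eq_norm] at hu
    rcases (norm_nonneg (c - u)).eq_or_lt with h0 | h0
    -- For `u = c` the logarithm is that of `R * 0⁻¹ = 0`, which is 0 by convention.
    · simp [← h0]
    · refine Real.log_nonneg ?_
      rw [← div_eq_mul_inv, le_div_iff₀ h0]; simpa using hu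
  · simp [hu]

theorem circleIntegrable_log_norm_of_differentiable {h : ℂ → ℂ} (hh : Differentiable ℂ h)
    (c : ℂ) (R : ℝ) : CircleIntegrable (fun z => Real.log ‖h z‖) c R :=
  MeromorphicOn.circleIntegrable_log_norm fun z _ => (hh.analyticAt z).meromorphicAt

/-- Integrates Jensen's inequality over the radius. Discs with different centres can be compared by
inclusion, circles cannot; `ExpType.of_mul` relies on this. -/
theorem lintegral_ball_eq_polar {F : ℂ → ENNReal} (hF : Measurable F) (c : ℂ) (R : ℝ) :
    ∫⁻ z in ball c R, F z = ∫⁻ r in Ioo 0 R, ENNReal.ofReal r *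
      ∫⁻ θ in Ioo (-Real.pi) Real.pi, F (circleMap c r θ) := by
  have hm : Measurable ((ball c R).indicator F) := hF.indicator measurableSet_ball
  rw [← lintegral_indicator measurableSet_ball,
    ← lintegral_add_left_eq_self ((ball c R).indicator F) c,
    ← Complex.lintegral_comp_polarCoord_symm, polarCoord_target, Measure.volume_eq_prod,
    ← Measure.prod_restrict, lintegral_prod]
  · rw [← Ioi_inter_Iio (a := 0) (b := R), inter_comm, ← Measure.restrict_restrict measurableSet_Iio,
      ← lintegral_indicator (s := Iio R) measurableSet_Iio]
    refine setLIntegral_congr_fun measurableSet_Ioi fun r (hr : 0 < r) => ?_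
    have e : ∀ θ, c + Complex.polarCoord.symm (r, θ) = circleMap c r θ := fun θ => by
      rw [Complex.polarCoord_symm_apply, circleMap, Complex.exp_mul_I]; simp
    simp only [e, smul_eq_mul]
    by_cases hrR : r < R
    · rw [indicator_of_mem (show r ∈ Iio R from hrR),
        ← lintegral_const_mul _ (by fun_prop)]
      refine lintegral_congr fun θ => ?_
      rw [indicator_of_mem]
      simpa [dist_eq_norm, circleMap_sub_center, abs_of_pos hr] using hrR
    · rw [indicator_of_notMem (show r ∉ Iio R from hrR)]
      refine (lintegral_congr fun θ => ?_).trans lintegral_zero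
      rw [indicator_of_notMem, mul_zero]
      simpa [dist_eq_norm, circleMap_sub_center, abs_of_pos hr] using hrR
  · refine Measurable.aemeasurable ?_
    have : Measurable fun p : ℝ × ℝ => Complex.polarCoord.symm p := by
      simp only [Complex.polarCoord_symm_apply]; fun_prop
    simp only [smul_eq_mul]
    fun_prop

theorem lintegral_ofReal_Ioo {R : ℝ} (hR : 0 ≤ R) :
    ∫⁻ r in Ioo 0 R, ENNReal.ofReal r = ENNReal.ofReal (R ^ 2 / 2) := by
  rw [← ofReal_integral_eq_lintegral_ofReal]
  · rw [← integral_Ioc_eq_integral_Ioo, ← intervalIntegral.integral_of_le hR]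
    simp
  · exact ((continuous_id.intervalIntegrable 0 R).1).mono_set Ioo_subset_Ioc_self
  · rw [EventuallyLE, ae_restrict_iff' measurableSet_Ioo]
    exact Eventually.of_forall fun r hr => hr.1.le

theorem integral_circleMap_Ioo (u : ℂ → ℝ) (c : ℂ) (r : ℝ) :
    ∫ θ in Ioo (-Real.pi) Real.pi, u (circleMap c r θ) = 2 * Real.pi * Real.circleAverage u c r := by
  rw [Real.circleAverage_eq_integral_add (-Real.pi),
    intervalIntegral.integral_comp_add_right (fun θ => u (circleMap c r θ)),
    ← integral_Ioc_eq_integral_Ioo,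
    ← intervalIntegral.integral_of_le (by linarith [Real.pi_pos])]
  rw [show 0 + -Real.pi = -Real.pi by ring, show 2 * Real.pi + -Real.pi = Real.pi by ring, smul_eq_mul,
    ← mul_assoc, mul_inv_cancel₀ (by positivity), one_mul]

theorem integrableOn_circleMap_Ioo {u : ℂ → ℝ} {c : ℂ} {r : ℝ} (hu : CircleIntegrable u c r) :
    IntegrableOn (fun θ => u (circleMap c r θ)) (Ioo (-Real.pi) Real.pi) := by
  have hp : Function.Periodic (fun θ => u (circleMap c r θ)) (2 * Real.pi) := fun x => by
    simp [periodic_circleMap c r x]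
  have := hp.intervalIntegrable₀ (by positivity) hu (-Real.pi) Real.pi
  exact this.1.mono_set Ioo_subset_Ioc_self

/-- Area form of Jensen's inequality for the defect of `log ‖h‖` from an upper bound. -/
theorem lintegral_ball_sub_log_norm_le {h : ℂ → ℂ} (hh : Differentiable ℂ h) {c : ℂ}
    (hc : h c ≠ 0) {R M : ℝ} (hR : 0 ≤ R) (hM : ∀ z ∈ ball c R, Real.log ‖h z‖ ≤ M) :
    ∫⁻ z in ball c R, ENNReal.ofReal (M - Real.log ‖h z‖)
      ≤ ENNReal.ofReal (Real.pi * R ^ 2 * (M - Real.log ‖h c‖)) := by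
  have hm : Measurable fun z => ENNReal.ofReal (M - Real.log ‖h z‖) := by
    have := hh.continuous.measurable
    fun_prop
  rw [lintegral_ball_eq_polar hm]
  have key : ∀ r ∈ Ioo 0 R, ENNReal.ofReal r *
      ∫⁻ θ in Ioo (-Real.pi) Real.pi, ENNReal.ofReal (M - Real.log ‖h (circleMap c r θ)‖)
      ≤ ENNReal.ofReal r * ENNReal.ofReal (2 * Real.pi * (M - Real.log ‖h c‖)) := by
    intro r hr
    gcongr
    have hci := circleIntegrable_log_norm_of_differentiable hh c r
    have hi := integrableOn_circleMap_Ioo hci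
    rw [← ofReal_integral_eq_lintegral_ofReal]
    · refine ENNReal.ofReal_le_ofReal ?_
      rw [integral_sub (integrable_const _) hi,
        integral_circleMap_Ioo (fun z => Real.log ‖h z‖)]
      have := log_norm_le_circleAverage hh hc hr.1
      have hv : volume.real (Ioo (-Real.pi) Real.pi) = 2 * Real.pi := by
        rw [Measure.real, Real.volume_Ioo, ENNReal.toReal_ofReal (by linarith [Real.pi_pos])]; ring
      simp only [integral_const, MeasurableSet.univ, measureReal_restrict_apply, univ_inter, hv,
        smul_eq_mul]
      nlinarith [Real.pi_pos]
    · exact (integrable_const _).sub hi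
    · refine Eventually.of_forall fun θ => sub_nonneg.2 (hM _ ?_)
      rw [mem_ball, dist_eq_norm, circleMap_sub_center, norm_circleMap_zero, abs_of_pos hr.1]; exact hr.2
  refine (setLIntegral_mono' measurableSet_Ioo key).trans ?_
  rw [lintegral_mul_const _ (by fun_prop), lintegral_ofReal_Ioo hR,
    ← ENNReal.ofReal_mul (by positivity)]
  exact ENNReal.ofReal_le_ofReal (by ring_nf; exact le_rfl)

/-- Area form of the sub-mean value property of `log ‖h‖`. -/
theorem log_norm_le_lintegral_ball {h : ℂ → ℂ} (hh : Differentiable ℂ h) {c : ℂ}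
    (hc : h c ≠ 0) {R : ℝ} (hR : 0 ≤ R) :
    ENNReal.ofReal (Real.pi * R ^ 2 * Real.log ‖h c‖)
      ≤ ∫⁻ z in ball c R, ENNReal.ofReal (Real.log ‖h z‖) := by
  have hm : Measurable fun z => ENNReal.ofReal (Real.log ‖h z‖) := by
    have := hh.continuous.measurable
    fun_prop
  rw [lintegral_ball_eq_polar hm]
  have key : ∀ r ∈ Ioo 0 R, ENNReal.ofReal r * ENNReal.ofReal (2 * Real.pi * Real.log ‖h c‖) ≤
      ENNReal.ofReal r *
      ∫⁻ θ in Ioo (-Real.pi) Real.pi, ENNReal.ofReal (Real.log ‖h (circleMap c r θ)‖) := by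
    intro r hr
    gcongr
    have hci := circleIntegrable_log_norm_of_differentiable hh c r
    have hi := integrableOn_circleMap_Ioo hci
    have h1 := log_norm_le_circleAverage hh hc hr.1
    have h2 := integral_circleMap_Ioo (fun z => Real.log ‖h z‖) c r
    calc ENNReal.ofReal (2 * Real.pi * Real.log ‖h c‖)
        ≤ ENNReal.ofReal (∫ θ in Ioo (-Real.pi) Real.pi, Real.log ‖h (circleMap c r θ)‖) := by
          rw [h2]; gcongr
      _ ≤ ENNReal.ofReal (∫ θ in Ioo (-Real.pi) Real.pi, max (Real.log ‖h (circleMap c r θ)‖) 0) := by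
          refine ENNReal.ofReal_le_ofReal (integral_mono hi hi.pos_part fun θ => le_max_left _ _)
      _ = ∫⁻ θ in Ioo (-Real.pi) Real.pi, ENNReal.ofReal (max (Real.log ‖h (circleMap c r θ)‖) 0) :=
          ofReal_integral_eq_lintegral_ofReal hi.pos_part
            (Eventually.of_forall fun θ => le_max_right _ _)
      _ = _ := by simp
  refine le_trans ?_ (setLIntegral_mono' measurableSet_Ioo key)
  rw [lintegral_mul_const _ (by fun_prop), lintegral_ofReal_Ioo hR,
    ← ENNReal.ofReal_mul (by positivity)]
  exact ENNReal.ofReal_le_ofReal (by ring_nf; exact le_rfl)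

/-- The zeros of an entire function that is not identically zero are isolated, hence form a null
set. -/
theorem ae_ne_zero_of_differentiable {g : ℂ → ℂ} (hg : Differentiable ℂ g) {z₀ : ℂ}
    (h0 : g z₀ ≠ 0) : ∀ᵐ z, g z ≠ 0 := by
  have ha : AnalyticOnNhd ℂ g univ := fun z _ => hg.analyticAt z
  have h1 := ha.preimage_zero_mem_codiscrete h0
  have h2 : ae (volume.restrict (univ : Set ℂ)) ≤ codiscreteWithin univ :=
    ae_restrict_le_codiscreteWithin MeasurableSet.univ
  rw [Measure.restrict_univ] at h2
  filter_upwards [h2 h1] with z hz using by simpa using hz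

end Jensen

/-- Exponential type bound for functions on the complex plane. -/
def ExpType (f : ℂ → ℂ) : Prop := ∃ A : ℝ, ∀ z, ‖f z‖ ≤ Real.exp (A * (1 + ‖z‖))

namespace ExpType

variable {f g : ℂ → ℂ}

theorem exists_nonneg (hf : ExpType f) : ∃ A : ℝ, 0 ≤ A ∧ ∀ z, ‖f z‖ ≤ Real.exp (A * (1 + ‖z‖)) := by
  obtain ⟨A, hA⟩ := hf
  refine ⟨max A 0, le_max_right _ _, fun z => (hA z).trans ?_⟩
  gcongr; exact le_max_left _ _

theorem mul (hf : ExpType f) (hg : ExpType g) : ExpType fun z => f z * g z := by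
  obtain ⟨A, hA⟩ := hf
  obtain ⟨B, hB⟩ := hg
  refine ⟨A + B, fun z => ?_⟩
  rw [norm_mul, add_mul, Real.exp_add]
  gcongr
  · exact hA z
  · exact hB z

theorem add (hf : ExpType f) (hg : ExpType g) : ExpType fun z => f z + g z := by
  obtain ⟨A, hA0, hA⟩ := hf.exists_nonneg
  obtain ⟨B, hB0, hB⟩ := hg.exists_nonneg
  refine ⟨A + B + 1, fun z => (norm_add_le _ _).trans ?_⟩
  have h1 : (1 : ℝ) ≤ 1 + ‖z‖ := by linarith [norm_nonneg z]
  have h2 : Real.exp (A * (1 + ‖z‖)) ≤ Real.exp ((A + B) * (1 + ‖z‖)) := by gcongr; linarith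
  have h3 : Real.exp (B * (1 + ‖z‖)) ≤ Real.exp ((A + B) * (1 + ‖z‖)) := by gcongr; linarith
  have h4 : (2 : ℝ) ≤ Real.exp (1 + ‖z‖) := by linarith [Real.add_one_le_exp (1 + ‖z‖)]
  rw [show (A + B + 1) * (1 + ‖z‖) = (A + B) * (1 + ‖z‖) + (1 + ‖z‖) by ring, Real.exp_add]
  nlinarith [hA z, hB z, Real.exp_pos ((A + B) * (1 + ‖z‖))]

theorem neg (hf : ExpType f) : ExpType fun z => -f z := by simpa [ExpType] using hf

theorem sub (hf : ExpType f) (hg : ExpType g) : ExpType fun z => f z - g z := by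
  simpa [sub_eq_add_neg] using hf.add hg.neg

theorem of_le {C D R : ℝ} (hf : Continuous f)
    (h : ∀ z, R ≤ ‖z‖ → ‖f z‖ ≤ C * Real.exp (D * ‖z‖)) : ExpType f := by
  obtain ⟨M, hM⟩ := (isCompact_closedBall (0 : ℂ) R).exists_bound_of_continuousOn hf.continuousOn
  refine ⟨|C| + |D| + |M|, fun z => ?_⟩
  have hz := norm_nonneg z
  have key : ∀ K : ℝ, 0 ≤ K → K ≤ Real.exp (K * (1 + ‖z‖)) := fun K hK => by
    nlinarith [Real.add_one_le_exp (K * (1 + ‖z‖)), mul_nonneg hK hz]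
  rcases le_total R ‖z‖ with hR | hR
  · refine (h z hR).trans ?_
    calc C * Real.exp (D * ‖z‖) ≤ Real.exp (|C| * (1 + ‖z‖)) * Real.exp (|D| * (1 + ‖z‖)) := by
          gcongr
          · exact (le_abs_self C).trans (key _ (abs_nonneg _))
          · exact le_abs_self D
          · linarith
      _ ≤ _ := by
          rw [← Real.exp_add]; gcongr; nlinarith [abs_nonneg M]
  · refine (hM z (by simpa using hR)).trans ((le_abs_self M).trans ((key _ (abs_nonneg _)).trans ?_))
    gcongr
    linarith [abs_nonneg C, abs_nonneg D]

end ExpType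

/-- An entire quotient of functions of exponential type is of exponential type. -/
theorem ExpType.of_mul {E f g : ℂ → ℂ} (hE : Differentiable ℂ E)
    (hg : Differentiable ℂ g) (hfe : ExpType f) (hge : ExpType g) {z₀ : ℂ} (h0 : g z₀ ≠ 0)
    (h : ∀ z, f z = E z * g z) : ExpType E := by
  obtain ⟨A, hA0, hA⟩ := hfe.exists_nonneg
  obtain ⟨B, hB0, hB⟩ := hge.exists_nonneg
  -- The condition `0 ≤ K` covers `u = 0`, where `Real.log 0 = 0`.
  have logle : ∀ (u : ℂ) (K : ℝ), 0 ≤ K → ‖u‖ ≤ Real.exp K → Real.log ‖u‖ ≤ K := by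
    intro u K hK hu
    rcases (norm_nonneg u).eq_or_lt with h | h
    · rw [← h]; simpa using hK
    · exact (Real.log_le_iff_le_exp h).2 hu
  -- The final bound is log‖E w‖ ≤ 4(L − log‖g z₀‖), with L ≤ 3(A + B)(2 + ‖z₀‖)(1 + ‖w‖). The 4 is
  -- the ratio of the areas of the discs of radii 2R and R.
  refine ⟨12 * (A + B) * (2 + ‖z₀‖) + 4 * |Real.log ‖g z₀‖|, fun w => ?_⟩
  -- This radius puts the disc around `w` inside the disc of radius 2R around `z₀`, and it grows
  -- only linearly with `w`.
  set R := ‖w - z₀‖ + 1 with hRdef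
  have hR0 : 0 < R := by positivity
  have hRle : R ≤ ‖w‖ + ‖z₀‖ + 1 := by linarith [norm_sub_le w z₀]
  set L := (A + B) * (1 + ‖z₀‖ + 2 * R) with hLdef
  have hL0 : 0 ≤ L := by positivity
  have hfL : ∀ z ∈ Metric.ball z₀ (2 * R), Real.log ‖f z‖ ≤ L ∧ Real.log ‖g z‖ ≤ L := by
    intro z hz
    rw [Metric.mem_ball, dist_eq_norm] at hz
    have hz' : ‖z‖ ≤ ‖z₀‖ + 2 * R := by
      have := norm_add_le (z - z₀) z₀; rw [sub_add_cancel] at this; linarith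
    constructor
    · refine logle _ _ hL0 ((hA z).trans (Real.exp_le_exp.2 ?_))
      have : A * (1 + ‖z‖) ≤ A * (1 + ‖z₀‖ + 2 * R) := by
        rw [add_assoc]; gcongr
      have : 0 ≤ B * (1 + ‖z₀‖ + 2 * R) := by positivity
      rw [hLdef]; linarith
    · refine logle _ _ hL0 ((hB z).trans (Real.exp_le_exp.2 ?_))
      have : B * (1 + ‖z‖) ≤ B * (1 + ‖z₀‖ + 2 * R) := by
        rw [add_assoc]; gcongr
      have : 0 ≤ A * (1 + ‖z₀‖ + 2 * R) := by positivity
      rw [hLdef]; linarith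
  by_cases hEw : E w = 0
  · rw [hEw, norm_zero]; positivity
  have hsub : Metric.ball w R ⊆ Metric.ball z₀ (2 * R) := by
    refine Metric.ball_subset_ball' ?_
    rw [dist_eq_norm]; linarith
  have h1 := log_norm_le_lintegral_ball hE hEw hR0.le
  -- Off the null set of zeros of `g`, log‖E‖ = log‖f‖ − log‖g‖ wherever E is nonzero; at a zero of
  -- E the left side is 0 and the right side is nonnegative.
  have h2 : ∫⁻ z in Metric.ball w R, ENNReal.ofReal (Real.log ‖E z‖)
      ≤ ∫⁻ z in Metric.ball w R, ENNReal.ofReal (L - Real.log ‖g z‖) := by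
    refine lintegral_mono_ae ?_
    rw [ae_restrict_iff' measurableSet_ball]
    filter_upwards [ae_ne_zero_of_differentiable hg h0] with z hz hzb
    refine ENNReal.ofReal_le_ofReal ?_
    have hb := hfL z (hsub hzb)
    by_cases hEz : E z = 0
    · rw [hEz]; simp; linarith
    · have := hb.1
      rw [h, norm_mul, Real.log_mul (norm_ne_zero_iff.2 hEz) (norm_ne_zero_iff.2 hz)] at this
      linarith
  have h3 : ∫⁻ z in Metric.ball w R, ENNReal.ofReal (L - Real.log ‖g z‖)
      ≤ ∫⁻ z in Metric.ball z₀ (2 * R), ENNReal.ofReal (L - Real.log ‖g z‖) :=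
    lintegral_mono_set hsub
  have h4 := lintegral_ball_sub_log_norm_le hg h0 (R := 2 * R) (by positivity)
    (fun z hz => (hfL z hz).2)
  have h5 := h1.trans (h2.trans (h3.trans h4))
  have h6 : 0 ≤ Real.pi * (2 * R) ^ 2 * (L - Real.log ‖g z₀‖) := by
    have := (hfL z₀ (Metric.mem_ball_self (by positivity))).2
    have := Real.pi_pos
    have : 0 ≤ L - Real.log ‖g z₀‖ := by linarith
    positivity
  rw [ENNReal.ofReal_le_ofReal_iff h6] at h5
  have h7 : Real.log ‖E w‖ ≤ 4 * (L - Real.log ‖g z₀‖) := by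
    have : 0 < Real.pi * R ^ 2 := by have := Real.pi_pos; positivity
    refine le_of_mul_le_mul_left ?_ this
    linarith
  rw [← Real.log_le_iff_le_exp (norm_pos_iff.2 hEw)]
  refine h7.trans ?_
  have h8 := neg_abs_le (Real.log ‖g z₀‖)
  have h9 : L ≤ (A + B) * (3 * (2 + ‖z₀‖) * (1 + ‖w‖)) := by
    rw [hLdef]
    have : 0 ≤ ‖z₀‖ * ‖w‖ := by positivity
    gcongr
    nlinarith [norm_nonneg z₀, norm_nonneg w]
  have h10 : 0 ≤ |Real.log ‖g z₀‖| * ‖w‖ := by positivity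
  nlinarith

/-- If `f k = h g` for entire functions and `g`, `k` have no common zero, then `g` divides `f`. -/
theorem exists_entire_quotient {f g h k : ℂ → ℂ} (hf : Differentiable ℂ f)
    (hg : Differentiable ℂ g) (hh : Differentiable ℂ h) (hk : Differentiable ℂ k)
    (heq : ∀ z, f z * k z = h z * g z) (hgk : ∀ z, g z = 0 → k z ≠ 0) :
    ∃ E : ℂ → ℂ, Differentiable ℂ E ∧ ∀ z, f z = E z * g z := by
  classical
  -- Near a zero of `g` the function `k` does not vanish, and `heq` identifies f/g with h/k there,
  -- so the singularity is removed explicitly.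
  refine ⟨fun z => if g z = 0 then h z / k z else f z / g z, fun z => ?_, fun z => ?_⟩
  · by_cases hz : g z = 0
    · have hkz := hgk z hz
      have hev : ∀ᶠ y in 𝓝 z, k y ≠ 0 := (hk z).continuousAt.eventually_ne hkz
      refine ((hh z).div (hk z) hkz).congr_of_eventuallyEq ?_
      filter_upwards [hev] with y hy
      split_ifs with hgy
      · rfl
      · rw [Pi.div_apply, div_eq_div_iff hgy hy, heq]
    · have hev : ∀ᶠ y in 𝓝 z, g y ≠ 0 := (hg z).continuousAt.eventually_ne hz
      refine ((hf z).div (hg z) hz).congr_of_eventuallyEq ?_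
      filter_upwards [hev] with y hy
      rw [if_neg hy, Pi.div_apply]
  · dsimp only
    split_ifs with hz
    · have := heq z
      rw [hz, mul_zero] at this
      rw [hz, mul_zero]
      exact (mul_eq_zero.1 this).resolve_right (hgk z hz)
    · field_simp

/-- Cancellation of a nontrivial entire factor: it is nonzero almost everywhere, and a continuous
function vanishing almost everywhere vanishes. -/
theorem exists_ne_zero_mul_of_entire {f g : ℂ → ℂ} (hf : Differentiable ℂ f)
    (hg : Differentiable ℂ g) (h : ∀ z, f z * g z = 0) {z₀ : ℂ} (h0 : g z₀ ≠ 0) : ∀ z, f z = 0 := by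
  have hz := ae_ne_zero_of_differentiable hg h0
  have h1 : f =ᵐ[volume] fun _ => 0 := hz.mono fun z hz => (mul_eq_zero.1 (h z)).resolve_right hz
  exact fun z => congrFun (hf.continuous.ae_eq_iff_eq volume continuous_const |>.1 h1) z

/-- Phragmén–Lindelöf and Liouville: an entire function of exponential type that has the same
limit along the four diagonal rays is constant. -/
theorem ExpType.eq_of_tendsto {f : ℂ → ℂ} (hd : Differentiable ℂ f) (hf : ExpType f) {c : ℂ}
    (hc : ∀ ζ : ℂ, ζ ^ 4 = -1 → Tendsto (fun r : ℝ => f (r * ζ)) atTop (𝓝 c)) (z : ℂ) :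
    f z = c := by
  obtain ⟨A, hA0, hA⟩ := hf.exists_nonneg
  have hray : ∀ ζ : ℂ, ζ ^ 4 = -1 → ∃ M, ∀ r : ℝ, 0 ≤ r → ‖f (r * ζ)‖ ≤ M := by
    intro ζ hζ
    have h1 : ∀ᶠ r : ℝ in atTop, ‖f (r * ζ)‖ ≤ ‖c‖ + 1 :=
      ((hc ζ hζ).norm.eventually_lt_const (by linarith : ‖c‖ < ‖c‖ + 1)).mono fun _ h => h.le
    obtain ⟨R, hR⟩ := eventually_atTop.1 h1
    obtain ⟨M, hM⟩ := (isCompact_Icc (a := (0 : ℝ)) (b := R)).exists_bound_of_continuousOn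
      (f := fun r : ℝ => f (r * ζ))
      (hd.continuous.comp (by fun_prop : Continuous fun r : ℝ => (r : ℂ) * ζ)).continuousOn
    refine ⟨max (‖c‖ + 1) M, fun r hr => ?_⟩
    rcases le_total R r with h | h
    · exact (hR r h).trans (le_max_left _ _)
    · exact (hM r ⟨hr, h⟩).trans (le_max_right _ _)
  obtain ⟨ζ, hζ⟩ : ∃ ζ : ℂ, ζ ^ 4 = -1 := IsAlgClosed.exists_pow_nat_eq (-1) (by norm_num)
  have hζ0 : ζ ≠ 0 := by rintro rfl; norm_num at hζ
  have hζ1 : ‖ζ‖ = 1 := by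
    have : ‖ζ‖ ^ 4 = 1 := by rw [← norm_pow, hζ]; simp
    exact (pow_eq_one_iff_of_nonneg (norm_nonneg _) (by norm_num)).1 this
  -- The four diagonal rays are the half-axes rotated by `ζ`. After this rotation, Phragmén–Lindelöf
  -- applies in each coordinate quadrant, where growth of order below 2 is allowed.
  have hI : ∀ n : ℕ, (ζ * Complex.I ^ n) ^ 4 = -1 := fun n => by
    rw [mul_pow, hζ, ← pow_mul, mul_comm n 4, pow_mul, Complex.I_pow_four, one_pow, mul_one]
  obtain ⟨M0, h0⟩ := hray _ (hI 0)
  obtain ⟨M1, h1⟩ := hray _ (hI 1)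
  obtain ⟨M2, h2⟩ := hray _ (hI 2)
  obtain ⟨M3, h3⟩ := hray _ (hI 3)
  set M := max (max M0 M1) (max M2 M3) with hM
  set g : ℂ → ℂ := fun z => f (z * ζ) with hg
  have hgd : Differentiable ℂ g := hd.comp (by fun_prop)
  have k0 : ∀ x : ℝ, 0 ≤ x → ‖g x‖ ≤ M := fun x hx => by
    refine le_trans ?_ ((le_max_left M0 M1).trans (le_max_left _ (max M2 M3)))
    simpa [hg] using h0 x hx
  have k1 : ∀ x : ℝ, 0 ≤ x → ‖g (x * Complex.I)‖ ≤ M := fun x hx => by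
    refine le_trans ?_ ((le_max_right M0 M1).trans (le_max_left _ (max M2 M3)))
    have := h1 x hx
    rw [pow_one] at this
    simpa [hg, mul_assoc, mul_comm, mul_left_comm] using this
  have k2 : ∀ x : ℝ, x ≤ 0 → ‖g x‖ ≤ M := fun x hx => by
    refine le_trans ?_ ((le_max_left M2 M3).trans (le_max_right (max M0 M1) _))
    simpa [hg] using h2 (-x) (by linarith)
  have k3 : ∀ x : ℝ, x ≤ 0 → ‖g (x * Complex.I)‖ ≤ M := fun x hx => by
    refine le_trans ?_ ((le_max_right M2 M3).trans (le_max_right (max M0 M1) _))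
    have := h3 (-x) (by linarith)
    rw [Complex.I_pow_three] at this
    simpa [hg, mul_assoc, mul_comm, mul_left_comm] using this
  have hB : ∀ S : Set ℂ, ∃ c < (2 : ℝ), ∃ B,
      g =O[Bornology.cobounded ℂ ⊓ 𝓟 S] fun z => Real.exp (B * ‖z‖ ^ c) := by
    intro S
    refine ⟨1, by norm_num, A, Asymptotics.IsBigO.of_bound (Real.exp A) (Eventually.of_forall ?_)⟩
    intro z
    have := hA (z * ζ)
    rw [norm_mul, hζ1, mul_one, mul_add, mul_one, Real.exp_add] at this
    simpa [hg] using this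
  have hbdd : ∀ z, ‖g z‖ ≤ M := by
    intro z
    rcases le_total 0 z.re with hr | hr <;> rcases le_total 0 z.im with hi | hi
    · exact PhragmenLindelof.quadrant_I hgd.diffContOnCl (hB _) k0 k1 hr hi
    · exact PhragmenLindelof.quadrant_IV hgd.diffContOnCl (hB _) k0 k3 hr hi
    · exact PhragmenLindelof.quadrant_II hgd.diffContOnCl (hB _) k2 k1 hr hi
    · exact PhragmenLindelof.quadrant_III hgd.diffContOnCl (hB _) k2 k3 hr hi
  have hconst : ∀ z w, g z = g w := fun z w => hgd.apply_eq_apply_of_bounded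
    ((Metric.isBounded_closedBall (x := (0 : ℂ)) (r := M)).subset (by
      rintro _ ⟨z, rfl⟩; simpa using hbdd z)) z w
  have hlim := hc ζ hζ
  have hval : ∀ r : ℝ, f (r * ζ) = f z := fun r => by
    have := hconst r (z / ζ)
    simpa [hg, div_mul_cancel₀ _ hζ0] using this
  simp only [hval] at hlim
  exact tendsto_nhds_unique tendsto_const_nhds hlim

/-! ### Solutions on the line and Wronskians -/

/-- `y` has derivative `w` and solves `y'' + k y = 0` on the line, in the integrated sense. -/
structure Sol (k y w : ℝ → ℂ) : Prop where
  prim_y : Prim y w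
  prim_w : Prim w fun x => -(k x * y x)

namespace Sol

variable {k k' y w y' w' : ℝ → ℂ}

theorem hasDerivAt (h : Sol k y w) (x : ℝ) : HasDerivAt y (w x) x :=
  h.prim_y.hasDerivAt h.prim_w.continuous x

theorem linComb (h : Sol k y w) (h' : Sol k y' w') (a b : ℂ) :
    Sol k (fun x => a * y x + b * y' x) (fun x => a * w x + b * w' x) where
  prim_y := (h.prim_y.const_mul a).add (h'.prim_y.const_mul b)
  prim_w := by
    convert (h.prim_w.const_mul a).add (h'.prim_w.const_mul b) using 2
    ring

theorem comp_const_add (h : Sol k y w) (c : ℝ) :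
    Sol (fun x => k (c + x)) (fun x => y (c + x)) (fun x => w (c + x)) where
  prim_y := h.prim_y.comp_const_add c
  prim_w := h.prim_w.comp_const_add c

theorem comp_const_sub (h : Sol k y w) (c : ℝ) :
    Sol (fun x => k (c - x)) (fun x => y (c - x)) (fun x => -w (c - x)) where
  prim_y := h.prim_y.comp_const_sub c
  prim_w := by simpa using (h.prim_w.comp_const_sub c).neg

/-- The Wronskian of two solutions is constant on an interval where the potentials agree. -/
theorem wronskian_eq (h : Sol k y w) (h' : Sol k' y' w') {a b : ℝ}
    (hk : ∀ᵐ x, x ∈ Ioo a b → k x = k' x) {s t : ℝ} (hs : s ∈ Icc a b) (ht : t ∈ Icc a b) :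
    y s * w' s - w s * y' s = y t * w' t - w t * y' t := by
  have hp := (h.prim_y.mul h'.prim_w).sub (h.prim_w.mul h'.prim_y)
  have := hp.sub_eq s t
  have hzero : ∫ x in s..t, (w x * w' x + y x * -(k' x * y' x)
      - (-(k x * y x) * y' x + w x * w' x)) = ∫ x in s..t, (0 : ℂ) := by
    refine intervalIntegral.integral_congr_ae ?_
    have h0 : ∀ᵐ x : ℝ, x ≠ a := by simp [ae_iff, measure_singleton]
    have h1 : ∀ᵐ x : ℝ, x ≠ b := by simp [ae_iff, measure_singleton]
    filter_upwards [hk, h0, h1] with x hx h0 h1 hxs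
    have hx1 := uIoc_subset_uIcc hxs
    have hx2 : x ∈ Icc a b := (uIcc_subset_Icc hs ht) hx1
    rw [hx ⟨lt_of_le_of_ne hx2.1 (Ne.symm h0), lt_of_le_of_ne hx2.2 h1⟩]
    ring
  rw [hzero, intervalIntegral.integral_zero] at this
  linear_combination -this

end Sol

/-! ### Volterra operators -/

section Volterra

variable {T : ℝ}

/-- The Volterra operator `f ↦ ∫₀ˣ α f` on the continuous functions on `[0, T]`. -/
noncomputable def volterra (hT : 0 ≤ T) {α : ℝ → ℂ} (hα : Integrable α) :
    C(Icc (0 : ℝ) T, ℂ) →L[ℂ] C(Icc (0 : ℝ) T, ℂ) :=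
  have hint : ∀ (f : C(Icc (0 : ℝ) T, ℂ)) (a b : ℝ),
      IntervalIntegrable (fun t => α t * IccExtend hT f t) volume a b := fun f a b =>
    (hα.intervalIntegrable).mul_continuousOn (f.continuous.Icc_extend' (h := hT)).continuousOn
  LinearMap.mkContinuous
    { toFun := fun f =>
        ⟨fun x => ∫ t in (0 : ℝ)..x, α t * IccExtend hT f t,
          (intervalIntegral.continuous_primitive (hint f) 0).comp continuous_subtype_val⟩
      map_add' := fun f g => by
        ext x
        simp only [ContinuousMap.coe_mk, ContinuousMap.add_apply]
        rw [← intervalIntegral.integral_add (hint f _ _) (hint g _ _)]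
        refine intervalIntegral.integral_congr fun t _ => ?_
        simp [IccExtend, mul_add]
      map_smul' := fun c f => by
        ext x
        simp only [ContinuousMap.coe_mk, ContinuousMap.smul_apply, RingHom.id_apply, smul_eq_mul]
        rw [← intervalIntegral.integral_const_mul]
        refine intervalIntegral.integral_congr fun t _ => ?_
        simp only [IccExtend, Function.comp_apply, ContinuousMap.smul_apply, smul_eq_mul]
        ring }
    (∫ t, ‖α t‖) (fun f => by
      rw [ContinuousMap.norm_le _ (by positivity)]
      intro x
      simp only [LinearMap.coe_mk, AddHom.coe_mk, ContinuousMap.coe_mk]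
      refine (intervalIntegral.norm_integral_le_integral_norm x.2.1).trans ?_
      rw [intervalIntegral.integral_of_le x.2.1, ← integral_mul_const]
      refine (setIntegral_mono (g := fun t => ‖α t‖ * ‖f‖) (hint f 0 x).norm.1
        (hα.norm.mul_const _).integrableOn fun t => ?_).trans
        (setIntegral_le_integral (hα.norm.mul_const _) (Eventually.of_forall fun t => by positivity))
      dsimp only
      rw [norm_mul]
      gcongr
      exact f.norm_coe_le_norm _)

theorem volterra_apply (hT : 0 ≤ T) {α : ℝ → ℂ} (hα : Integrable α)
    (f : C(Icc (0 : ℝ) T, ℂ)) (x : Icc (0 : ℝ) T) :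
    volterra hT hα f x = ∫ t in (0 : ℝ)..x, α t * IccExtend hT f t := rfl

/-- Source of the factorial in the Volterra iteration. As `k` is merely integrable, the power rule
is obtained by induction from the product rule for absolutely continuous functions. -/
theorem integral_mul_primitive_pow {k : ℝ → ℝ} (hk : Integrable k) (n : ℕ) (x : ℝ) :
    ∫ t in (0 : ℝ)..x, k t * (∫ s in (0 : ℝ)..t, k s) ^ n
      = (∫ s in (0 : ℝ)..x, k s) ^ (n + 1) / (n + 1) := by
  set m : ℝ → ℂ := fun x => 0 + ∫ s in (0 : ℝ)..x, (k s : ℂ) with hm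
  have hm' : ∀ x, m x = ((∫ s in (0 : ℝ)..x, k s : ℝ) : ℂ) := fun x => by
    rw [hm]; simp only [zero_add]; exact intervalIntegral.integral_ofReal
  have h1 : Prim m fun x => (k x : ℂ) := Prim.of_integral (fun a b => hk.ofReal.intervalIntegrable) 0 0
  have hp : ∀ n : ℕ, Prim (fun x => m x ^ (n + 1)) fun x => (n + 1) * ((k x : ℂ) * m x ^ n) := by
    intro n
    induction n with
    | zero => simpa using h1
    | succ n ih =>
      have h2 : (fun x => ((n + 1 : ℕ) + 1 : ℂ) * ((k x : ℂ) * m x ^ (n + 1)))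
          = fun x => (n + 1) * ((k x : ℂ) * m x ^ n) * m x + m x ^ (n + 1) * k x := by
        ext x; push_cast; ring
      rw [h2]
      exact ih.mul h1
  have := ((hp n).const_mul (1 / (n + 1))).sub_eq 0 x
  have hn : (n + 1 : ℂ) ≠ 0 := by exact_mod_cast n.succ_ne_zero
  have hzero : m 0 = 0 := by simp [hm]
  rw [hzero] at this
  simp only [hm'] at this
  have h2 : ∫ t in (0 : ℝ)..x, 1 / ((n : ℂ) + 1) * (((n : ℂ) + 1) * ((k t : ℂ) *
      ((∫ s in (0 : ℝ)..t, k s : ℝ) : ℂ) ^ n))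
      = ((∫ t in (0 : ℝ)..x, k t * (∫ s in (0 : ℝ)..t, k s) ^ n : ℝ) : ℂ) := by
    rw [← intervalIntegral.integral_ofReal]
    refine intervalIntegral.integral_congr fun t _ => ?_
    push_cast; field_simp
  rw [h2] at this
  have h3 : (((∫ s in (0 : ℝ)..x, k s) ^ (n + 1) / (n + 1) : ℝ) : ℂ)
    = ((∫ t in (0 : ℝ)..x, k t * (∫ s in (0 : ℝ)..t, k s) ^ n : ℝ) : ℂ) := by
    rw [← this]; push_cast; field_simp; simp
  exact_mod_cast h3.symm

theorem integrable_indicator_one : Integrable ((Ioo 0 T).indicator fun _ => (1 : ℂ)) :=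
  (integrable_indicator_iff measurableSet_Ioo).2 (by simp)

/-- Double integration against a potential. -/
noncomputable def doubleVolterra (hT : 0 ≤ T) {k : ℝ → ℂ} (hk : Integrable k) :
    C(Icc (0 : ℝ) T, ℂ) →L[ℂ] C(Icc (0 : ℝ) T, ℂ) :=
  volterra hT (integrable_indicator_one (T := T)) ∘L volterra hT hk

theorem integral_indicator_one_mul {f : ℝ → ℂ} {x : ℝ} (hx : x ∈ Icc 0 T) :
    ∫ t in (0 : ℝ)..x, (Ioo 0 T).indicator (fun _ => (1 : ℂ)) t * f t = ∫ t in (0 : ℝ)..x, f t := by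
  refine intervalIntegral.integral_congr_ae ?_
  have h1 : ∀ᵐ t : ℝ, t ≠ T := by simp [ae_iff, measure_singleton]
  filter_upwards [h1] with t ht htx
  rw [uIoc_of_le hx.1] at htx
  rw [indicator_of_mem (show t ∈ Ioo 0 T from
    ⟨htx.1, lt_of_le_of_ne (htx.2.trans hx.2) ht⟩), one_mul]

theorem doubleVolterra_apply (hT : 0 ≤ T) {k : ℝ → ℂ} (hk : Integrable k)
    (f : C(Icc (0 : ℝ) T, ℂ)) (x : Icc (0 : ℝ) T) :
    doubleVolterra hT hk f x
      = ∫ s in (0 : ℝ)..x, ∫ t in (0 : ℝ)..s, k t * IccExtend hT f t := by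
  change volterra hT (integrable_indicator_one (T := T)) (volterra hT hk f) x = _
  rw [volterra_apply, integral_indicator_one_mul x.2]
  refine intervalIntegral.integral_congr fun s hs => ?_
  rw [uIcc_of_le x.2.1] at hs
  rw [IccExtend_of_mem hT _ ⟨hs.1, hs.2.trans x.2.2⟩, volterra_apply]

theorem norm_doubleVolterra_le (hT : 0 ≤ T) {k : ℝ → ℂ} (hk : Integrable k)
    (f : C(Icc (0 : ℝ) T, ℂ)) (x : Icc (0 : ℝ) T) :
    ‖doubleVolterra hT hk f x‖ ≤ T * ∫ t in (0 : ℝ)..x, ‖k t‖ * ‖IccExtend hT f t‖ := by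
  have hint : ∀ a b : ℝ, IntervalIntegrable (fun t => ‖k t‖ * ‖IccExtend hT f t‖) volume a b :=
    fun a b => hk.norm.intervalIntegrable.mul_continuousOn
      (f.continuous.Icc_extend' (h := hT)).norm.continuousOn
  have hnn : 0 ≤ ∫ t in (0 : ℝ)..x, ‖k t‖ * ‖IccExtend hT f t‖ :=
    intervalIntegral.integral_nonneg x.2.1 fun t _ => by positivity
  rw [doubleVolterra_apply]
  have h1 : ∀ s ∈ uIoc (0 : ℝ) x, ‖∫ t in (0 : ℝ)..s, k t * IccExtend hT f t‖
      ≤ ∫ t in (0 : ℝ)..x, ‖k t‖ * ‖IccExtend hT f t‖ := by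
    intro s hs
    rw [uIoc_of_le x.2.1] at hs
    refine (intervalIntegral.norm_integral_le_integral_norm hs.1.le).trans ?_
    simp only [norm_mul]
    exact intervalIntegral.integral_mono_interval le_rfl hs.1.le hs.2
      (Eventually.of_forall fun t => by positivity) (hint 0 x)
  refine (intervalIntegral.norm_integral_le_of_norm_le_const h1).trans ?_
  rw [mul_comm, sub_zero, abs_of_nonneg x.2.1]
  gcongr
  exact x.2.2

/-- Each application costs a factor `T` from the outer integration and one more integration against
`‖k‖`, which turns the n-th power of the primitive into the next one divided by n + 1. -/
theorem norm_doubleVolterra_pow_le (hT : 0 ≤ T) {k : ℝ → ℂ} (hk : Integrable k)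
    (f : C(Icc (0 : ℝ) T, ℂ)) (n : ℕ) (x : Icc (0 : ℝ) T) :
    ‖(doubleVolterra hT hk ^ n) f x‖
      ≤ ‖f‖ * (T ^ n * (∫ t in (0 : ℝ)..x, ‖k t‖) ^ n / n.factorial) := by
  induction n generalizing x with
  | zero => simpa using f.norm_coe_le_norm x
  | succ n ih =>
    rw [pow_succ']
    change ‖doubleVolterra hT hk ((doubleVolterra hT hk ^ n) f) x‖ ≤ _
    refine (norm_doubleVolterra_le hT hk _ x).trans ?_
    have hc : Continuous fun t => ∫ s in (0 : ℝ)..t, ‖k s‖ :=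
      intervalIntegral.continuous_primitive (fun a b => hk.norm.intervalIntegrable) 0
    have h1 : ∫ t in (0 : ℝ)..x, ‖k t‖ * ‖IccExtend hT ((doubleVolterra hT hk ^ n) f) t‖
        ≤ ∫ t in (0 : ℝ)..x, (‖f‖ * (T ^ n / n.factorial)) *
          (‖k t‖ * (∫ s in (0 : ℝ)..t, ‖k s‖) ^ n) := by
      refine intervalIntegral.integral_mono_on x.2.1 ?_ ?_ fun t ht => ?_
      · exact hk.norm.intervalIntegrable.mul_continuousOn
          (((doubleVolterra hT hk ^ n) f).continuous.Icc_extend' (h := hT)).norm.continuousOn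
      · exact (hk.norm.intervalIntegrable.mul_continuousOn (hc.pow n).continuousOn).const_mul _
      · have htT : t ∈ Icc 0 T := ⟨ht.1, ht.2.trans x.2.2⟩
        rw [IccExtend_of_mem hT _ htT]
        have := ih ⟨t, htT⟩
        calc _ ≤ ‖k t‖ * (‖f‖ * (T ^ n * (∫ s in (0 : ℝ)..t, ‖k s‖) ^ n / n.factorial)) := by
              gcongr
          _ = _ := by ring
    calc _ ≤ T * ∫ t in (0 : ℝ)..x, (‖f‖ * (T ^ n / n.factorial)) *
          (‖k t‖ * (∫ s in (0 : ℝ)..t, ‖k s‖) ^ n) := by gcongr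
      _ = _ := by
        rw [intervalIntegral.integral_const_mul, integral_mul_primitive_pow hk.norm,
          Nat.factorial_succ]
        have : (n.factorial : ℝ) ≠ 0 := by exact_mod_cast n.factorial_ne_zero
        have : (n + 1 : ℝ) ≠ 0 := by exact_mod_cast n.succ_ne_zero
        push_cast
        field_simp
        ring

/-- The Neumann series inverts 1 − (−K)ⁿ, which is 1 + K times a commuting geometric sum; a
commuting factor of a unit is a unit. -/
theorem _root_.isUnit_one_add_of_norm_pow_lt_one {R : Type*} [NormedRing R]
    [HasSummableGeomSeries R] {K : R} {n : ℕ} (h : ‖K ^ n‖ < 1) : IsUnit (1 + K) := by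
  have h1 : IsUnit (1 - (-K) ^ n) := by
    refine isUnit_one_sub_of_norm_lt_one (lt_of_le_of_lt (le_of_eq ?_) h)
    rcases Nat.even_or_odd n with h | h
    · rw [h.neg_pow]
    · rw [h.neg_pow, norm_neg]
  have h2 : Commute (1 - -K) (∑ i ∈ Finset.range n, (-K) ^ i) := by
    refine Commute.sum_right _ _ _ fun i _ => ?_
    exact ((Commute.one_left _).sub_left (Commute.refl _)).pow_right i
  rw [← mul_neg_geom_sum, h2.isUnit_mul_iff, sub_neg_eq_add] at h1
  exact h1.1

theorem _root_.Differentiable.ringInverse {R : Type*} [NormedRing R] [HasSummableGeomSeries R]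
    [NormedAlgebra ℂ R] {A : ℂ → R} (hA : Differentiable ℂ A) (hu : ∀ z, IsUnit (A z)) :
    Differentiable ℂ fun z => Ring.inverse (A z) := fun z =>
  (differentiableAt_inverse (𝕜 := ℂ) (hu z)).comp z (hA z)

theorem _root_.Differentiable.one_add_algebra {R : Type*} [NormedRing R] [NormedAlgebra ℂ R]
    {A : ℂ → R} (hA : Differentiable ℂ A) : Differentiable ℂ fun z => 1 + A z :=
  hA.const_add 1

theorem differentiable_quadratic {V : Type*} [NormedAddCommGroup V] [NormedSpace ℂ V] (a b c : V) :
    Differentiable ℂ fun z : ℂ => z ^ 2 • a - (2 * z) • b - c := by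
  fun_prop

/-- Powers decay factorially, so some power has norm below 1 however large `k` is. -/
theorem isUnit_one_add_doubleVolterra (hT : 0 ≤ T) {k : ℝ → ℂ} (hk : Integrable k) :
    IsUnit (1 + doubleVolterra hT hk) := by
  set K := doubleVolterra hT hk
  set m := ∫ t, ‖k t‖ with hm
  obtain ⟨n, hn⟩ := ((FloorSemiring.tendsto_pow_div_factorial_atTop (T * m)).eventually_lt_const
    (show (0 : ℝ) < 1 by norm_num)).exists
  have hm0 : 0 ≤ m := integral_nonneg fun t => norm_nonneg _
  have hnorm : ‖K ^ n‖ ≤ (T * m) ^ n / n.factorial := by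
    refine ContinuousLinearMap.opNorm_le_bound _ (by positivity) fun f => ?_
    rw [ContinuousMap.norm_le _ (by positivity)]
    intro x
    refine (norm_doubleVolterra_pow_le hT hk f n x).trans ?_
    rw [mul_comm, mul_pow]
    have h1 : ∫ t in (0 : ℝ)..x, ‖k t‖ ≤ m := by
      rw [intervalIntegral.integral_of_le x.2.1]
      exact setIntegral_le_integral hk.norm (Eventually.of_forall fun t => norm_nonneg _)
    have h2 : 0 ≤ ∫ t in (0 : ℝ)..x, ‖k t‖ :=
      intervalIntegral.integral_nonneg x.2.1 fun t _ => norm_nonneg _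
    gcongr
  exact isUnit_one_add_of_norm_pow_lt_one (R := C(Icc (0 : ℝ) T, ℂ) →L[ℂ] C(Icc (0 : ℝ) T, ℂ))
    (hnorm.trans_lt hn)

end Volterra

/-! ### Families of solutions depending on the spectral parameter -/

/-- The potential of the pencil, cut off to `(0, T)`. -/
noncomputable def potential (T : ℝ) (p q : ℝ → ℂ) (z : ℂ) : ℝ → ℂ :=
  (Ioo 0 T).indicator fun x => z ^ 2 - 2 * z * p x - q x

theorem potential_eq (T : ℝ) (p q : ℝ → ℂ) (z : ℂ) (x : ℝ) :
    potential T p q z x = z ^ 2 * (Ioo 0 T).indicator (fun _ => (1 : ℂ)) x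
      - 2 * z * (Ioo 0 T).indicator p x - (Ioo 0 T).indicator q x := by
  unfold potential
  by_cases hx : x ∈ Ioo 0 T <;> simp [hx]

/-- A family of solutions with Cauchy data `c₀`, `c₁` at `a`, entire in the spectral parameter. -/
structure SolFamily (T : ℝ) (p q : ℝ → ℂ) (a : ℝ) (c₀ c₁ : ℂ) where
  y : ℂ → C(ℝ, ℂ)
  w : ℂ → ℝ → ℂ
  sol : ∀ z, Sol (potential T p q z) (y z) (w z)
  y_base : ∀ z, y z a = c₀
  w_base : ∀ z, w z a = c₁
  diff_y : Differentiable ℂ fun z => (y z).restrict (Icc 0 T)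
  diff_w : ∀ x ∈ Icc 0 T, Differentiable ℂ fun z => w z x

/-- The Cauchy problem is (1 + K_z) y = c₀ + c₁x with K_z the double Volterra operator. It is
quadratic in z, and 1 + K_z is always invertible, so y is entire in z as an element of C[0, T]. -/
theorem nonempty_solFamily_zero {T : ℝ} (hT : 0 ≤ T) {p q : ℝ → ℂ} (hp : IntegrableOn p (Ioo 0 T))
    (hq : IntegrableOn q (Ioo 0 T)) (c₀ c₁ : ℂ) : Nonempty (SolFamily T p q 0 c₀ c₁) := by
  have ip : Integrable ((Ioo 0 T).indicator p) := hp.integrable_indicator measurableSet_Ioo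
  have iq : Integrable ((Ioo 0 T).indicator q) := hq.integrable_indicator measurableSet_Ioo
  have i1 := integrable_indicator_one (T := T)
  have ik : ∀ z, Integrable (potential T p q z) := fun z => by
    rw [funext (potential_eq T p q z)]
    exact ((i1.const_mul _).sub (ip.const_mul _)).sub iq
  have hdec : ∀ z, volterra hT (ik z)
      = z ^ 2 • volterra hT i1 - (2 * z) • volterra hT ip - volterra hT iq := by
    intro z
    ext f x
    have hint : ∀ {α : ℝ → ℂ}, Integrable α → IntervalIntegrable
        (fun t => α t * IccExtend hT f t) volume 0 x := fun h =>
      h.intervalIntegrable.mul_continuousOn (f.continuous.Icc_extend' (h := hT)).continuousOn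
    simp only [sub_apply, smul_apply,
      ContinuousMap.sub_apply, ContinuousMap.smul_apply, volterra_apply, smul_eq_mul]
    rw [← intervalIntegral.integral_const_mul, ← intervalIntegral.integral_const_mul,
      ← intervalIntegral.integral_sub ((hint i1).const_mul _) ((hint ip).const_mul _),
      ← intervalIntegral.integral_sub (((hint i1).const_mul _).sub ((hint ip).const_mul _))
        (hint iq)]
    refine intervalIntegral.integral_congr fun t _ => ?_
    rw [potential_eq]; ring
  have hdv : Differentiable ℂ fun z => volterra hT (ik z) := by
    rw [funext hdec]
    exact differentiable_quadratic (V := C(Icc (0 : ℝ) T, ℂ) →L[ℂ] C(Icc (0 : ℝ) T, ℂ)) _ _ _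
  have hdK : Differentiable ℂ fun z => 1 + doubleVolterra hT (ik z) := by
    refine Differentiable.one_add_algebra (R := C(Icc (0 : ℝ) T, ℂ) →L[ℂ] C(Icc (0 : ℝ) T, ℂ)) ?_
    unfold doubleVolterra
    exact (differentiable_const _).clm_comp hdv
  set f₀ : C(Icc (0 : ℝ) T, ℂ) := ⟨fun x => c₀ + c₁ * ((x : ℝ) : ℂ), by fun_prop⟩ with hf₀
  set Y : ℂ → C(Icc (0 : ℝ) T, ℂ) := fun z => Ring.inverse (1 + doubleVolterra hT (ik z)) f₀ with hY
  have hdY : Differentiable ℂ Y := by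
    have h1 := Differentiable.ringInverse (R := C(Icc (0 : ℝ) T, ℂ) →L[ℂ] C(Icc (0 : ℝ) T, ℂ)) hdK
      fun z => isUnit_one_add_doubleVolterra hT (ik z)
    exact h1.clm_apply (differentiable_const f₀)
  have hYeq : ∀ z (x : Icc (0 : ℝ) T), Y z x + doubleVolterra hT (ik z) (Y z) x
      = c₀ + c₁ * ((x : ℝ) : ℂ) := by
    intro z x
    have h1 := Ring.mul_inverse_cancel (M₀ := C(Icc (0 : ℝ) T, ℂ) →L[ℂ] C(Icc (0 : ℝ) T, ℂ)) _ (isUnit_one_add_doubleVolterra hT (ik z))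
    have h2 := congrArg (fun A => A f₀ x) h1
    simpa [hf₀] using h2
  set α : ℂ → ℝ → ℂ := fun z t => potential T p q z t * IccExtend hT (Y z) t with hα
  have iα : ∀ z a b, IntervalIntegrable (α z) volume a b := fun z a b =>
    (ik z).intervalIntegrable.mul_continuousOn ((Y z).continuous.Icc_extend' (h := hT)).continuousOn
  set w : ℂ → ℝ → ℂ := fun z x => c₁ + ∫ t in (0 : ℝ)..x, -α z t with hw
  have hpw : ∀ z, Prim (w z) fun t => -α z t := fun z =>
    Prim.of_integral (fun a b => (iα z a b).neg) c₁ 0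
  set y : ℂ → ℝ → ℂ := fun z x => c₀ + ∫ t in (0 : ℝ)..x, w z t with hy
  have hpy : ∀ z, Prim (y z) (w z) := fun z =>
    Prim.of_integral (fun a b => (hpw z).continuous.intervalIntegrable a b) c₀ 0
  have hyY : ∀ z (x : Icc (0 : ℝ) T), y z x = Y z x := by
    intro z x
    have h1 := hYeq z x
    rw [doubleVolterra_apply] at h1
    simp only [hy, hw, intervalIntegral.integral_neg]
    have hc : Continuous fun s => ∫ t in (0 : ℝ)..s, α z t :=
      intervalIntegral.continuous_primitive (iα z) 0
    rw [intervalIntegral.integral_add (continuous_const.intervalIntegrable _ _)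
      (hc.fun_neg.intervalIntegrable _ _), intervalIntegral.integral_neg,
      intervalIntegral.integral_const]
    simp only [sub_zero, Complex.real_smul]
    linear_combination -h1
  have hsol : ∀ z, Sol (potential T p q z) (y z) (w z) := fun z => by
    refine ⟨hpy z, ?_⟩
    -- `y z` and the extension of `Y z` may differ outside the interval, but there the potential
    -- vanishes.
    have : (fun t => -(potential T p q z t * y z t)) = fun t => -α z t := by
      ext t
      by_cases ht : t ∈ Ioo 0 T
      · simp only [hα]
        rw [IccExtend_of_mem hT _ (Ioo_subset_Icc_self ht), ← hyY z ⟨t, Ioo_subset_Icc_self ht⟩]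
      · simp [hα, potential, ht]
    rw [this]
    exact hpw z
  refine ⟨⟨fun z => ⟨y z, (hpy z).continuous⟩, w, hsol, fun z => by simp [hy], fun z => by simp [hw],
    ?_, ?_⟩⟩
  · have : (fun z => ContinuousMap.restrict (Icc 0 T) ⟨y z, (hpy z).continuous⟩) = Y := by
      ext z x
      exact hyY z x
    rw [this]; exact hdY
  · intro x hx
    have : (fun z => w z x) = fun z => c₁ - volterra hT (ik z) (Y z) ⟨x, hx⟩ := by
      ext z
      rw [volterra_apply]
      simp only [hw, intervalIntegral.integral_neg]
      ring
    rw [this]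
    refine (differentiable_const _).sub ?_
    exact (ContinuousMap.evalCLM ℂ (⟨x, hx⟩ : Icc (0 : ℝ) T)).differentiable.comp
      (hdv.clm_apply hdY)

theorem SolFamily.diff_eval {T : ℝ} {p q : ℝ → ℂ} {a : ℝ} {c₀ c₁ : ℂ} (X : SolFamily T p q a c₀ c₁)
    {x : ℝ} (hx : x ∈ Icc 0 T) : Differentiable ℂ fun z => X.y z x := by
  have h : Differentiable ℂ fun z => ContinuousMap.evalCLM ℂ (⟨x, hx⟩ : Icc (0 : ℝ) T)
      ((X.y z).restrict (Icc 0 T)) := (ContinuousLinearMap.differentiable _).comp X.diff_y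
  exact h

/-- The system based at 0 has Wronskian 1, so Cramer's rule gives entire coefficients for any Cauchy
data at `a`. -/
theorem nonempty_solFamily {T : ℝ} (hT : 0 ≤ T) {p q : ℝ → ℂ} (hp : IntegrableOn p (Ioo 0 T))
    (hq : IntegrableOn q (Ioo 0 T)) {a : ℝ} (ha : a ∈ Icc 0 T) (c₀ c₁ : ℂ) :
    Nonempty (SolFamily T p q a c₀ c₁) := by
  obtain ⟨X⟩ := nonempty_solFamily_zero hT hp hq 1 0
  obtain ⟨Y⟩ := nonempty_solFamily_zero hT hp hq 0 1
  have hW : ∀ z, X.y z a * Y.w z a - X.w z a * Y.y z a = 1 := fun z => by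
    rw [(X.sol z).wronskian_eq (Y.sol z) (a := 0) (b := T) (by simp) ha (left_mem_Icc.2 hT),
      X.y_base, X.w_base, Y.y_base, Y.w_base]
    ring
  set A : ℂ → ℂ := fun z => c₀ * Y.w z a - c₁ * Y.y z a with hA
  set B : ℂ → ℂ := fun z => c₁ * X.y z a - c₀ * X.w z a with hB
  have hdA : Differentiable ℂ A :=
    ((Y.diff_w a ha).const_mul _).sub ((Y.diff_eval ha).const_mul _)
  have hdB : Differentiable ℂ B :=
    ((X.diff_eval ha).const_mul _).sub ((X.diff_w a ha).const_mul _)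
  refine ⟨⟨fun z => ⟨fun x => A z * X.y z x + B z * Y.y z x, by fun_prop⟩,
    fun z x => A z * X.w z x + B z * Y.w z x, fun z => (X.sol z).linComb (Y.sol z) _ _,
    fun z => ?_, fun z => ?_, ?_, fun x hx => ?_⟩⟩
  · simp only [ContinuousMap.coe_mk, hA, hB]
    linear_combination c₀ * hW z
  · simp only [hA, hB]
    linear_combination c₁ * hW z
  · exact (hdA.smul X.diff_y).add (hdB.smul Y.diff_y)
  · exact (hdA.mul (X.diff_w x hx)).add (hdB.mul (Y.diff_w x hx))

/-- A solution is determined by its Cauchy data, also between pencils that agree on an interval. -/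
theorem Sol.eq_linComb {k k' u w v₁ w₁ v₂ w₂ : ℝ → ℂ} (h : Sol k' u w) (h₁ : Sol k v₁ w₁)
    (h₂ : Sol k v₂ w₂) {b c a t : ℝ} (hk : ∀ᵐ x, x ∈ Ioo b c → k' x = k x) (ha : a ∈ Icc b c)
    (hv₁ : v₁ a = 1) (hw₁ : w₁ a = 0) (hv₂ : v₂ a = 0) (hw₂ : w₂ a = 1) (ht : t ∈ Icc b c) :
    u t = u a * v₁ t + w a * v₂ t ∧ w t = u a * w₁ t + w a * w₂ t := by
  -- The Wronskians of `u` with both basis solutions are carried from `a` to `t`; they form a linear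
  -- system of determinant 1 for `u t`, `w t`.
  have e1 := h.wronskian_eq h₁ hk ht ha
  have e2 := h.wronskian_eq h₂ hk ht ha
  have e3 := h₁.wronskian_eq h₂ (a := b) (b := c) (by simp) ht ha
  simp only [hv₁, hw₁, hv₂, hw₂] at e1 e2 e3
  constructor
  · linear_combination v₁ t * e2 - v₂ t * e1 - u t * e3
  · linear_combination w₁ t * e2 - w₂ t * e1 - w t * e3

/-! ### Asymptotics of solutions for large spectral parameter -/

/-- Bounds on the coefficients of a pencil on the line; `d` is the derivative of `p`. -/
structure PencilCoeff (B : ℝ) (p d q : ℝ → ℂ) : Prop where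
  prim : Prim p d
  int_d : Integrable d
  int_q : Integrable q
  norm_p_le : ∀ x, ‖p x‖ ≤ B
  int_d_le : ∫ x, ‖d x‖ ≤ B
  int_q_le : ∫ x, ‖q x‖ ≤ B

namespace PencilCoeff

variable {B : ℝ} {p d q : ℝ → ℂ}

theorem neg (h : PencilCoeff B p d q) : PencilCoeff B (fun x => -p x) (fun x => -d x) q where
  prim := h.prim.neg
  int_d := h.int_d.neg
  int_q := h.int_q
  norm_p_le x := by simpa using h.norm_p_le x
  int_d_le := by simpa using h.int_d_le
  int_q_le := h.int_q_le

theorem comp_const_add (h : PencilCoeff B p d q) (c : ℝ) :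
    PencilCoeff B (fun x => p (c + x)) (fun x => d (c + x)) (fun x => q (c + x)) where
  prim := h.prim.comp_const_add c
  int_d := h.int_d.comp_add_left c
  int_q := h.int_q.comp_add_left c
  norm_p_le _ := h.norm_p_le _
  int_d_le := (integral_add_left_eq_self (fun x => ‖d x‖) c).le.trans h.int_d_le
  int_q_le := (integral_add_left_eq_self (fun x => ‖q x‖) c).le.trans h.int_q_le

theorem comp_const_sub (h : PencilCoeff B p d q) (c : ℝ) :
    PencilCoeff B (fun x => p (c - x)) (fun x => -d (c - x)) (fun x => q (c - x)) where
  prim := h.prim.comp_const_sub c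
  int_d := (h.int_d.comp_sub_left c).neg
  int_q := h.int_q.comp_sub_left c
  norm_p_le _ := h.norm_p_le _
  int_d_le := by
    simp only [norm_neg]
    exact (integral_sub_left_eq_self (fun x => ‖d x‖) volume c).le.trans h.int_d_le
  int_q_le := (integral_sub_left_eq_self (fun x => ‖q x‖) volume c).le.trans h.int_q_le

theorem nonneg (h : PencilCoeff B p d q) : 0 ≤ B := (norm_nonneg _).trans (h.norm_p_le 0)

theorem intervalIntegrable_rhs (h : PencilCoeff B p d q) (c : ℂ) (a b : ℝ) :
    IntervalIntegrable (fun x => q x + p x ^ 2 + c * d x) volume a b :=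
  (h.int_q.intervalIntegrable.add ((h.prim.continuous.pow 2).intervalIntegrable _ _)).add
    (h.int_d.intervalIntegrable.const_mul c)

theorem integral_norm_rhs_le (h : PencilCoeff B p d q) {c : ℂ} (hc : ‖c‖ = 1) {s L : ℝ}
    (hs : 0 ≤ s) (hL : s ≤ L) :
    ∫ x in (0 : ℝ)..s, ‖q x + p x ^ 2 + c * d x‖ ≤ B + B ^ 2 * L + B := by
  have hB := h.nonneg
  have i1 : IntervalIntegrable (fun x => ‖q x‖) volume 0 s := h.int_q.norm.intervalIntegrable
  have i2 : IntervalIntegrable (fun _ : ℝ => B ^ 2) volume 0 s :=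
    continuous_const.intervalIntegrable _ _
  have i3 : IntervalIntegrable (fun x => ‖d x‖) volume 0 s := h.int_d.norm.intervalIntegrable
  have le1 : ∫ x in (0 : ℝ)..s, ‖q x‖ ≤ B := by
    rw [intervalIntegral.integral_of_le hs]
    exact (setIntegral_le_integral h.int_q.norm
      (Eventually.of_forall fun _ => norm_nonneg _)).trans h.int_q_le
  have le3 : ∫ x in (0 : ℝ)..s, ‖d x‖ ≤ B := by
    rw [intervalIntegral.integral_of_le hs]
    exact (setIntegral_le_integral h.int_d.norm
      (Eventually.of_forall fun _ => norm_nonneg _)).trans h.int_d_le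
  have le2 : ∫ x in (0 : ℝ)..s, B ^ 2 ≤ B ^ 2 * L := by
    rw [intervalIntegral.integral_const, sub_zero, smul_eq_mul, mul_comm]
    gcongr
  calc _ ≤ ∫ x in (0 : ℝ)..s, (‖q x‖ + B ^ 2 + ‖d x‖) := by
        refine intervalIntegral.integral_mono_on hs (h.intervalIntegrable_rhs c 0 s).norm
          ((i1.add i2).add i3) fun x _ => ?_
        refine (norm_add_le _ _).trans ?_
        rw [norm_mul, hc, one_mul]
        gcongr
        refine (norm_add_le _ _).trans ?_
        rw [norm_pow]
        gcongr
        exact h.norm_p_le x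
    _ = (∫ x in (0 : ℝ)..s, ‖q x‖) + (∫ x in (0 : ℝ)..s, B ^ 2) + ∫ x in (0 : ℝ)..s, ‖d x‖ := by
        rw [intervalIntegral.integral_add (i1.add i2) i3, intervalIntegral.integral_add i1 i2]
    _ ≤ _ := by gcongr

end PencilCoeff

/-- Variation of constants with integrating factor exp(−E). -/
theorem duhamel {E n A α g : ℝ → ℂ} (hE : ∀ x, HasDerivAt E (n x) x) (hn : Continuous n)
    (hE0 : E 0 = 0) (hA : Prim A α) {s : ℝ} (hs : 0 ≤ s)
    (h : ∀ᵐ x, x ∈ Ioo 0 s → α x = n x * A x + g x) :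
    A s = Complex.exp (E s) * A 0 + ∫ x in (0 : ℝ)..s, Complex.exp (E s - E x) * g x := by
  have hEc : Continuous E := continuous_iff_continuousAt.2 fun x => (hE x).continuousAt
  have h1 : Prim (fun x => Complex.exp (-E x)) (fun x => Complex.exp (-E x) * -n x) :=
    Prim.of_hasDerivAt (fun x => (hE x).neg.cexp) (by fun_prop)
  have h2 := (h1.mul hA).sub_eq 0 s
  have h3 : ∫ x in (0 : ℝ)..s, (Complex.exp (-E x) * -n x * A x + Complex.exp (-E x) * α x)
      = ∫ x in (0 : ℝ)..s, Complex.exp (-E x) * g x := by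
    refine intervalIntegral.integral_congr_ae ?_
    have h0 : ∀ᵐ x : ℝ, x ≠ s := by simp [ae_iff, measure_singleton]
    filter_upwards [h, h0] with x hx h0 hxs
    rw [uIoc_of_le hs] at hxs
    rw [hx ⟨hxs.1, lt_of_le_of_ne hxs.2 h0⟩]
    ring
  have h4 : ∫ x in (0 : ℝ)..s, Complex.exp (E s - E x) * g x
      = Complex.exp (E s) * ∫ x in (0 : ℝ)..s, Complex.exp (-E x) * g x := by
    rw [← intervalIntegral.integral_const_mul]
    refine intervalIntegral.integral_congr fun x _ => ?_
    rw [sub_eq_add_neg, Complex.exp_add]; ring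
  rw [h3, hE0, neg_zero, Complex.exp_zero, one_mul] at h2
  rw [h4, ← h2, mul_sub, ← mul_assoc, ← Complex.exp_add]
  simp

theorem norm_intervalIntegral_le_mul {f g : ℝ → ℂ} {s c G : ℝ} (hs : 0 ≤ s) (hc : 0 ≤ c)
    (h : ∀ x ∈ Icc 0 s, ‖f x‖ ≤ c * ‖g x‖) (hg : IntervalIntegrable g volume 0 s)
    (hG : ∫ x in (0 : ℝ)..s, ‖g x‖ ≤ G) : ‖∫ x in (0 : ℝ)..s, f x‖ ≤ c * G := by
  refine (intervalIntegral.norm_integral_le_of_norm_le hs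
    (Eventually.of_forall fun x hx => h x ⟨hx.1.le, hx.2⟩) (hg.norm.const_mul c)).trans ?_
  rw [intervalIntegral.integral_const_mul]
  gcongr

/-- The phase of the leading term of the asymptotics. -/
noncomputable def phase (p : ℝ → ℂ) (z : ℂ) (s : ℝ) : ℂ :=
  -Complex.I * z * s + Complex.I * ∫ x in (0 : ℝ)..s, p x

/-! ### Growth and leading term of solutions for large z in the upper half-plane -/

section WKB

variable {B L : ℝ} {p d q k y w : ℝ → ℂ} {z : ℂ} {l : ℝ}

theorem PencilCoeff.hasDerivAt_phase (h : PencilCoeff B p d q) (z : ℂ) (s : ℝ) :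
    HasDerivAt (phase p z) (-Complex.I * z + Complex.I * p s) s := by
  have h1 : HasDerivAt (fun s : ℝ => ∫ x in (0 : ℝ)..s, p x) (p s) s :=
    intervalIntegral.integral_hasDerivAt_right (h.prim.continuous.intervalIntegrable _ _)
      (h.prim.continuous.stronglyMeasurableAtFilter _ _) h.prim.continuous.continuousAt
  have h2 : HasDerivAt (fun s : ℝ => (s : ℂ)) 1 s := Complex.ofRealCLM.hasDerivAt
  have := (h2.const_mul (-Complex.I * z)).fun_add (h1.const_mul Complex.I)
  rwa [mul_one] at this

theorem PencilCoeff.norm_exp_phase_sub_le (h : PencilCoeff B p d q) {x s : ℝ} (hx : 0 ≤ x)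
    (hxs : x ≤ s) (hs : s ≤ L) :
    ‖Complex.exp (phase p z s - phase p z x)‖ ≤ Real.exp (B * L) * Real.exp (z.im * (s - x)) ∧
    ‖Complex.exp (phase p z x - phase p z s)‖ ≤ Real.exp (B * L) * Real.exp (-(z.im * (s - x))) := by
  have hB := h.nonneg
  have h1 : phase p z s - phase p z x
      = -Complex.I * z * (s - x : ℝ) + Complex.I * ∫ t in x..s, p t := by
    have := intervalIntegral.integral_add_adjacent_intervals
      (h.prim.continuous.intervalIntegrable (μ := volume) 0 x)
      (h.prim.continuous.intervalIntegrable x s)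
    simp only [phase]
    rw [← this]; push_cast; ring
  have h2 : ‖∫ t in x..s, p t‖ ≤ B * L := by
    refine (intervalIntegral.norm_integral_le_of_norm_le_const fun t _ => h.norm_p_le t).trans ?_
    rw [abs_of_nonneg (by linarith)]
    gcongr
    linarith
  have h3 : (phase p z s - phase p z x).re = z.im * (s - x) - (∫ t in x..s, p t).im := by
    rw [h1]; simp [sub_eq_add_neg]
  have h4 := abs_le.1 ((Complex.abs_im_le_norm _).trans h2)
  constructor
  · rw [Complex.norm_exp, h3, ← Real.exp_add]
    exact Real.exp_le_exp.2 (by linarith [h4.1])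
  · rw [← neg_sub, Complex.norm_exp, Complex.neg_re, h3, ← Real.exp_add]
    exact Real.exp_le_exp.2 (by linarith [h4.2])

/-- The two first-order equations satisfied by `w + m y` and `w - m y`, solved. -/
theorem PencilCoeff.duhamel (h : PencilCoeff B p d q) (hy : Sol k y w)
    (hk : ∀ᵐ x, x ∈ Ioo 0 l → k x = z ^ 2 - 2 * z * p x - q x) {s : ℝ} (hs : s ∈ Icc 0 l) :
    (w s + (-Complex.I * z + Complex.I * p s) * y s = Complex.exp (phase p z s) *
        (w 0 + (-Complex.I * z + Complex.I * p 0) * y 0) + ∫ x in (0 : ℝ)..s,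
        Complex.exp (phase p z s - phase p z x) * ((q x + p x ^ 2 + Complex.I * d x) * y x)) ∧
    (w s - (-Complex.I * z + Complex.I * p s) * y s = Complex.exp (-phase p z s) *
        (w 0 - (-Complex.I * z + Complex.I * p 0) * y 0) + ∫ x in (0 : ℝ)..s,
        Complex.exp (phase p z x - phase p z s) * ((q x + p x ^ 2 + -Complex.I * d x) * y x)) := by
  have hc := h.prim.continuous
  have hm : Prim (fun x => -Complex.I * z + Complex.I * p x) (fun x => Complex.I * d x) := by
    simpa using (Prim.const (-Complex.I * z)).add (h.prim.const_mul Complex.I)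
  have hmy := hm.mul hy.prim_y
  have hks : ∀ᵐ x, x ∈ Ioo 0 s → k x = z ^ 2 - 2 * z * p x - q x := by
    filter_upwards [hk] with x hx hxs using hx ⟨hxs.1, hxs.2.trans_le hs.2⟩
  have hI := Complex.I_sq
  constructor
  -- With m = −iz + ip one has m² = −(z − p)², which cancels the powers of z in the potential; only
  -- q + p² ± ip' remains as a source term.
  · refine NonlocalPencil.duhamel (E := phase p z) (h.hasDerivAt_phase z) (by fun_prop)
      (by simp [phase]) (hy.prim_w.add hmy) hs.1 ?_
    filter_upwards [hks] with x hx hxs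
    rw [hx hxs]
    linear_combination (-(z - p x) ^ 2 * y x) * hI
  · have := NonlocalPencil.duhamel (E := fun x => -phase p z x)
      (g := fun x => (q x + p x ^ 2 + -Complex.I * d x) * y x)
      (fun x => (h.hasDerivAt_phase z x).neg) (by fun_prop)
      (by simp [phase]) (hy.prim_w.sub hmy) hs.1 (by
        filter_upwards [hks] with x hx hxs
        rw [hx hxs]
        linear_combination (-(z - p x) ^ 2 * y x) * hI)
    simpa only [neg_sub_neg] using this

theorem PencilCoeff.half_norm_le (h : PencilCoeff B p d q) (hz : 2 * B ≤ ‖z‖) (x : ℝ) :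
    ‖z‖ ≤ 2 * ‖-Complex.I * z + Complex.I * p x‖ ∧ ‖-Complex.I * z + Complex.I * p x‖ ≤ 2 * ‖z‖ := by
  have h1 : -Complex.I * z + Complex.I * p x = -Complex.I * (z - p x) := by ring
  have h2 := h.norm_p_le x
  rw [h1, norm_mul, norm_neg, Complex.norm_I, one_mul]
  have h3 := norm_sub_norm_le z (p x)
  have h4 := norm_sub_le z (p x)
  have := h.nonneg
  constructor <;> linarith

theorem PencilCoeff.norm_remainder_le (h : PencilCoeff B p d q) {c : ℂ} (hc : ‖c‖ = 1)
    {s : ℝ} (hs : s ∈ Icc 0 l) (hl : l ≤ L) {c' : ℝ} (hc' : 0 ≤ c') {e : ℝ → ℂ}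
    (he : ∀ x ∈ Icc 0 s, ‖e x‖ * ‖y x‖ ≤ c') :
    ‖∫ x in (0 : ℝ)..s, e x * ((q x + p x ^ 2 + c * d x) * y x)‖
      ≤ c' * (B + B ^ 2 * L + B) := by
  refine norm_intervalIntegral_le_mul hs.1 hc' (fun x hx => ?_)
    (h.intervalIntegrable_rhs c 0 s) (h.integral_norm_rhs_le hc hs.1 (hs.2.trans hl))
  rw [norm_mul, norm_mul]
  calc _ = (‖e x‖ * ‖y x‖) * ‖q x + p x ^ 2 + c * d x‖ := by ring
    _ ≤ _ := by gcongr; exact he x hx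

/-- Evaluate at the point where |y| e^{−Im z · x} attains its maximum S. The difference of the two
Duhamel formulas is 2my there, its source terms are bounded by a multiple of S, and |m| is
comparable to |z|, so large |z| absorbs them. -/
theorem PencilCoeff.norm_sol_le (h : PencilCoeff B p d q) (hy : Sol k y w)
    (hk : ∀ᵐ x, x ∈ Ioo 0 l → k x = z ^ 2 - 2 * z * p x - q x) (hl0 : 0 ≤ l) (hl : l ≤ L)
    (hz : 0 ≤ z.im) (hz0 : z ≠ 0) (hz1 : 2 * B ≤ ‖z‖)
    (hz2 : 4 * (Real.exp (B * L) * (B + B ^ 2 * L + B)) ≤ ‖z‖) {s : ℝ} (hs : s ∈ Icc 0 l) :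
    ‖y s‖ ≤ 8 * Real.exp (B * L) * (‖y 0‖ + ‖w 0‖ / ‖z‖) * Real.exp (z.im * s) := by
  set K := Real.exp (B * L) with hK
  set G := B + B ^ 2 * L + B with hG
  have hK0 : 0 < K := Real.exp_pos _
  have hB := h.nonneg
  have hG0 : 0 ≤ G := by have := hl0.trans hl; positivity
  have hzn : 0 < ‖z‖ := norm_pos_iff.2 hz0
  have hcont : ContinuousOn (fun x => ‖y x‖ * Real.exp (-(z.im * x))) (Icc 0 l) := by
    have := hy.prim_y.continuous
    fun_prop
  obtain ⟨s₀, hs₀, hmax⟩ := isCompact_Icc.exists_isMaxOn ⟨s, hs⟩ hcont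
  set S := ‖y s₀‖ * Real.exp (-(z.im * s₀)) with hS
  have hS0 : 0 ≤ S := by positivity
  have hyS : ∀ x ∈ Icc 0 l, ‖y x‖ ≤ S * Real.exp (z.im * x) := fun x hx => by
    have := hmax hx
    simp only [mem_ofPred_eq] at this
    calc ‖y x‖ = ‖y x‖ * Real.exp (-(z.im * x)) * Real.exp (z.im * x) := by
          rw [mul_assoc, ← Real.exp_add]; simp
      _ ≤ _ := by gcongr
  have hys₀ : ‖y s₀‖ = S * Real.exp (z.im * s₀) := by
    rw [hS, mul_assoc, ← Real.exp_add]; simp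
  set e := Real.exp (z.im * s₀) with he
  have he0 : 0 < e := Real.exp_pos _
  obtain ⟨hA, hA'⟩ := h.duhamel hy hk hs₀
  set m := fun x => -Complex.I * z + Complex.I * p x with hm
  have hexp0 := h.norm_exp_phase_sub_le (z := z) le_rfl hs₀.1 (hs₀.2.trans hl)
  have hph0 : phase p z 0 = 0 := by simp [phase]
  rw [hph0, sub_zero, sub_zero, zero_sub] at hexp0
  have hle : Real.exp (-(z.im * s₀)) ≤ e := Real.exp_le_exp.2 (by nlinarith [mul_nonneg hz hs₀.1])
  have hint : ∀ x ∈ Icc 0 s₀,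
      ‖Complex.exp (phase p z s₀ - phase p z x)‖ * ‖y x‖ ≤ K * S * e ∧
      ‖Complex.exp (phase p z x - phase p z s₀)‖ * ‖y x‖ ≤ K * S * e := by
    intro x hx
    obtain ⟨h1, h2⟩ := h.norm_exp_phase_sub_le (z := z) hx.1 hx.2 (hs₀.2.trans hl)
    have h3 := hyS x ⟨hx.1, hx.2.trans hs₀.2⟩
    have h4 : Real.exp (-(z.im * (s₀ - x))) ≤ Real.exp (z.im * (s₀ - x)) :=
      Real.exp_le_exp.2 (by nlinarith [mul_nonneg hz (sub_nonneg.2 hx.2)])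
    have h5 : Real.exp (z.im * (s₀ - x)) * Real.exp (z.im * x) = e := by
      rw [← Real.exp_add]; congr 1; ring
    have h6 : K * Real.exp (z.im * (s₀ - x)) * (S * Real.exp (z.im * x)) = K * S * e := by
      rw [← h5]; ring
    constructor
    · rw [← h6]; gcongr
    · rw [← h6]; gcongr; exact h2.trans (by gcongr)
  have hc' : 0 ≤ K * S * e := by positivity
  have hn0 : ∀ ε : ℂ, ‖ε‖ = 1 → ‖w 0 + ε * (m 0 * y 0)‖ ≤ ‖w 0‖ + 2 * ‖z‖ * ‖y 0‖ := fun ε hε => by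
    refine (norm_add_le _ _).trans ?_
    rw [norm_mul, hε, one_mul, norm_mul]
    gcongr
    exact (h.half_norm_le hz1 0).2
  have hAn : ‖w s₀ + m s₀ * y s₀‖ ≤ K * e * (‖w 0‖ + 2 * ‖z‖ * ‖y 0‖) + K * S * e * G := by
    rw [hA]
    refine (norm_add_le _ _).trans (add_le_add ?_
      (h.norm_remainder_le (by simp) hs₀ hl hc' fun x hx => (hint x hx).1))
    rw [norm_mul]
    have := hn0 1 (by simp)
    rw [one_mul] at this
    gcongr
    exact hexp0.1
  have hAn' : ‖w s₀ - m s₀ * y s₀‖ ≤ K * e * (‖w 0‖ + 2 * ‖z‖ * ‖y 0‖) + K * S * e * G := by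
    rw [hA']
    refine (norm_add_le _ _).trans (add_le_add ?_
      (h.norm_remainder_le (by simp) hs₀ hl hc' fun x hx => (hint x hx).2))
    rw [norm_mul]
    have := hn0 (-1) (by simp)
    rw [neg_one_mul, ← sub_eq_add_neg] at this
    gcongr
    exact hexp0.2.trans (by gcongr)
  have h2m : 2 * (m s₀ * y s₀) = (w s₀ + m s₀ * y s₀) - (w s₀ - m s₀ * y s₀) := by ring
  have hmain : ‖z‖ * (S * e) ≤ 2 * (K * e * (‖w 0‖ + 2 * ‖z‖ * ‖y 0‖) + K * S * e * G) := by
    have h1 : ‖2 * (m s₀ * y s₀)‖ ≤ _ := h2m ▸ (norm_sub_le _ _).trans (add_le_add hAn hAn')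
    rw [norm_mul, norm_mul, Complex.norm_ofNat, ← mul_assoc, hys₀] at h1
    calc _ ≤ 2 * ‖m s₀‖ * (S * e) := by gcongr; exact (h.half_norm_le hz1 s₀).1
      _ ≤ _ := h1
      _ = _ := by ring
  have hmain2 : ‖z‖ * S ≤ 2 * K * (‖w 0‖ + 2 * ‖z‖ * ‖y 0‖) + 2 * (K * G) * S := by
    refine le_of_mul_le_mul_right ?_ he0
    linarith
  -- The threshold 4KG ≤ ‖z‖ makes the term 2KGS at most half of the left side.
  have hmain3 : ‖z‖ * S ≤ 4 * K * (‖w 0‖ + 2 * ‖z‖ * ‖y 0‖) := by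
    nlinarith [mul_le_mul_of_nonneg_right hz2 hS0]
  have hmain4 : S ≤ 8 * K * (‖y 0‖ + ‖w 0‖ / ‖z‖) := by
    refine le_of_mul_le_mul_left (hmain3.trans ?_) hzn
    have : ‖z‖ * (8 * K * (‖y 0‖ + ‖w 0‖ / ‖z‖)) = 8 * K * (‖z‖ * ‖y 0‖ + ‖w 0‖) := by field_simp
    rw [this]
    nlinarith [mul_nonneg hK0.le (norm_nonneg (w 0))]
  exact (hyS s hs).trans (by gcongr)

/-- With data (0, 1), subtracting the Duhamel formulas gives 2my = e^E − e^{−E} plus source terms.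
After multiplication by e^{−E} the main term is 1, and the p-part of m joins the error. In the
application S is O(1/|z|). -/
theorem PencilCoeff.norm_leading_sub_one_le (h : PencilCoeff B p d q) (hy : Sol k y w)
    (hk : ∀ᵐ x, x ∈ Ioo 0 l → k x = z ^ 2 - 2 * z * p x - q x) (hl : l ≤ L) (hy0 : y 0 = 0)
    (hw0 : w 0 = 1) (hz : 0 ≤ z.im) {S : ℝ} (hS : 0 ≤ S)
    (hyS : ∀ x ∈ Icc 0 l, ‖y x‖ ≤ S * Real.exp (z.im * x)) {s : ℝ} (hs : s ∈ Icc 0 l) :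
    ‖-2 * Complex.I * z * y s * Complex.exp (-phase p z s) - 1‖
      ≤ Real.exp (B * L) ^ 2 * Real.exp (-(2 * z.im * s))
        + 2 * Real.exp (B * L) ^ 2 * (B + B ^ 2 * L + B) * S
        + 2 * B * Real.exp (B * L) * S := by
  set K := Real.exp (B * L) with hK
  set G := B + B ^ 2 * L + B with hG
  have hK0 : 0 < K := Real.exp_pos _
  have hB := h.nonneg
  obtain ⟨hA, hA'⟩ := h.duhamel hy hk hs
  have hexp0 := h.norm_exp_phase_sub_le (z := z) le_rfl hs.1 (hs.2.trans hl)
  have hph0 : phase p z 0 = 0 := by simp [phase]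
  rw [hph0, sub_zero, sub_zero, zero_sub] at hexp0
  rw [hy0, hw0] at hA hA'
  set I₁ := ∫ x in (0 : ℝ)..s,
        Complex.exp (phase p z s - phase p z x) * ((q x + p x ^ 2 + Complex.I * d x) * y x)
  set I₂ := ∫ x in (0 : ℝ)..s,
        Complex.exp (phase p z x - phase p z s) * ((q x + p x ^ 2 + -Complex.I * d x) * y x)
  set E := phase p z s with hE
  have hint : ∀ x ∈ Icc 0 s,
      ‖Complex.exp (phase p z s - phase p z x)‖ * ‖y x‖ ≤ K * S * Real.exp (z.im * s) ∧
      ‖Complex.exp (phase p z x - phase p z s)‖ * ‖y x‖ ≤ K * S * Real.exp (z.im * s) := by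
    intro x hx
    obtain ⟨h1, h2⟩ := h.norm_exp_phase_sub_le (z := z) hx.1 hx.2 (hs.2.trans hl)
    have h3 := hyS x ⟨hx.1, hx.2.trans hs.2⟩
    have h4 : Real.exp (-(z.im * (s - x))) ≤ Real.exp (z.im * (s - x)) :=
      Real.exp_le_exp.2 (by nlinarith [mul_nonneg hz (sub_nonneg.2 hx.2)])
    have h5 : Real.exp (z.im * (s - x)) * Real.exp (z.im * x) = Real.exp (z.im * s) := by
      rw [← Real.exp_add]; congr 1; ring
    have h6 : K * Real.exp (z.im * (s - x)) * (S * Real.exp (z.im * x))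
      = K * S * Real.exp (z.im * s) := by
      rw [← h5]; ring
    constructor
    · rw [← h6]; gcongr
    · rw [← h6]; gcongr; exact h2.trans (by gcongr)
  have hc' : 0 ≤ K * S * Real.exp (z.im * s) := by positivity
  have h1 : ‖I₁‖ ≤ K * S * Real.exp (z.im * s) * G :=
    h.norm_remainder_le (by simp) hs hl hc' fun x hx => (hint x hx).1
  have h2 : ‖I₂‖ ≤ K * S * Real.exp (z.im * s) * G :=
    h.norm_remainder_le (by simp) hs hl hc' fun x hx => (hint x hx).2
  have hee : Complex.exp (-E) * Complex.exp E = 1 := by rw [← Complex.exp_add]; simp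
  have key : -2 * Complex.I * z * y s * Complex.exp (-E) - 1
      = Complex.exp (-E) * I₁ - Complex.exp (-E) * Complex.exp (-E) - Complex.exp (-E) * I₂
        - 2 * Complex.I * p s * y s * Complex.exp (-E) := by
    linear_combination Complex.exp (-E) * hA - Complex.exp (-E) * hA' + hee
  have hes : Real.exp (-(z.im * s)) * Real.exp (z.im * s) = 1 := by rw [← Real.exp_add]; simp
  have b1 : ‖Complex.exp (-E) * I₁‖ ≤ K ^ 2 * G * S := by
    rw [norm_mul]
    calc _ ≤ (K * Real.exp (-(z.im * s))) * (K * S * Real.exp (z.im * s) * G) := by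
          gcongr; exact hexp0.2
      _ = K ^ 2 * G * S * (Real.exp (-(z.im * s)) * Real.exp (z.im * s)) := by ring
      _ = _ := by rw [hes, mul_one]
  have b2 : ‖Complex.exp (-E) * I₂‖ ≤ K ^ 2 * G * S := by
    rw [norm_mul]
    calc _ ≤ (K * Real.exp (-(z.im * s))) * (K * S * Real.exp (z.im * s) * G) := by
          gcongr; exact hexp0.2
      _ = K ^ 2 * G * S * (Real.exp (-(z.im * s)) * Real.exp (z.im * s)) := by ring
      _ = _ := by rw [hes, mul_one]
  have b3 : ‖Complex.exp (-E) * Complex.exp (-E)‖ ≤ K ^ 2 * Real.exp (-(2 * z.im * s)) := by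
    rw [norm_mul]
    calc _ ≤ (K * Real.exp (-(z.im * s))) * (K * Real.exp (-(z.im * s))) := by
          gcongr <;> exact hexp0.2
      _ = K ^ 2 * (Real.exp (-(z.im * s)) * Real.exp (-(z.im * s))) := by ring
      _ = _ := by rw [← Real.exp_add]; congr 2; ring
  have b4 : ‖2 * Complex.I * p s * y s * Complex.exp (-E)‖ ≤ 2 * B * K * S := by
    simp only [norm_mul, Complex.norm_I, Complex.norm_ofNat, mul_one]
    calc _ ≤ 2 * B * (S * Real.exp (z.im * s)) * (K * Real.exp (-(z.im * s))) := by
          gcongr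
          · exact h.norm_p_le s
          · exact hyS s hs
          · exact hexp0.2
      _ = 2 * B * K * S * (Real.exp (-(z.im * s)) * Real.exp (z.im * s)) := by ring
      _ = _ := by rw [hes, mul_one]
  rw [key]
  have := norm_sub_le (Complex.exp (-E) * I₁ - Complex.exp (-E) * Complex.exp (-E)
    - Complex.exp (-E) * I₂) (2 * Complex.I * p s * y s * Complex.exp (-E))
  have := norm_sub_le (Complex.exp (-E) * I₁ - Complex.exp (-E) * Complex.exp (-E))
    (Complex.exp (-E) * I₂)
  have := norm_sub_le (Complex.exp (-E) * I₁) (Complex.exp (-E) * Complex.exp (-E))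
  linarith

end WKB

/-- Coefficients on `[0, T]` extend to bounded coefficients on the line. -/
theorem exists_pencilCoeff {T : ℝ} (hT : 0 ≤ T) {p q : ℝ → ℂ}
    (hp : AbsolutelyContinuousOnInterval p 0 T) (hq : IntegrableOn q (Ioo 0 T)) :
    ∃ (B : ℝ) (d : ℝ → ℂ), PencilCoeff B (clamp T p) d ((Ioo 0 T).indicator q) := by
  obtain ⟨α, hα, hpα⟩ := hp.exists_ae_hasDerivAt hT
  have h1 := Prim.clamp hT hp hα hpα
  have hcp : ContinuousOn p (Icc 0 T) := by
    have := hp.continuousOn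
    rwa [uIcc_of_le hT] at this
  obtain ⟨M, hM⟩ := isCompact_Icc.exists_bound_of_continuousOn hcp
  have hM' : ∀ x, ‖clamp T p x‖ ≤ M := fun x =>
    hM _ ⟨le_max_left _ _, max_le hT (min_le_right _ _)⟩
  have hM0 : 0 ≤ M := (norm_nonneg _).trans (hM' 0)
  have n1 : 0 ≤ ∫ x, ‖(Ioo 0 T).indicator α x‖ := integral_nonneg fun _ => norm_nonneg _
  have n2 : 0 ≤ ∫ x, ‖(Ioo 0 T).indicator q x‖ := integral_nonneg fun _ => norm_nonneg _
  refine ⟨M + (∫ x, ‖(Ioo 0 T).indicator α x‖) + ∫ x, ‖(Ioo 0 T).indicator q x‖,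
    (Ioo 0 T).indicator α, h1, hα.integrable_indicator measurableSet_Ioo,
    hq.integrable_indicator measurableSet_Ioo, fun x => ?_, ?_, ?_⟩
  · linarith [hM' x]
  · linarith
  · linarith

theorem clamp_of_mem {T : ℝ} {f : ℝ → ℂ} {x : ℝ} (hx : x ∈ Icc 0 T) : clamp T f x = f x := by
  rw [clamp, min_eq_left hx.2, max_eq_right hx.1]

theorem potential_eq_clamp {T : ℝ} {p q : ℝ → ℂ} {z : ℂ} {x : ℝ} (hx : x ∈ Ioo 0 T) :
    potential T p q z x = z ^ 2 - 2 * z * clamp T p x - (Ioo 0 T).indicator q x := by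
  rw [potential, indicator_of_mem hx, indicator_of_mem hx, clamp_of_mem (Ioo_subset_Icc_self hx)]

/-- The normalizing factor of a solution vanishing at `a`, evaluated at `x`. -/
noncomputable def leadingFactor (ε : ℂ) (p : ℝ → ℂ) (z : ℂ) (x a : ℝ) : ℂ :=
  2 * ε * Complex.I * z * Complex.exp (ε * Complex.I * (z * (a - x : ℝ) - ∫ t in x..a, p t))

/-! ### Estimates for any base point and both half-planes -/

section Bounds

variable {T B : ℝ} {p d q : ℝ → ℂ}

/-- Replacing (z, p) by (−z, −p) leaves the potential unchanged and exchanges the half-planes. -/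
theorem PencilCoeff.norm_sol_le_abs {L l : ℝ} {k y w : ℝ → ℂ} {z : ℂ} (h : PencilCoeff B p d q)
    (hy : Sol k y w) (hk : ∀ᵐ x, x ∈ Ioo 0 l → k x = z ^ 2 - 2 * z * p x - q x) (hl0 : 0 ≤ l)
    (hl : l ≤ L) (hz0 : z ≠ 0) (hz1 : 2 * B ≤ ‖z‖)
    (hz2 : 4 * (Real.exp (B * L) * (B + B ^ 2 * L + B)) ≤ ‖z‖) {s : ℝ} (hs : s ∈ Icc 0 l) :
    ‖y s‖ ≤ 8 * Real.exp (B * L) * (‖y 0‖ + ‖w 0‖ / ‖z‖) * Real.exp (|z.im| * s) := by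
  rcases le_total 0 z.im with hz | hz
  · rw [abs_of_nonneg hz]
    exact h.norm_sol_le hy hk hl0 hl hz hz0 hz1 hz2 hs
  · rw [abs_of_nonpos hz]
    have := h.neg.norm_sol_le (z := -z) hy (by
      filter_upwards [hk] with x hx hxl
      rw [hx hxl]; ring) hl0 hl (by simpa using hz) (by simpa using hz0) (by simpa using hz1)
      (by simpa using hz2) hs
    simpa using this

/-- To the right of `x` translate, to the left reflect; either way the Cauchy data move to 0. -/
theorem PencilCoeff.norm_sol_le_of_potential {z : ℂ} {y w : ℝ → ℂ} {p q : ℝ → ℂ}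
    (h : PencilCoeff B (clamp T p) d ((Ioo 0 T).indicator q)) (hz0 : z ≠ 0) (hz1 : 2 * B ≤ ‖z‖)
    (hz2 : 4 * (Real.exp (B * T) * (B + B ^ 2 * T + B)) ≤ ‖z‖)
    (hy : Sol (potential T p q z) y w) {x t : ℝ} (hx : x ∈ Icc 0 T) (ht : t ∈ Icc 0 T) :
    ‖y t‖ ≤ 8 * Real.exp (B * T) * (‖y x‖ + ‖w x‖ / ‖z‖) * Real.exp (|z.im| * |t - x|) := by
  rcases le_total x t with hxt | hxt
  · have := (h.comp_const_add x).norm_sol_le_abs (l := T - x) (L := T) (hy.comp_const_add x)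
      (Eventually.of_forall fun s hs => potential_eq_clamp
        (show x + s ∈ Ioo 0 T from ⟨by linarith [hx.1, hs.1], by linarith [hs.2]⟩))
      (by linarith [hx.2]) (by linarith [hx.1]) hz0 hz1 hz2 (s := t - x)
      ⟨by linarith, by linarith [ht.2]⟩
    rw [abs_of_nonneg (sub_nonneg.2 hxt)]
    simpa using this
  · have := (h.comp_const_sub x).norm_sol_le_abs (l := x) (L := T) (hy.comp_const_sub x)
      (Eventually.of_forall fun s hs => potential_eq_clamp
        (show x - s ∈ Ioo 0 T from ⟨by linarith [hs.2], by linarith [hx.2, hs.1]⟩))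
      hx.1 hx.2 hz0 hz1 hz2 (s := x - t)
      ⟨by linarith, by linarith [ht.1]⟩
    rw [abs_of_nonpos (sub_nonpos.2 hxt), neg_sub]
    simpa using this

/-- Solutions grow at most exponentially away from the point carrying their Cauchy data. -/
theorem exists_norm_sol_le (hT : 0 ≤ T) (hp : AbsolutelyContinuousOnInterval p 0 T)
    (hq : IntegrableOn q (Ioo 0 T)) : ∃ C R : ℝ, 0 ≤ C ∧ 0 < R ∧ ∀ z : ℂ, R ≤ ‖z‖ → ∀ y w : ℝ → ℂ,
    Sol (potential T p q z) y w → ∀ x ∈ Icc 0 T, ∀ t ∈ Icc 0 T,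
    ‖y t‖ ≤ C * (‖y x‖ + ‖w x‖ / ‖z‖) * Real.exp (|z.im| * |t - x|) := by
  obtain ⟨B, d, h⟩ := exists_pencilCoeff hT hp hq
  refine ⟨8 * Real.exp (B * T), max 1 (max (2 * B) (4 * (Real.exp (B * T) * (B + B ^ 2 * T + B)))),
    by positivity, by positivity, fun z hz y w hy x hx t ht => ?_⟩
  rw [max_le_iff, max_le_iff] at hz
  exact h.norm_sol_le_of_potential (norm_pos_iff.1 (by linarith)) hz.2.1 hz.2.2 hy hx ht

theorem exists_norm_leadingFactor_le (hT : 0 ≤ T) (hp : AbsolutelyContinuousOnInterval p 0 T) :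
    ∃ C : ℝ, 0 ≤ C ∧ ∀ (z ε : ℂ), ε = 1 ∧ 0 ≤ z.im ∨ ε = -1 ∧ z.im ≤ 0 →
    ∀ x ∈ Icc 0 T, ∀ a ∈ Icc x T,
    ‖leadingFactor ε p z x a‖ ≤ C * ‖z‖ * Real.exp (-(|z.im| * (a - x))) := by
  have hcp : ContinuousOn p (Icc 0 T) := by
    have := hp.continuousOn
    rwa [uIcc_of_le hT] at this
  obtain ⟨M, hM⟩ := isCompact_Icc.exists_bound_of_continuousOn hcp
  have hM0 : 0 ≤ M := (norm_nonneg _).trans (hM 0 (left_mem_Icc.2 hT))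
  refine ⟨2 * Real.exp (M * T), by positivity, fun z ε hε x hx a ha => ?_⟩
  have h2 : ‖∫ t in x..a, p t‖ ≤ M * T := by
    refine (intervalIntegral.norm_integral_le_of_norm_le_const fun t ht => hM t ?_).trans ?_
    · rw [uIoc_of_le ha.1] at ht
      exact ⟨hx.1.trans ht.1.le, ht.2.trans ha.2⟩
    · rw [abs_of_nonneg (by linarith [ha.1])]
      gcongr
      linarith [hx.1, ha.2]
  have h4 := abs_le.1 ((Complex.abs_im_le_norm _).trans h2)
  have hεn : ‖ε‖ = 1 := by rcases hε with h | h <;> simp [h.1]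
  rw [leadingFactor, norm_mul, norm_mul, norm_mul, norm_mul, hεn, Complex.norm_I, Complex.norm_ofNat]
  have h5 : ‖Complex.exp (ε * Complex.I * (z * (a - x : ℝ) - ∫ t in x..a, p t))‖
      ≤ Real.exp (M * T) * Real.exp (-(|z.im| * (a - x))) := by
    rw [Complex.norm_exp, ← Real.exp_add]
    refine Real.exp_le_exp.2 ?_
    rcases hε with ⟨rfl, hz⟩ | ⟨rfl, hz⟩
    · rw [abs_of_nonneg hz]
      simp
      linarith [h4.2]
    · rw [abs_of_nonpos hz]
      simp
      linarith [h4.1]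
  calc _ ≤ 2 * 1 * 1 * ‖z‖ * (Real.exp (M * T) * Real.exp (-(|z.im| * (a - x)))) := by gcongr
    _ = _ := by ring

/-- Reflection about `a` and a change of sign give data (0, 1) at 0, and the growth bound supplies S
= 8K/|z|. The sign `ε` records whether (z, p) had to be replaced by (−z, −p). -/
theorem exists_norm_leadingFactor_mul_sub_one_le (hT : 0 ≤ T)
    (hp : AbsolutelyContinuousOnInterval p 0 T) (hq : IntegrableOn q (Ioo 0 T)) :
    ∃ C R : ℝ, 0 ≤ C ∧ 0 < R ∧ ∀ z : ℂ, R ≤ ‖z‖ → ∀ ε : ℂ, ε = 1 ∧ 0 ≤ z.im ∨ ε = -1 ∧ z.im ≤ 0 →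
    ∀ y w : ℝ → ℂ, Sol (potential T p q z) y w → ∀ x ∈ Icc 0 T, ∀ a ∈ Icc x T, y a = 0 → w a = 1 →
    ‖leadingFactor ε p z x a * y x - 1‖ ≤ C * (Real.exp (-(2 * |z.im| * (a - x))) + 1 / ‖z‖) := by
  obtain ⟨B, d, h⟩ := exists_pencilCoeff hT hp hq
  have hB := h.nonneg
  set K := Real.exp (B * T) with hK
  set G := B + B ^ 2 * T + B with hG
  have hK0 : 0 < K := Real.exp_pos _
  refine ⟨K ^ 2 + (2 * K ^ 2 * G + 2 * B * K) * (8 * K), max 1 (max (2 * B) (4 * (K * G))),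
    by positivity, by positivity, fun z hz ε hε y w hy x hx a ha hya hwa => ?_⟩
  rw [max_le_iff, max_le_iff] at hz
  have hzn : 0 < ‖z‖ := by linarith
  have haT : a ∈ Icc 0 T := ⟨hx.1.trans ha.1, ha.2⟩
  -- the reflected solution
  have hr : Sol (fun s => potential T p q z (a - s)) (fun s => -1 * y (a - s) + 0 * y (a - s))
      (fun s => -1 * -w (a - s) + 0 * -w (a - s)) :=
    (hy.comp_const_sub a).linComb (hy.comp_const_sub a) (-1) 0
  have hk : ∀ᵐ s, s ∈ Ioo 0 a → potential T p q z (a - s)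
      = z ^ 2 - 2 * z * clamp T p (a - s) - (Ioo 0 T).indicator q (a - s) :=
    Eventually.of_forall fun s hs => potential_eq_clamp
      (show a - s ∈ Ioo 0 T from ⟨by linarith [hs.2], by linarith [ha.2, hs.1]⟩)
  have hbound : ∀ s ∈ Icc 0 a, ‖-1 * y (a - s) + 0 * y (a - s)‖
      ≤ 8 * K / ‖z‖ * Real.exp (|z.im| * s) := fun s hs => by
    have := h.norm_sol_le_of_potential (norm_pos_iff.1 hzn) hz.2.1 hz.2.2 hy haT
      (show a - s ∈ Icc 0 T from ⟨by linarith [hs.2], by linarith [ha.2, hs.1]⟩)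
    rw [hya, hwa, sub_sub_cancel_left, abs_neg, abs_of_nonneg hs.1] at this
    have e : -1 * y (a - s) + 0 * y (a - s) = -y (a - s) := by ring
    rw [e, norm_neg]
    refine this.trans (le_of_eq ?_)
    simp; ring
  have hS : 0 ≤ 8 * K / ‖z‖ := by positivity
  have hs : a - x ∈ Icc 0 a := ⟨by linarith [ha.1], by linarith [hx.1]⟩
  have hphase : ∫ u in (0 : ℝ)..(a - x), clamp T p (a - u) = ∫ t in x..a, p t := by
    rw [intervalIntegral.integral_comp_sub_left (fun u => clamp T p u) a, sub_sub_cancel, sub_zero]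
    refine intervalIntegral.integral_congr fun t ht => ?_
    rw [uIcc_of_le ha.1] at ht
    exact clamp_of_mem ⟨hx.1.trans ht.1, ht.2.trans ha.2⟩
  have hfin : ∀ X : ℝ, X ≤ K ^ 2 * Real.exp (-(2 * |z.im| * (a - x)))
      + 2 * K ^ 2 * G * (8 * K / ‖z‖) + 2 * B * K * (8 * K / ‖z‖) →
      X ≤ (K ^ 2 + (2 * K ^ 2 * G + 2 * B * K) * (8 * K)) *
        (Real.exp (-(2 * |z.im| * (a - x))) + 1 / ‖z‖) := fun X hX => by
    refine hX.trans ?_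
    have e1 : 0 ≤ Real.exp (-(2 * |z.im| * (a - x))) := (Real.exp_pos _).le
    have e2 : 0 ≤ 1 / ‖z‖ := by positivity
    have e3 : 0 ≤ (2 * K ^ 2 * G + 2 * B * K) * (8 * K) := by positivity
    have e4 : 0 ≤ K ^ 2 := by positivity
    have e5 : 8 * K / ‖z‖ = 8 * K * (1 / ‖z‖) := by ring
    rw [e5]
    nlinarith [mul_nonneg e3 e1, mul_nonneg e4 e2]
  refine hfin _ ?_
  rcases hε with ⟨rfl, hzi⟩ | ⟨rfl, hzi⟩
  · rw [abs_of_nonneg hzi] at hbound ⊢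
    have := (h.comp_const_sub a).norm_leading_sub_one_le (L := T) hr hk ha.2 (by simp [hya])
      (by simp [hwa]) hzi hS hbound hs
    convert this using 3
    rw [phase, hphase, leadingFactor, sub_sub_cancel]
    ring_nf
  · rw [abs_of_nonpos hzi] at hbound ⊢
    have := (h.comp_const_sub a).neg.norm_leading_sub_one_le (z := -z) (L := T) hr (by
        filter_upwards [hk] with s hs hsa
        rw [hs hsa]; ring) ha.2 (by simp [hya])
      (by simp [hwa]) (by simpa using hzi) hS (by simpa using hbound) hs
    rw [Complex.neg_im] at this
    convert this using 3
    rw [phase, intervalIntegral.integral_neg, hphase, leadingFactor, sub_sub_cancel]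
    ring_nf

end Bounds

/-! ### Functionals with a jump at the left end point -/

/-- Restriction of a continuous function to `[0, T]`. -/
noncomputable abbrev restr (T : ℝ) (y : C(ℝ, ℂ)) : C(Icc (0 : ℝ) T, ℂ) := y.restrict (Icc 0 T)

/-- `V` is `H y(0)` plus a functional dominated by a finite measure on `(0, a]`. -/
def JumpFunctional (T : ℝ) (V : C(Icc (0 : ℝ) T, ℂ) →L[ℂ] ℂ) (H : ℂ) (μ : Measure ℝ) (a : ℝ) :
    Prop :=
  ∀ y : C(ℝ, ℂ), ‖V (restr T y) - H * y 0‖ ≤ ∫ x in Ioc 0 a, ‖y x‖ ∂μ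

theorem norm_eq_one_of_pow_four {ζ : ℂ} (h : ζ ^ 4 = -1) : ‖ζ‖ = 1 := by
  have h1 : ‖ζ‖ ^ 4 = 1 := by rw [← norm_pow, h, norm_neg, norm_one]
  exact (pow_eq_one_iff_of_nonneg (norm_nonneg _) (by norm_num)).1 h1

theorem im_ne_zero_of_pow_four {ζ : ℂ} (h : ζ ^ 4 = -1) : ζ.im ≠ 0 := by
  intro him
  have h1 : ζ = (ζ.re : ℂ) := by apply Complex.ext <;> simp [him]
  rw [h1] at h
  have h2 : ζ.re ^ 4 = -1 := by exact_mod_cast h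
  nlinarith [sq_nonneg (ζ.re ^ 2)]

theorem exists_sign {ζ : ℂ} (h : ζ ^ 4 = -1) : ∃ ε : ℂ, ∀ r : ℝ, 0 ≤ r →
    (ε = 1 ∧ 0 ≤ (r * ζ).im ∨ ε = -1 ∧ (r * ζ).im ≤ 0) := by
  rcases lt_or_gt_of_ne (im_ne_zero_of_pow_four h) with hi | hi
  · exact ⟨-1, fun r hr => Or.inr ⟨rfl, by simpa using mul_nonpos_of_nonneg_of_nonpos hr hi.le⟩⟩
  · exact ⟨1, fun r hr => Or.inl ⟨rfl, by simpa using mul_nonneg hr hi.le⟩⟩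

theorem norm_ray {ζ : ℂ} (h : ζ ^ 4 = -1) {r : ℝ} (hr : 0 ≤ r) : ‖(r * ζ : ℂ)‖ = r := by
  rw [norm_mul, norm_eq_one_of_pow_four h, mul_one, Complex.norm_real, Real.norm_of_nonneg hr]

theorem abs_im_ray (ζ : ℂ) {r : ℝ} (hr : 0 ≤ r) : |(r * ζ : ℂ).im| = r * |ζ.im| := by
  simp [abs_mul, abs_of_nonneg hr]

theorem tendsto_exp_neg_mul {c : ℝ} (hc : 0 < c) :
    Tendsto (fun r : ℝ => Real.exp (-(r * c))) atTop (𝓝 0) :=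
  Real.tendsto_exp_neg_atTop_nhds_zero.comp (tendsto_id.atTop_mul_const hc)

section

variable {T : ℝ} {p q : ℝ → ℂ} {a : ℝ} {ε ζ : ℂ}

/-- On a diagonal ray |Im z| is proportional to r, so for x < a both error terms tend to zero. -/
theorem tendsto_leadingFactor_mul (hT : 0 ≤ T) (hp : AbsolutelyContinuousOnInterval p 0 T)
    (hq : IntegrableOn q (Ioo 0 T)) (hζ : ζ ^ 4 = -1)
    (hε : ∀ r : ℝ, 0 ≤ r → (ε = 1 ∧ 0 ≤ (r * ζ).im ∨ ε = -1 ∧ (r * ζ).im ≤ 0))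
    (v : SolFamily T p q a 0 1) {x : ℝ} (hx : x ∈ Ico 0 a) (ha : a ≤ T) :
    Tendsto (fun r : ℝ => leadingFactor ε p (r * ζ) x a * v.y (r * ζ) x) atTop (𝓝 1) := by
  obtain ⟨C, R, hC, hR, h⟩ := exists_norm_leadingFactor_mul_sub_one_le hT hp hq
  have hc : 0 < 2 * |ζ.im| * (a - x) := by
    have := abs_pos.2 (im_ne_zero_of_pow_four hζ)
    have : 0 < a - x := sub_pos.2 hx.2
    positivity
  have hlim : Tendsto (fun r : ℝ => C * (Real.exp (-(r * (2 * |ζ.im| * (a - x)))) + 1 / r)) atTop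
      (𝓝 0) := by
    simpa using ((tendsto_exp_neg_mul hc).add (tendsto_inv_atTop_zero (𝕜 := ℝ))).const_mul C
  rw [tendsto_iff_norm_sub_tendsto_zero]
  refine squeeze_zero' (Eventually.of_forall fun _ => norm_nonneg _) ?_ hlim
  filter_upwards [eventually_ge_atTop R] with r hr
  have hr0 : 0 ≤ r := hR.le.trans hr
  refine (h _ (by rwa [norm_ray hζ hr0]) ε (hε r hr0) _ _ (v.sol _) x
    ⟨hx.1, hx.2.le.trans ha⟩ a ⟨hx.2.le, ha⟩ (v.y_base _) (v.w_base _)).trans (le_of_eq ?_)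
  rw [norm_ray hζ hr0, abs_im_ray ζ hr0]
  ring_nf

/-- The atom at 0 dominates: after normalization v₂ at t is O(e^{−|Im z| t}), so its integral over
(0, a] vanishes in the limit. Since `μ` may concentrate near 0, this is dominated convergence and
carries no rate. -/
theorem tendsto_leadingFactor_functional (hT : 0 ≤ T) (hp : AbsolutelyContinuousOnInterval p 0 T)
    (hq : IntegrableOn q (Ioo 0 T)) (hζ : ζ ^ 4 = -1)
    (hε : ∀ r : ℝ, 0 ≤ r → (ε = 1 ∧ 0 ≤ (r * ζ).im ∨ ε = -1 ∧ (r * ζ).im ≤ 0))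
    (v : SolFamily T p q a 0 1) (ha : a ∈ Ioc 0 T) {V : C(Icc (0 : ℝ) T, ℂ) →L[ℂ] ℂ} {H : ℂ}
    {μ : Measure ℝ} [IsFiniteMeasure μ] (hV : JumpFunctional T V H μ a) :
    Tendsto (fun r : ℝ => leadingFactor ε p (r * ζ) 0 a * V (restr T (v.y (r * ζ)))) atTop (𝓝 H) := by
  obtain ⟨C₁, R, hC₁, hR, h₁⟩ := exists_norm_sol_le hT hp hq
  obtain ⟨C₂, hC₂, h₂⟩ := exists_norm_leadingFactor_le hT hp
  have hc : 0 < |ζ.im| := abs_pos.2 (im_ne_zero_of_pow_four hζ)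
  have haT : a ∈ Icc 0 T := ⟨ha.1.le, ha.2⟩
  have hlim : Tendsto (fun r : ℝ => ∫ t in Ioc 0 a, Real.exp (-(r * (|ζ.im| * t))) ∂μ) atTop
      (𝓝 0) := by
    have := tendsto_integral_filter_of_dominated_convergence (μ := μ.restrict (Ioc 0 a))
      (l := atTop) (F := fun (r : ℝ) t => Real.exp (-(r * (|ζ.im| * t)))) (f := fun _ => 0)
      (fun _ => 1) (Eventually.of_forall fun r => by fun_prop) ?_ (integrable_const _) ?_
    · simpa using this
    · filter_upwards [eventually_ge_atTop 0] with r hr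
      filter_upwards [ae_restrict_mem measurableSet_Ioc] with t ht
      rw [Real.norm_of_nonneg (Real.exp_pos _).le, Real.exp_le_one_iff]
      have := ht.1
      simp only [Left.neg_nonpos_iff]
      positivity
    · filter_upwards [ae_restrict_mem measurableSet_Ioc] with t ht
      exact tendsto_exp_neg_mul (mul_pos hc ht.1)
  have hrem : Tendsto (fun r : ℝ => leadingFactor ε p (r * ζ) 0 a *
      (V (restr T (v.y (r * ζ))) - H * v.y (r * ζ) 0)) atTop (𝓝 0) := by
    rw [tendsto_zero_iff_norm_tendsto_zero]
    refine squeeze_zero' (Eventually.of_forall fun _ => norm_nonneg _) ?_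
      (by simpa using hlim.const_mul (C₁ * C₂))
    filter_upwards [eventually_ge_atTop R] with r hr
    have hr0 : 0 ≤ r := hR.le.trans hr
    have hrp : 0 < r := hR.trans_le hr
    have hN := h₂ _ ε (hε r hr0) 0 (left_mem_Icc.2 hT) a haT
    rw [norm_ray hζ hr0, abs_im_ray ζ hr0, sub_zero] at hN
    rw [norm_mul]
    calc _ ≤ ‖leadingFactor ε p (r * ζ) 0 a‖ * ∫ t in Ioc 0 a, ‖v.y (r * ζ) t‖ ∂μ := by
          gcongr; exact hV _
      _ = ∫ t in Ioc 0 a, ‖leadingFactor ε p (r * ζ) 0 a‖ * ‖v.y (r * ζ) t‖ ∂μ :=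
          (integral_const_mul _ _).symm
      _ ≤ ∫ t in Ioc 0 a, C₁ * C₂ * Real.exp (-(r * (|ζ.im| * t))) ∂μ := by
          refine setIntegral_mono_on ?_ ?_ measurableSet_Ioc fun t ht => ?_
          · exact Continuous.integrableOn_Ioc (by fun_prop)
          · exact Continuous.integrableOn_Ioc (by fun_prop)
          · have hy := h₁ _ (by rwa [norm_ray hζ hr0]) _ _ (v.sol (r * ζ)) a haT t
              ⟨ht.1.le, ht.2.trans ha.2⟩
            rw [v.y_base, v.w_base, norm_ray hζ hr0, abs_im_ray ζ hr0,
              abs_of_nonpos (sub_nonpos.2 ht.2), norm_zero, norm_one, zero_add, neg_sub] at hy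
            calc _ ≤ (C₂ * r * Real.exp (-(r * |ζ.im| * a))) *
                  (C₁ * (1 / r) * Real.exp (r * |ζ.im| * (a - t))) := by gcongr
              _ = C₁ * C₂ * (Real.exp (-(r * |ζ.im| * a)) * Real.exp (r * |ζ.im| * (a - t))) := by
                  field_simp
              _ = _ := by rw [← Real.exp_add]; ring_nf
      _ = _ := integral_const_mul _ _
  have h0 := (tendsto_leadingFactor_mul hT hp hq hζ hε v (x := 0) ⟨le_rfl, ha.1⟩ ha.2).const_mul H
  have := h0.add hrem
  rw [mul_one, add_zero] at this
  refine this.congr fun r => ?_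
  ring

theorem SolFamily.expType {c₀ c₁ : ℂ} (v : SolFamily T p q a c₀ c₁) (hT : 0 ≤ T)
    (hp : AbsolutelyContinuousOnInterval p 0 T) (hq : IntegrableOn q (Ioo 0 T)) (ha : a ∈ Icc 0 T)
    (W : C(Icc (0 : ℝ) T, ℂ) →L[ℂ] ℂ) : ExpType fun z => W (restr T (v.y z)) := by
  obtain ⟨C, R, hC, hR, h⟩ := exists_norm_sol_le hT hp hq
  refine ExpType.of_le (C := ‖W‖ * (C * (‖c₀‖ + ‖c₁‖ / R))) (D := T) (R := R)
    (W.continuous.comp v.diff_y.continuous) fun z hz => ?_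
  rw [mul_assoc]
  refine W.le_opNorm_of_le ?_
  rw [ContinuousMap.norm_le _ (by positivity)]
  intro t
  have := h z hz _ _ (v.sol z) a ha t t.2
  rw [v.y_base, v.w_base] at this
  refine this.trans ?_
  have h1 : |(t : ℝ) - a| ≤ T := abs_le.2 ⟨by linarith [t.2.1, ha.2], by linarith [t.2.2, ha.1]⟩
  have h2 : |z.im| * |(t : ℝ) - a| ≤ T * ‖z‖ := by
    rw [mul_comm T]
    exact mul_le_mul (Complex.abs_im_le_norm z) h1 (abs_nonneg _) (norm_nonneg _)
  gcongr

theorem SolFamily.differentiable_functional {c₀ c₁ : ℂ} (v : SolFamily T p q a c₀ c₁)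
    (W : C(Icc (0 : ℝ) T, ℂ) →L[ℂ] ℂ) : Differentiable ℂ fun z => W (restr T (v.y z)) :=
  W.differentiable.comp v.diff_y

theorem SolFamily.expType_eval {c₀ c₁ : ℂ} (v : SolFamily T p q a c₀ c₁) (hT : 0 ≤ T)
    (hp : AbsolutelyContinuousOnInterval p 0 T) (hq : IntegrableOn q (Ioo 0 T)) (ha : a ∈ Icc 0 T)
    {x : ℝ} (hx : x ∈ Icc 0 T) : ExpType fun z => v.y z x :=
  v.expType hT hp hq ha (ContinuousMap.evalCLM ℂ (⟨x, hx⟩ : Icc (0 : ℝ) T))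

/-- A functional applied to the solution with Cauchy data `0`, `1` at `x`. -/
theorem SolFamily.functional_eq (v₁ : SolFamily T p q a 1 0) (v₂ : SolFamily T p q a 0 1)
    {x : ℝ} (g₁ : SolFamily T p q x 1 0) (g : SolFamily T p q x 0 1) (ha : a ∈ Icc 0 T)
    (hx : x ∈ Icc 0 T) (W : C(Icc (0 : ℝ) T, ℂ) →L[ℂ] ℂ) (z : ℂ) :
    W (restr T (g.y z)) = v₁.y z x * W (restr T (v₂.y z)) - v₂.y z x * W (restr T (v₁.y z)) := by
  have hW := (v₁.sol z).wronskian_eq (v₂.sol z) (a := 0) (b := T) (by simp) hx ha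
  rw [v₁.y_base, v₁.w_base, v₂.y_base, v₂.w_base] at hW
  -- The right side vanishes at `x`, and its derivative there is the Wronskian, which is 1.
  have h : restr T (g.y z) = v₁.y z x • restr T (v₂.y z) - v₂.y z x • restr T (v₁.y z) := by
    ext t
    have := (((v₂.sol z).linComb (v₁.sol z) (v₁.y z x) (-v₂.y z x)).eq_linComb (g₁.sol z) (g.sol z)
      (b := 0) (c := T) (by simp) hx (g₁.y_base z) (g₁.w_base z) (g.y_base z) (g.w_base z) t.2).1
    simp only [ContinuousMap.restrict_apply, ContinuousMap.sub_apply, ContinuousMap.smul_apply,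
      smul_eq_mul]
    linear_combination -this - g.y z t * hW
  rw [h, map_sub, map_smul, map_smul, smul_eq_mul, smul_eq_mul]

/-- For x ≥ a/2 no point of [0, a] is farther from x than 0 is, so the growth exponent is x. This is
why each step recovers only the right half of the interval. -/
theorem exists_norm_functional_le (hT : 0 ≤ T) (hp : AbsolutelyContinuousOnInterval p 0 T)
    (hq : IntegrableOn q (Ioo 0 T)) {V : C(Icc (0 : ℝ) T, ℂ) →L[ℂ] ℂ} {H : ℂ}
    {μ : Measure ℝ} [IsFiniteMeasure μ] (ha : a ∈ Ioc 0 T) (hV : JumpFunctional T V H μ a) {x : ℝ}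
    (hx : x ∈ Icc (a / 2) a) (g : SolFamily T p q x 0 1) :
    ∃ C R : ℝ, 0 ≤ C ∧ 0 < R ∧ ∀ z : ℂ, R ≤ ‖z‖ →
      ‖V (restr T (g.y z))‖ ≤ C / ‖z‖ * Real.exp (|z.im| * x) := by
  obtain ⟨C, R, hC, hR, h⟩ := exists_norm_sol_le hT hp hq
  have hxT : x ∈ Icc 0 T := ⟨by linarith [hx.1, ha.1], hx.2.trans ha.2⟩
  refine ⟨(‖H‖ + μ.real (Ioc 0 a)) * C, R, by positivity, hR, fun z hz => ?_⟩
  set b := C / ‖z‖ * Real.exp (|z.im| * x) with hb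
  have hg : ∀ t ∈ Icc 0 a, ‖g.y z t‖ ≤ b := fun t ht => by
    have := h z hz _ _ (g.sol z) x hxT t ⟨ht.1, ht.2.trans ha.2⟩
    rw [g.y_base, g.w_base, norm_zero, norm_one, zero_add] at this
    refine this.trans ?_
    rw [mul_one_div, hb]
    gcongr
    exact abs_le.2 ⟨by linarith [ht.1], by linarith [ht.2, hx.1]⟩
  have h1 : ∫ t in Ioc 0 a, ‖g.y z t‖ ∂μ ≤ ∫ _ in Ioc 0 a, b ∂μ :=
    setIntegral_mono_on (Continuous.integrableOn_Ioc (by fun_prop))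
      (integrable_const _) measurableSet_Ioc fun t ht => hg t ⟨ht.1.le, ht.2⟩
  rw [setIntegral_const, smul_eq_mul] at h1
  have h2 := norm_le_insert' (V (restr T (g.y z))) (H * g.y z 0)
  have h3 : ‖H * g.y z 0‖ ≤ ‖H‖ * b := by
    rw [norm_mul]; gcongr; exact hg 0 ⟨le_rfl, ha.1.le⟩
  calc _ ≤ ‖H‖ * b + μ.real (Ioc 0 a) * b := h2.trans (add_le_add h3 ((hV _).trans h1))
    _ = _ := by rw [hb]; ring

end

/-- The key vanishing statement: if two pencils have the same `V(v₂)`, and `V(v₁)` differ by an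
entire multiple of it, then the cross product of the fundamental systems vanishes on the right half
of the interval. -/
theorem cross_eq_zero {T : ℝ} (hT : 0 ≤ T) {p q p' q' : ℝ → ℂ}
    (hp : AbsolutelyContinuousOnInterval p 0 T) (hq : IntegrableOn q (Ioo 0 T))
    (hp' : AbsolutelyContinuousOnInterval p' 0 T) (hq' : IntegrableOn q' (Ioo 0 T))
    {V : C(Icc (0 : ℝ) T, ℂ) →L[ℂ] ℂ} {H : ℂ} (hH : H ≠ 0) {μ : Measure ℝ} [IsFiniteMeasure μ]
    {a : ℝ} (ha : a ∈ Ioc 0 T) (hV : JumpFunctional T V H μ a)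
    (v₁ : SolFamily T p q a 1 0) (v₂ : SolFamily T p q a 0 1)
    (v₁' : SolFamily T p' q' a 1 0) (v₂' : SolFamily T p' q' a 0 1)
    (h2 : ∀ z, V (restr T (v₂.y z)) = V (restr T (v₂'.y z))) {F : ℂ → ℂ} (hF : Differentiable ℂ F)
    (h1 : ∀ z, V (restr T (v₁.y z)) - V (restr T (v₁'.y z)) = F z * V (restr T (v₂.y z)))
    {x : ℝ} (hx : x ∈ Icc (a / 2) a) (z : ℂ) :
    v₂.y z x * (v₁'.y z x + F z * v₂'.y z x) - v₁.y z x * v₂'.y z x = 0 := by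
  have haT : a ∈ Icc 0 T := ⟨ha.1.le, ha.2⟩
  have hxT : x ∈ Icc 0 T := ⟨by linarith [hx.1, ha.1], hx.2.trans ha.2⟩
  have ip := hp.integrableOn_Ioo hT
  have ip' := hp'.integrableOn_Ioo hT
  obtain ⟨g₁⟩ := nonempty_solFamily hT ip hq hxT 1 0
  obtain ⟨g⟩ := nonempty_solFamily hT ip hq hxT 0 1
  obtain ⟨g₁'⟩ := nonempty_solFamily hT ip' hq' hxT 1 0
  obtain ⟨g'⟩ := nonempty_solFamily hT ip' hq' hxT 0 1
  set D := fun z => V (restr T (v₂.y z)) with hD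
  set P := fun z => v₂.y z x * (v₁'.y z x + F z * v₂'.y z x) - v₁.y z x * v₂'.y z x with hP
  set Q := fun z => v₂.y z x * V (restr T (g'.y z)) - V (restr T (g.y z)) * v₂'.y z x with hQ
  -- Multiplication by `D` eliminates `F`, about whose growth nothing is known; the exponential type
  -- of `P` is then read off from Q/D.
  have hPQ : ∀ z, Q z = P z * D z := fun z => by
    simp only [hQ, hP, hD]
    rw [v₁.functional_eq v₂ g₁ g haT hxT, v₁'.functional_eq v₂' g₁' g' haT hxT]
    linear_combination (-v₁'.y z x * v₂.y z x) * h2 z + v₂.y z x * v₂'.y z x * h1 z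
  have hPd : Differentiable ℂ P :=
    ((v₂.diff_eval hxT).mul ((v₁'.diff_eval hxT).add (hF.mul (v₂'.diff_eval hxT)))).sub
      ((v₁.diff_eval hxT).mul (v₂'.diff_eval hxT))
  have hQe : ExpType Q :=
    ((v₂.expType_eval hT hp hq haT hxT).mul (g'.expType hT hp' hq' hxT V)).sub
      ((g.expType hT hp hq hxT V).mul (v₂'.expType_eval hT hp' hq' haT hxT))
  have hDlim : ∀ (ζ ε : ℂ), ζ ^ 4 = -1 →
      (∀ r : ℝ, 0 ≤ r → (ε = 1 ∧ 0 ≤ (r * ζ).im ∨ ε = -1 ∧ (r * ζ).im ≤ 0)) →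
      Tendsto (fun r : ℝ => leadingFactor ε p (r * ζ) 0 a * D (r * ζ)) atTop (𝓝 H) :=
    fun ζ ε hζ hε => tendsto_leadingFactor_functional hT hp hq hζ hε v₂ ha hV
  obtain ⟨C, R, hC, hR, hy⟩ := exists_norm_sol_le hT hp hq
  obtain ⟨C', R', hC', hR', hy'⟩ := exists_norm_sol_le hT hp' hq'
  obtain ⟨K, S, hK, hS, hg⟩ := exists_norm_functional_le hT hp hq ha hV hx g
  obtain ⟨K', S', hK', hS', hg'⟩ := exists_norm_functional_le hT hp' hq' ha hV hx g'
  obtain ⟨N, hN, hNle⟩ := exists_norm_leadingFactor_le hT hp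
  have hPlim : ∀ ζ : ℂ, ζ ^ 4 = -1 → Tendsto (fun r : ℝ => P (r * ζ)) atTop (𝓝 0) := by
    intro ζ hζ
    obtain ⟨ε, hε⟩ := exists_sign hζ
    have hlim := hDlim ζ ε hζ hε
    -- Both products in `Q` are O(r⁻² e^{|Im z| a}), since (a − x) + x = a, while the leading factor
    -- is O(r e^{−|Im z| a}).
    have hQlim : Tendsto (fun r : ℝ => leadingFactor ε p (r * ζ) 0 a * Q (r * ζ)) atTop (𝓝 0) := by
      rw [tendsto_zero_iff_norm_tendsto_zero]
      refine squeeze_zero' (g := fun r : ℝ => N * (C * K' + K * C') * r⁻¹)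
        (Eventually.of_forall fun _ => norm_nonneg _) ?_
        (by simpa using (tendsto_inv_atTop_zero (𝕜 := ℝ)).const_mul (N * (C * K' + K * C')))
      filter_upwards [eventually_ge_atTop R, eventually_ge_atTop R', eventually_ge_atTop S,
        eventually_ge_atTop S'] with r r1 r2 r3 r4
      have hrp : 0 < r := hR.trans_le r1
      have hn := norm_ray hζ hrp.le
      have b1 := hy _ (by rwa [hn]) _ _ (v₂.sol (r * ζ)) a haT x hxT
      have b2 := hy' _ (by rwa [hn]) _ _ (v₂'.sol (r * ζ)) a haT x hxT
      have b3 := hg _ (by rwa [hn])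
      have b4 := hg' _ (by rwa [hn])
      have b5 := hNle _ ε (hε r hrp.le) 0 (left_mem_Icc.2 hT) a haT
      rw [v₂.y_base, v₂.w_base] at b1
      rw [v₂'.y_base, v₂'.w_base] at b2
      rw [hn, abs_im_ray ζ hrp.le] at b1 b2 b3 b4 b5
      rw [abs_of_nonpos (sub_nonpos.2 hx.2), norm_zero, norm_one, zero_add, neg_sub] at b1 b2
      rw [sub_zero] at b5
      have hexp : Real.exp (-(r * |ζ.im| * a)) *
          (Real.exp (r * |ζ.im| * (a - x)) * Real.exp (r * |ζ.im| * x)) = 1 := by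
        rw [← Real.exp_add, ← Real.exp_add, Real.exp_eq_one_iff]; ring
      rw [norm_mul]
      calc _ ≤ (N * r * Real.exp (-(r * |ζ.im| * a))) *
            ((C * (1 / r) * Real.exp (r * |ζ.im| * (a - x))) * (K' / r * Real.exp (r * |ζ.im| * x))
            + (K / r * Real.exp (r * |ζ.im| * x)) *
              (C' * (1 / r) * Real.exp (r * |ζ.im| * (a - x)))) := by
            gcongr
            refine (norm_sub_le _ _).trans ?_
            rw [norm_mul, norm_mul]
            gcongr
        _ = N * (C * K' + K * C') * (r * (1 / r) * (1 / r)) * (Real.exp (-(r * |ζ.im| * a)) *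
          (Real.exp (r * |ζ.im| * (a - x)) * Real.exp (r * |ζ.im| * x))) := by ring
        _ = _ := by rw [hexp]; field_simp
    have := hQlim.div hlim hH
    rw [zero_div] at this
    refine this.congr' ?_
    filter_upwards [hlim.eventually_ne hH] with r hr
    simp only [Pi.div_apply]
    rw [hPQ, div_eq_iff hr]; ring
  have hζ₀ : ∃ ζ : ℂ, ζ ^ 4 = -1 := IsAlgClosed.exists_pow_nat_eq _ (by norm_num)
  obtain ⟨ζ₀, hζ₀⟩ := hζ₀
  obtain ⟨ε₀, hε₀⟩ := exists_sign hζ₀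
  obtain ⟨r, hr⟩ := ((hDlim ζ₀ ε₀ hζ₀ hε₀).eventually_ne hH).exists
  exact ExpType.eq_of_tendsto hPd (ExpType.of_mul hPd (v₂.differentiable_functional V) hQe
    (v₂.expType hT hp hq haT V) (right_ne_zero_of_mul hr) hPQ) hPlim z

/-! ### From vanishing cross products to equality of the coefficients -/

theorem eq_zero_of_hasDerivAt_of_eqOn {f : ℝ → ℂ} {c : ℂ} {f' : ℂ} {x a b : ℝ} (hx : x ∈ Ioo a b)
    (hf : HasDerivAt f f' x) (h : ∀ t ∈ Ioo a b, f t = c) : f' = 0 := by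
  have h1 : f =ᶠ[𝓝 x] fun _ => c := by
    filter_upwards [Ioo_mem_nhds hx.1 hx.2] with t ht using h t ht
  exact (hf.congr_of_eventuallyEq h1.symm).unique (hasDerivAt_const x c)

/-- The relation reads v₁/v₂ = u/y, and by the Wronskians the two sides have derivatives −1/v₂² and
−1/y². The polynomial form survives zeros of the denominators. -/
theorem sq_eq_sq_of_cross {k k' v₁ w₁ v₂ w₂ u s y r : ℝ → ℂ} (h₁ : Sol k v₁ w₁) (h₂ : Sol k v₂ w₂)
    (hu : Sol k' u s) (hy : Sol k' y r) (hW : ∀ x, v₁ x * w₂ x - w₁ x * v₂ x = 1)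
    (hW' : ∀ x, u x * r x - s x * y x = 1) {b c : ℝ}
    (hP : ∀ x ∈ Ioo b c, v₂ x * u x - v₁ x * y x = 0) {x : ℝ} (hx : x ∈ Ioo b c) :
    v₂ x * v₂ x - y x * y x = 0 := by
  have hd := ((h₂.hasDerivAt x).mul (hu.hasDerivAt x)).sub ((h₁.hasDerivAt x).mul (hy.hasDerivAt x))
  have h0 := eq_zero_of_hasDerivAt_of_eqOn hx hd hP
  have h1 := hP x hx
  linear_combination (-(v₂ x * y x)) * h0 + v₂ x ^ 2 * hW' x * (-1) + y x ^ 2 * hW x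
    + (w₂ x * y x + v₂ x * r x) * h1

/-- Differentiating v² = y² gives vw = yr, and then w² − kv² = r² − k'y². The first two identities
yield w² = r² where v ≠ 0, which leaves k = k'. -/
theorem potential_eq_of_sq {k k' v w y r : ℝ → ℂ} (hv : Sol k v w) (hy : Sol k' y r) {b c : ℝ}
    (h : ∀ x ∈ Ioo b c, v x * v x - y x * y x = 0) :
    ∀ᵐ x, x ∈ Ioo b c → v x ≠ 0 → k x = k' x := by
  have h1 : ∀ x ∈ Ioo b c, v x * w x - y x * r x = 0 := fun x hx => by
    have := eq_zero_of_hasDerivAt_of_eqOn hx (((hv.hasDerivAt x).mul (hv.hasDerivAt x)).sub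
      ((hy.hasDerivAt x).mul (hy.hasDerivAt x))) h
    linear_combination this / 2
  filter_upwards [hv.prim_w.ae_hasDerivAt, hy.prim_w.ae_hasDerivAt] with x hw hr hx hvx
  have h2 := eq_zero_of_hasDerivAt_of_eqOn hx (((hv.hasDerivAt x).mul hw).sub
    ((hy.hasDerivAt x).mul hr)) h1
  have h3 := h x hx
  have h4 := h1 x hx
  have h5 : (k x - k' x) * v x ^ 4 = 0 := by
    linear_combination (-(v x ^ 2)) * h2 + (v x * w x + y x * r x) * h4
      - (k' x * v x ^ 2 + r x ^ 2) * h3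
  exact sub_eq_zero.1 ((mul_eq_zero.1 h5).resolve_right (pow_ne_zero 4 hvx))

section

variable {T : ℝ} {p q p' q' : ℝ → ℂ} {a : ℝ}

theorem SolFamily.wronskian_eq_one (v₁ : SolFamily T p q a 1 0)
    (v₂ : SolFamily T p q a 0 1) (z : ℂ) (x : ℝ) :
    v₁.y z x * v₂.w z x - v₁.w z x * v₂.y z x = 1 := by
  rw [(v₁.sol z).wronskian_eq (v₂.sol z) (a := min x a) (b := max x a) (by simp) (t := a)
    ⟨min_le_left _ _, le_max_left _ _⟩ ⟨min_le_right _ _, le_max_right _ _⟩,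
    v₁.y_base, v₁.w_base, v₂.y_base, v₂.w_base]
  ring

theorem potential_congr {b c : ℝ} (h : ∀ᵐ x, x ∈ Ioo b c → p x = p' x ∧ q x = q' x) (z : ℂ) :
    ∀ᵐ x, x ∈ Ioo b c → potential T p q z x = potential T p' q' z x := by
  filter_upwards [h] with x hx hxbc
  obtain ⟨h1, h2⟩ := hx hxbc
  rw [potential, potential]
  by_cases hxT : x ∈ Ioo 0 T
  · rw [indicator_of_mem hxT, indicator_of_mem hxT, h1, h2]
  · rw [indicator_of_notMem hxT, indicator_of_notMem hxT]

/-- Where the coefficients agree, so do the solutions with the same Cauchy data. -/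
theorem SolFamily.eq_of_coeff_eq {c₀ c₁ : ℂ} (v : SolFamily T p q a c₀ c₁)
    (v' : SolFamily T p' q' a c₀ c₁) (hT : 0 ≤ T) (hp : IntegrableOn p (Ioo 0 T))
    (hq : IntegrableOn q (Ioo 0 T)) {b c : ℝ}
    (h : ∀ᵐ x, x ∈ Ioo b c → p x = p' x ∧ q x = q' x) (ha : a ∈ Icc 0 T) (habc : a ∈ Icc b c)
    (z : ℂ) {t : ℝ} (ht : t ∈ Icc b c) : v.y z t = v'.y z t ∧ v.w z t = v'.w z t := by
  obtain ⟨v₁⟩ := nonempty_solFamily hT hp hq ha 1 0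
  obtain ⟨v₂⟩ := nonempty_solFamily hT hp hq ha 0 1
  have e := (v.sol z).eq_linComb (v₁.sol z) (v₂.sol z) (b := b) (c := c) (by simp) habc
    (v₁.y_base z) (v₁.w_base z) (v₂.y_base z) (v₂.w_base z) ht
  have e' := (v'.sol z).eq_linComb (v₁.sol z) (v₂.sol z) (b := b) (c := c)
    (by filter_upwards [potential_congr h z] with x hx hxbc using (hx hxbc).symm) habc
    (v₁.y_base z) (v₁.w_base z) (v₂.y_base z) (v₂.w_base z) ht
  rw [v.y_base, v.w_base] at e
  rw [v'.y_base, v'.w_base] at e'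
  exact ⟨e.1.trans e'.1.symm, e.2.trans e'.2.symm⟩

/-- The exceptional null set depends on z, so only the countably many z = nζ are used. For fixed x
the asymptotics make v₂(x) nonzero for all large n, and two consecutive n determine both
coefficients. -/
theorem coeff_eq_of_cross (hT : 0 ≤ T) (hp : AbsolutelyContinuousOnInterval p 0 T)
    (hq : IntegrableOn q (Ioo 0 T)) (v₁ : SolFamily T p q a 1 0) (v₂ : SolFamily T p q a 0 1)
    (v₁' : SolFamily T p' q' a 1 0) (v₂' : SolFamily T p' q' a 0 1) (F : ℂ → ℂ) {b : ℝ}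
    (hb : 0 ≤ b) (ha : a ≤ T)
    (h : ∀ x ∈ Ioo b a, ∀ z, v₂.y z x * (v₁'.y z x + F z * v₂'.y z x) - v₁.y z x * v₂'.y z x = 0) :
    ∀ᵐ x, x ∈ Ioo b a → p x = p' x ∧ q x = q' x := by
  obtain ⟨ζ, hζ⟩ : ∃ ζ : ℂ, ζ ^ 4 = -1 := IsAlgClosed.exists_pow_nat_eq _ (by norm_num)
  obtain ⟨ε, hε⟩ := exists_sign hζ
  have hk : ∀ n : ℕ, ∀ᵐ x, x ∈ Ioo b a → v₂.y ((n : ℝ) * ζ) x ≠ 0 →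
      potential T p q ((n : ℝ) * ζ) x = potential T p' q' ((n : ℝ) * ζ) x := fun n => by
    set z : ℂ := (n : ℝ) * ζ
    refine potential_eq_of_sq (v₂.sol z) (v₂'.sol z) fun x hx =>
      sq_eq_sq_of_cross (v₁.sol z) (v₂.sol z) ((v₁'.sol z).linComb (v₂'.sol z) 1 (F z)) (v₂'.sol z)
        (v₁.wronskian_eq_one v₂ z) (fun x => ?_) (fun x hx => ?_) hx
    · linear_combination v₁'.wronskian_eq_one v₂' z x
    · linear_combination h x hx z
  filter_upwards [ae_all_iff.2 hk] with x hx hxba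
  have hlim := tendsto_leadingFactor_mul hT hp hq hζ hε v₂ (x := x) ⟨hb.trans hxba.1.le, hxba.2⟩ ha
  have hev := tendsto_natCast_atTop_atTop.eventually (hlim.eventually_ne one_ne_zero)
  obtain ⟨n, hn⟩ := eventually_atTop.1 hev
  have hxT : x ∈ Ioo 0 T := ⟨hb.trans_lt hxba.1, hxba.2.trans_le ha⟩
  have e1 := hx n hxba (right_ne_zero_of_mul (hn n le_rfl))
  have e2 := hx (n + 1) hxba (right_ne_zero_of_mul (hn (n + 1) (Nat.le_succ n)))
  simp only [potential, indicator_of_mem hxT] at e1 e2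
  push_cast at e1 e2
  have hζ0 : ζ ≠ 0 := by
    rintro rfl
    norm_num at hζ
  have e3 : ζ * (p x - p' x) = 0 := by linear_combination (e1 - e2) / 2
  have e4 := sub_eq_zero.1 ((mul_eq_zero.1 e3).resolve_left hζ0)
  refine ⟨e4, ?_⟩
  rw [e4] at e1
  linear_combination -e1

/-- Once the coefficients agree on the right half, so do the solutions there, and the cross product
collapses to F v₂². As v₂ cannot vanish on an interval, F = 0. -/
theorem step {H : ℂ} {μ : Measure ℝ} [IsFiniteMeasure μ] (hT : 0 ≤ T)
    (hp : AbsolutelyContinuousOnInterval p 0 T) (hq : IntegrableOn q (Ioo 0 T))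
    (hp' : AbsolutelyContinuousOnInterval p' 0 T) (hq' : IntegrableOn q' (Ioo 0 T))
    {V : C(Icc (0 : ℝ) T, ℂ) →L[ℂ] ℂ} (hH : H ≠ 0) (ha : a ∈ Ioc 0 T)
    (hV : JumpFunctional T V H μ a) (v₁ : SolFamily T p q a 1 0) (v₂ : SolFamily T p q a 0 1)
    (v₁' : SolFamily T p' q' a 1 0) (v₂' : SolFamily T p' q' a 0 1)
    (h2 : ∀ z, V (restr T (v₂.y z)) = V (restr T (v₂'.y z))) {F : ℂ → ℂ} (hF : Differentiable ℂ F)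
    (h1 : ∀ z, V (restr T (v₁.y z)) - V (restr T (v₁'.y z)) = F z * V (restr T (v₂.y z))) :
    (∀ᵐ x, x ∈ Ioo (a / 2) a → p x = p' x ∧ q x = q' x) ∧
      ∀ z, V (restr T (v₁.y z)) = V (restr T (v₁'.y z)) := by
  have hcross : ∀ x ∈ Icc (a / 2) a, ∀ z,
      v₂.y z x * (v₁'.y z x + F z * v₂'.y z x) - v₁.y z x * v₂'.y z x = 0 := fun x hx z =>
    cross_eq_zero hT hp hq hp' hq' hH ha hV v₁ v₂ v₁' v₂' h2 hF h1 hx z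
  have ha2 : 0 < a / 2 := half_pos ha.1
  have hag := coeff_eq_of_cross hT hp hq v₁ v₂ v₁' v₂' F ha2.le ha.2
    fun x hx z => hcross x (Ioo_subset_Icc_self hx) z
  refine ⟨hag, fun z => ?_⟩
  have haT : a ∈ Icc 0 T := ⟨ha.1.le, ha.2⟩
  have haI : a ∈ Icc (a / 2) a := ⟨by linarith, le_rfl⟩
  suffices hF0 : F z = 0 by
    have := h1 z
    rwa [hF0, zero_mul, sub_eq_zero] at this
  by_contra hF0
  have hzero : ∀ x ∈ Ioo (a / 2) a, v₂.y z x = 0 := fun x hx => by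
    have e := hcross x (Ioo_subset_Icc_self hx) z
    rw [← (v₁.eq_of_coeff_eq v₁' hT (hp.integrableOn_Ioo hT) hq hag haT haI z
        (Ioo_subset_Icc_self hx)).1,
      ← (v₂.eq_of_coeff_eq v₂' hT (hp.integrableOn_Ioo hT) hq hag haT haI z
        (Ioo_subset_Icc_self hx)).1] at e
    have e' : F z * v₂.y z x ^ 2 = 0 := by linear_combination e
    exact pow_eq_zero_iff two_ne_zero |>.1 ((mul_eq_zero.1 e').resolve_left hF0)
  have hx : 3 * a / 4 ∈ Ioo (a / 2) a := ⟨by linarith, by linarith [ha.1]⟩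
  have hw := eq_zero_of_hasDerivAt_of_eqOn hx ((v₂.sol z).hasDerivAt _) hzero
  have := v₁.wronskian_eq_one v₂ z (3 * a / 4)
  rw [hw, hzero _ hx] at this
  simp at this

/-- Equality of the values of a functional on the solutions passes to smaller intervals. -/
theorem functional_eq_descend {V W : C(Icc (0 : ℝ) T, ℂ) →L[ℂ] ℂ} {b : ℝ} (hT : 0 ≤ T)
    (hp : AbsolutelyContinuousOnInterval p 0 T) (hq : IntegrableOn q (Ioo 0 T))
    (v₁ : SolFamily T p q a 1 0) (v₂ : SolFamily T p q a 0 1)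
    (v₁' : SolFamily T p' q' a 1 0) (v₂' : SolFamily T p' q' a 0 1)
    (hb : 0 ≤ b) (hba : b ≤ a) (ha : a ≤ T)
    (h : ∀ᵐ x, x ∈ Ioo b a → p x = p' x ∧ q x = q' x)
    (h1 : ∀ z, V (restr T (v₁.y z)) = V (restr T (v₁'.y z)))
    (h2 : ∀ z, V (restr T (v₂.y z)) = V (restr T (v₂'.y z)))
    (hVW : ∀ y : C(ℝ, ℂ), (∀ x ∈ Icc b a, y x = 0) → W (restr T y) = V (restr T y))
    {c₀ c₁ : ℂ} (u : SolFamily T p q b c₀ c₁) (u' : SolFamily T p' q' b c₀ c₁) (z : ℂ) :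
    W (restr T (u.y z)) = W (restr T (u'.y z)) := by
  have haT : a ∈ Icc 0 T := ⟨hb.trans hba, ha⟩
  have hbT : b ∈ Icc 0 T := ⟨hb, hba.trans ha⟩
  have hag := fun t ht => u.eq_of_coeff_eq u' hT (hp.integrableOn_Ioo hT) hq h hbT ⟨le_rfl, hba⟩ z
    (t := t) ht
  -- Expansion in the system based at `a`. The coefficients are the Cauchy data of `u` at `a`, which
  -- coincide for both pencils since these agree between `b` and `a`.
  have hr : ∀ {p q : ℝ → ℂ} (v₁ : SolFamily T p q a 1 0) (v₂ : SolFamily T p q a 0 1)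
      (u : SolFamily T p q b c₀ c₁), V (restr T (u.y z))
      = u.y z a * V (restr T (v₁.y z)) + u.w z a * V (restr T (v₂.y z)) := fun v₁ v₂ u => by
    have : restr T (u.y z) = u.y z a • restr T (v₁.y z) + u.w z a • restr T (v₂.y z) := by
      ext t
      exact ((u.sol z).eq_linComb (v₁.sol z) (v₂.sol z) (b := 0) (c := T) (by simp) haT
        (v₁.y_base z) (v₁.w_base z) (v₂.y_base z) (v₂.w_base z) t.2).1
    rw [this, map_add, map_smul, map_smul, smul_eq_mul, smul_eq_mul]
  have hVu : V (restr T (u.y z)) = V (restr T (u'.y z)) := by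
    rw [hr v₁ v₂ u, hr v₁' v₂' u', h1, h2, (hag a ⟨hba, le_rfl⟩).1, (hag a ⟨hba, le_rfl⟩).2]
  have hsub : restr T (u.y z - u'.y z) = restr T (u.y z) - restr T (u'.y z) := rfl
  -- The difference vanishes between `b` and `a`, so truncating the functional does not change its
  -- value.
  have := hVW (u.y z - u'.y z) fun x hx => by
    rw [ContinuousMap.sub_apply, (hag x hx).1, sub_self]
  rw [hsub, map_sub, map_sub, hVu, sub_self] at this
  exact sub_eq_zero.1 this

/-- Uniqueness of the coefficients, once the functional values agree up to an entire factor. -/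
theorem coeff_eq_of_functional_eq {H : ℂ} {μ : Measure ℝ} [IsFiniteMeasure μ] (hT : 0 < T)
    (hp : AbsolutelyContinuousOnInterval p 0 T) (hq : IntegrableOn q (Ioo 0 T))
    (hp' : AbsolutelyContinuousOnInterval p' 0 T) (hq' : IntegrableOn q' (Ioo 0 T))
    {V : ℝ → C(Icc (0 : ℝ) T, ℂ) →L[ℂ] ℂ} (hH : H ≠ 0)
    (hV : ∀ a ∈ Ioc 0 T, JumpFunctional T (V a) H μ a)
    (hVV : ∀ b c, 0 < b → b ≤ c → c ≤ T → ∀ y : C(ℝ, ℂ), (∀ x ∈ Icc b c, y x = 0) →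
      V b (restr T y) = V c (restr T y))
    (v₁ : SolFamily T p q T 1 0) (v₂ : SolFamily T p q T 0 1)
    (v₁' : SolFamily T p' q' T 1 0) (v₂' : SolFamily T p' q' T 0 1)
    (h2 : ∀ z, V T (restr T (v₂.y z)) = V T (restr T (v₂'.y z))) {F : ℂ → ℂ}
    (hF : Differentiable ℂ F)
    (h1 : ∀ z, V T (restr T (v₁.y z)) - V T (restr T (v₁'.y z)) = F z * V T (restr T (v₂.y z))) :
    ∀ᵐ x, x ∈ Ioo 0 T → p x = p' x ∧ q x = q' x := by
  have ip := hp.integrableOn_Ioo hT.le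
  have ip' := hp'.integrableOn_Ioo hT.le
  -- The induction also carries equal functional values at T/2ⁿ; after the first halving the
  -- multiplier is zero.
  have key : ∀ n : ℕ, (∀ᵐ x, x ∈ Ioo (T / 2 ^ (n + 1)) (T / 2 ^ n) → p x = p' x ∧ q x = q' x) ∧
      ∃ (v₁ : SolFamily T p q (T / 2 ^ n) 1 0) (v₂ : SolFamily T p q (T / 2 ^ n) 0 1)
        (v₁' : SolFamily T p' q' (T / 2 ^ n) 1 0) (v₂' : SolFamily T p' q' (T / 2 ^ n) 0 1),
        ∀ z, V (T / 2 ^ n) (restr T (v₁.y z)) = V (T / 2 ^ n) (restr T (v₁'.y z)) ∧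
          V (T / 2 ^ n) (restr T (v₂.y z)) = V (T / 2 ^ n) (restr T (v₂'.y z)) := by
    intro n
    induction n with
    | zero =>
      have e : T / 2 ^ 0 = T := by simp
      have e' : T / 2 ^ (0 + 1) = T / 2 := by simp
      rw [e, e']
      obtain ⟨s1, s2⟩ := step hT.le hp hq hp' hq' hH ⟨hT, le_rfl⟩ (hV T ⟨hT, le_rfl⟩) v₁ v₂ v₁' v₂'
        h2 hF h1
      exact ⟨s1, v₁, v₂, v₁', v₂', fun z => ⟨s2 z, h2 z⟩⟩
    | succ n ih =>
      obtain ⟨hag, v₁, v₂, v₁', v₂', hv⟩ := ih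
      have hb : 0 < T / 2 ^ (n + 1) := by positivity
      have haT : T / 2 ^ n ≤ T := div_le_self hT.le (one_le_pow₀ one_le_two)
      have hba : T / 2 ^ (n + 1) ≤ T / 2 ^ n :=
        div_le_div_of_nonneg_left hT.le (by positivity)
          (pow_le_pow_right₀ one_le_two (Nat.le_succ n))
      have hbT : T / 2 ^ (n + 1) ∈ Icc 0 T := ⟨hb.le, hba.trans haT⟩
      obtain ⟨u₁⟩ := nonempty_solFamily hT.le ip hq hbT 1 0
      obtain ⟨u₂⟩ := nonempty_solFamily hT.le ip hq hbT 0 1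
      obtain ⟨u₁'⟩ := nonempty_solFamily hT.le ip' hq' hbT 1 0
      obtain ⟨u₂'⟩ := nonempty_solFamily hT.le ip' hq' hbT 0 1
      have hd1 := functional_eq_descend hT.le hp hq v₁ v₂ v₁' v₂' hb.le hba haT hag
        (fun z => (hv z).1) (fun z => (hv z).2) (hVV _ _ hb hba haT) u₁ u₁'
      have hd2 := functional_eq_descend hT.le hp hq v₁ v₂ v₁' v₂' hb.le hba haT hag
        (fun z => (hv z).1) (fun z => (hv z).2) (hVV _ _ hb hba haT) u₂ u₂'
      have s := step hT.le hp hq hp' hq' hH ⟨hb, hbT.2⟩ (hV _ ⟨hb, hbT.2⟩) u₁ u₂ u₁' u₂'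
        hd2 (F := fun _ => 0) (differentiable_const _) (fun z => by rw [hd1 z]; ring)
      have e : T / 2 ^ (n + 1 + 1) = T / 2 ^ (n + 1) / 2 := by rw [pow_succ _ (n + 1)]; field_simp
      rw [e]
      exact ⟨s.1, u₁, u₂, u₁', u₂', fun z => ⟨hd1 z, hd2 z⟩⟩
  have hpt : ∀ᵐ x : ℝ, ∀ n : ℕ, x ≠ T / 2 ^ n :=
    ae_all_iff.2 fun n => by simp [ae_iff, measure_singleton]
  filter_upwards [ae_all_iff.2 fun n => (key n).1, hpt] with x hx hne hxT
  have hlim : ∃ n : ℕ, T / 2 ^ n < x := by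
    obtain ⟨n, hn⟩ := pow_unbounded_of_one_lt (T / x) (one_lt_two (α := ℝ))
    exact ⟨n, (div_lt_comm₀ hxT.1 (by positivity)).1 hn⟩
  classical
  have hspec := Nat.find_spec hlim
  have hpos : Nat.find hlim ≠ 0 := fun h0 => by
    rw [h0] at hspec
    simp only [pow_zero, div_one] at hspec
    exact lt_asymm hspec hxT.2
  obtain ⟨m, hm⟩ := Nat.exists_eq_succ_of_ne_zero hpos
  have hmin := Nat.find_min hlim (m := m) (by omega)
  rw [hm] at hspec
  exact hx m ⟨hspec, lt_of_le_of_ne (not_lt.1 hmin) (hne m)⟩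

/-- The uniqueness theorem in terms of solutions based at the right end point. -/
theorem coeff_eq_of_spectral_data {H : ℂ} {μ : Measure ℝ} [IsFiniteMeasure μ] (hT : 0 < T)
    (hp : AbsolutelyContinuousOnInterval p 0 T) (hq : IntegrableOn q (Ioo 0 T))
    (hp' : AbsolutelyContinuousOnInterval p' 0 T) (hq' : IntegrableOn q' (Ioo 0 T))
    (hint : ∫ x in (0 : ℝ)..T, p x = ∫ x in (0 : ℝ)..T, p' x)
    {V : ℝ → C(Icc (0 : ℝ) T, ℂ) →L[ℂ] ℂ} (hH : H ≠ 0)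
    (hV : ∀ a ∈ Ioc 0 T, JumpFunctional T (V a) H μ a)
    (hVV : ∀ b c, 0 < b → b ≤ c → c ≤ T → ∀ y : C(ℝ, ℂ), (∀ x ∈ Icc b c, y x = 0) →
      V b (restr T y) = V c (restr T y))
    (W : C(Icc (0 : ℝ) T, ℂ) →L[ℂ] ℂ)
    (v₁ : SolFamily T p q T 1 0) (v₂ : SolFamily T p q T 0 1)
    (v₁' : SolFamily T p' q' T 1 0) (v₂' : SolFamily T p' q' T 0 1)
    (hM : ∀ z, V T (restr T (v₂.y z)) ≠ 0 → V T (restr T (v₂'.y z)) ≠ 0 →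
      W (restr T (v₂.y z)) * V T (restr T (v₂'.y z))
        = W (restr T (v₂'.y z)) * V T (restr T (v₂.y z)))
    (hS : ∀ z, V T (restr T (v₂.y z)) = 0 → V T (restr T (v₁.y z)) * W (restr T (v₂.y z))
      - V T (restr T (v₂.y z)) * W (restr T (v₁.y z)) ≠ 0)
    (hω : ∀ z, V T (restr T (v₁.y z)) * W (restr T (v₂.y z))
      - V T (restr T (v₂.y z)) * W (restr T (v₁.y z))
      = V T (restr T (v₁'.y z)) * W (restr T (v₂'.y z))
      - V T (restr T (v₂'.y z)) * W (restr T (v₁'.y z))) :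
    ∀ᵐ x, x ∈ Ioo 0 T → p x = p' x ∧ q x = q' x := by
  have hTT : T ∈ Icc 0 T := ⟨hT.le, le_rfl⟩
  have dΓ₁ := v₁.differentiable_functional (V T)
  have dΓ₂ := v₁.differentiable_functional W
  have dΔ₁ := v₂.differentiable_functional (V T)
  have dΔ₂ := v₂.differentiable_functional W
  have dΓ₁' := v₁'.differentiable_functional (V T)
  have dΓ₂' := v₁'.differentiable_functional W
  have dΔ₁' := v₂'.differentiable_functional (V T)
  have dΔ₂' := v₂'.differentiable_functional W
  have eΔ₁ := v₂.expType hT.le hp hq hTT (V T)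
  have eΔ₁' := v₂'.expType hT.le hp' hq' hTT (V T)
  have hlim := fun (ζ ε : ℂ) (hζ : ζ ^ 4 = -1) hε =>
    tendsto_leadingFactor_functional (ε := ε) hT.le hp hq hζ hε v₂ ⟨hT, le_rfl⟩ (hV T ⟨hT, le_rfl⟩)
  have hlim' := fun (ζ ε : ℂ) (hζ : ζ ^ 4 = -1) hε =>
    tendsto_leadingFactor_functional (ε := ε) hT.le hp' hq' hζ hε v₂' ⟨hT, le_rfl⟩
      (hV T ⟨hT, le_rfl⟩)
  -- The equal integrals of the two first coefficients enter here: they give Δ₁ and Δ₁' the same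
  -- normalization.
  have hfac : ∀ ε z, leadingFactor ε p' z 0 T = leadingFactor ε p z 0 T := fun ε z => by
    rw [leadingFactor, leadingFactor, hint]
  simp only [hfac] at hlim'
  set Γ₁ := fun z => V T (restr T (v₁.y z))
  set Γ₂ := fun z => W (restr T (v₁.y z))
  set Δ₁ := fun z => V T (restr T (v₂.y z))
  set Δ₂ := fun z => W (restr T (v₂.y z))
  set Γ₁' := fun z => V T (restr T (v₁'.y z))
  set Γ₂' := fun z => W (restr T (v₁'.y z))
  set Δ₁' := fun z => V T (restr T (v₂'.y z))
  set Δ₂' := fun z => W (restr T (v₂'.y z))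
  obtain ⟨ζ₀, hζ₀⟩ : ∃ ζ : ℂ, ζ ^ 4 = -1 := IsAlgClosed.exists_pow_nat_eq _ (by norm_num)
  obtain ⟨ε₀, hε₀⟩ := exists_sign hζ₀
  obtain ⟨z₀, h0⟩ : ∃ z, Δ₁ z ≠ 0 := by
    obtain ⟨r, hr⟩ := ((hlim ζ₀ ε₀ hζ₀ hε₀).eventually_ne hH).exists
    exact ⟨_, right_ne_zero_of_mul hr⟩
  obtain ⟨z₁, h0'⟩ : ∃ z, Δ₁' z ≠ 0 := by
    obtain ⟨r, hr⟩ := ((hlim' ζ₀ ε₀ hζ₀ hε₀).eventually_ne hH).exists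
    exact ⟨_, right_ne_zero_of_mul hr⟩
  -- Known off the zeros of Δ₁ and Δ₁'. Multiplying by both makes it hold everywhere, and the
  -- nontrivial entire factors are then cancelled.
  have hM' : ∀ z, Δ₂ z * Δ₁' z - Δ₂' z * Δ₁ z = 0 := by
    have hd : Differentiable ℂ fun z => Δ₂ z * Δ₁' z - Δ₂' z * Δ₁ z :=
      (dΔ₂.mul dΔ₁').sub (dΔ₂'.mul dΔ₁)
    refine exists_ne_zero_mul_of_entire hd dΔ₁' (exists_ne_zero_mul_of_entire (hd.mul dΔ₁') dΔ₁
      (fun z => ?_) h0) h0'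
    by_cases hz : Δ₁ z = 0
    · rw [hz, mul_zero]
    by_cases hz' : Δ₁' z = 0
    · rw [hz', mul_zero, zero_mul]
    · rw [hM z hz hz', sub_self, zero_mul, zero_mul]
  have hne : ∀ z, Δ₁ z = 0 → Δ₂ z ≠ 0 := fun z hz hz2 => hS z hz (by
    change Γ₁ z * Δ₂ z - Δ₁ z * Γ₂ z = 0
    rw [hz, hz2]; ring)
  obtain ⟨E, hE, hEeq⟩ := exists_entire_quotient dΔ₁' dΔ₁ dΔ₂' dΔ₂
    (fun z => by linear_combination hM' z) hne
  have hE1 : ∀ z, E z = 1 := ExpType.eq_of_tendsto hE (ExpType.of_mul hE dΔ₁ eΔ₁' eΔ₁ h0 hEeq)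
    fun ζ hζ => by
      obtain ⟨ε, hε⟩ := exists_sign hζ
      have := (hlim' ζ ε hζ hε).div (hlim ζ ε hζ hε) hH
      rw [div_self hH] at this
      refine this.congr' ?_
      filter_upwards [(hlim ζ ε hζ hε).eventually_ne hH] with r hr
      have e : V T (restr T (v₂'.y (r * ζ))) = E (r * ζ) * V T (restr T (v₂.y (r * ζ))) := hEeq _
      simp only [Pi.div_apply]
      rw [e, div_eq_iff hr]; ring
  have hΔ₁ : ∀ z, Δ₁ z = Δ₁' z := fun z => by rw [hEeq, hE1, one_mul]
  have hΔ₂ : ∀ z, Δ₂ z - Δ₂' z = 0 := exists_ne_zero_mul_of_entire (dΔ₂.sub dΔ₂') dΔ₁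
    (fun z => by
      have := hM' z
      rw [← hΔ₁] at this
      linear_combination this) h0
  obtain ⟨F, hF, hFeq⟩ := exists_entire_quotient (dΓ₁.sub dΓ₁') dΔ₁ (dΓ₂.sub dΓ₂') dΔ₂
    (fun z => by
      have h1 : Γ₁ z * Δ₂ z - Δ₁ z * Γ₂ z = Γ₁' z * Δ₂' z - Δ₁' z * Γ₂' z := hω z
      rw [← hΔ₁, ← sub_eq_zero.1 (hΔ₂ z)] at h1
      simp only [Pi.sub_apply]
      linear_combination h1) hne
  exact coeff_eq_of_functional_eq hT hp hq hp' hq' hH hV hVV v₁ v₂ v₁' v₂' hΔ₁ hF hFeq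

end

/-! ### Stieltjes integrals as functionals -/

/-- A complex measure has finite variation. -/
theorem isFiniteMeasure_variation (ν : VectorMeasure ℝ ℂ) : IsFiniteMeasure ν.variation := by
  -- A variation above twice the uniform bound of μ would produce a set whose measure exceeds that
  -- bound.
  have key : ∀ μ : SignedMeasure ℝ, μ.variation univ < ⊤ := fun μ => by
    refine lt_of_le_of_lt (le_of_not_gt fun h => ?_)
      (show 2 * (μ.bound : ENNReal) < ⊤ from ENNReal.mul_lt_top (by simp) ENNReal.coe_lt_top)
    obtain ⟨t, -, -, ht⟩ := μ.exists_subset_lt_enorm_apply_of_lt_variation MeasurableSet.univ h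
    exact absurd ht (not_lt.2 (by gcongr; exact μ.enorm_apply_le_bound))
  set re := ν.mapRange Complex.reCLM.toLinearMap.toAddMonoidHom Complex.continuous_re
  set im := ν.mapRange Complex.imCLM.toLinearMap.toAddMonoidHom Complex.continuous_im
  have hle : ν.variation ≤ re.variation + im.variation := by
    refine VectorMeasure.variation_le_of_forall_enorm_le fun E _ => ?_
    calc ‖ν E‖ₑ ≤ ‖re E‖ₑ + ‖im E‖ₑ := by
          rw [← ofReal_norm, ← ofReal_norm, ← ofReal_norm,
            ← ENNReal.ofReal_add (norm_nonneg _) (norm_nonneg _)]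
          exact ENNReal.ofReal_le_ofReal (Complex.norm_le_abs_re_add_abs_im _)
      _ ≤ _ := add_le_add (VectorMeasure.enorm_measure_le_variation _ _)
          (VectorMeasure.enorm_measure_le_variation _ _)
  refine ⟨lt_of_le_of_lt (hle univ) ?_⟩
  rw [Measure.add_apply]
  exact ENNReal.add_lt_top.2 ⟨key re, key im⟩

/-- The pairing is given only as a real bilinear map; associativity of multiplication supplies
complex homogeneity. -/
theorem integral_mul_smul (ν : VectorMeasure ℝ ℂ) (c : ℂ) (f : ℝ → ℂ) :
    ν.integral (fun x => c * f x) (ContinuousLinearMap.mul ℝ ℂ)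
      = c * ν.integral f (ContinuousLinearMap.mul ℝ ℂ) :=
  setToFun_smul (𝕜 := ℂ) _ (fun c s x => mul_assoc c x (ν s)) c f

section

variable {T : ℝ}

theorem integrable_of_bounded {f : ℝ → ℂ} (hf : Continuous f) {C : ℝ} (h : ∀ x, ‖f x‖ ≤ C)
    (ν : VectorMeasure ℝ ℂ) : ν.Integrable f :=
  have := isFiniteMeasure_variation ν
  Integrable.of_bound hf.aestronglyMeasurable C (Eventually.of_forall h)

theorem norm_IccExtend_le (hT : 0 ≤ T) (f : C(Icc (0 : ℝ) T, ℂ)) (x : ℝ) : ‖IccExtend hT f x‖ ≤ ‖f‖ :=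
  f.norm_coe_le_norm _

/-- Integration over `s` against a complex measure, as a functional on `C[0, T]`. -/
noncomputable def integralCLM (hT : 0 ≤ T) (ν : VectorMeasure ℝ ℂ) (s : Set ℝ) : C(Icc (0 : ℝ) T, ℂ) →L[ℂ] ℂ :=
  LinearMap.mkContinuous
    { toFun := fun f => (ν.restrict s).integral (IccExtend hT f) (ContinuousLinearMap.mul ℝ ℂ)
      map_add' := fun f g => VectorMeasure.integral_fun_add
        (integrable_of_bounded (f.continuous.Icc_extend' (h := hT)) (norm_IccExtend_le hT f) _)
        (integrable_of_bounded (g.continuous.Icc_extend' (h := hT)) (norm_IccExtend_le hT g) _)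
      map_smul' := fun c f => integral_mul_smul _ c _ }
    (‖ContinuousLinearMap.mul ℝ ℂ‖ * (ν.restrict s).variation.real univ) fun f => by
      have := isFiniteMeasure_variation (ν.restrict s)
      rw [mul_comm, ← mul_assoc]
      exact VectorMeasure.norm_integral_le_of_norm_le_const
        (Eventually.of_forall (norm_IccExtend_le hT f))

theorem integralCLM_restr (hT : 0 ≤ T) (ν : VectorMeasure ℝ ℂ) {s : Set ℝ} (hs : s ⊆ Icc 0 T) (y : C(ℝ, ℂ)) {g : ℝ → ℂ}
    (hg : EqOn g y s) :
    integralCLM hT ν s (restr T y) = (ν.restrict s).integral g (ContinuousLinearMap.mul ℝ ℂ) := by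
  refine VectorMeasure.setIntegral_congr_fun fun x hx => ?_
  rw [IccExtend_of_mem hT _ (hs hx), hg hx]
  rfl

theorem integrableOn_of_subset_Icc (hT : 0 ≤ T) (ν : VectorMeasure ℝ ℂ) {s : Set ℝ} (hsm : MeasurableSet s) (hs : s ⊆ Icc 0 T)
    (y : C(ℝ, ℂ)) : ν.IntegrableOn y s := by
  have h := integrable_of_bounded ((restr T y).continuous.Icc_extend' (h := hT))
    (norm_IccExtend_le hT (restr T y)) (ν.restrict s)
  refine MeasureTheory.Integrable.congr h ?_
  rw [VectorMeasure.variation_restrict hsm]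
  filter_upwards [ae_restrict_mem hsm] with x hx
  rw [IccExtend_of_mem hT _ (hs hx)]
  rfl

/-- Splitting off the atom at 0 leaves an integral over (0, a], which the variation dominates. -/
theorem jumpFunctional_integralCLM (hT : 0 ≤ T) (ν : VectorMeasure ℝ ℂ) {a : ℝ} (ha : a ∈ Ioc 0 T) :
    JumpFunctional T (integralCLM hT ν (Icc 0 a)) (ν {0}) ν.variation a := by
  intro y
  have hsub : Icc 0 a ⊆ Icc 0 T := Icc_subset_Icc_right ha.2
  rw [integralCLM_restr hT ν hsub y fun x _ => rfl]
  have hu : Icc 0 a = {0} ∪ Ioc 0 a := by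
    rw [← Icc_self, Icc_union_Ioc_eq_Icc le_rfl ha.1.le]
  have h1 : ({0} : Set ℝ) ⊆ Icc 0 T := by simpa using hT
  have h2 : Ioc 0 a ⊆ Icc 0 T := Ioc_subset_Icc_self.trans hsub
  rw [hu, VectorMeasure.setIntegral_union (by simp) (measurableSet_singleton _) measurableSet_Ioc
    (integrableOn_of_subset_Icc hT ν (measurableSet_singleton _) h1 y)
    (integrableOn_of_subset_Icc hT ν measurableSet_Ioc h2 y), VectorMeasure.integral_singleton,
    ContinuousLinearMap.mul_apply', mul_comm (y 0), add_sub_cancel_left]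
  refine VectorMeasure.norm_integral_le_integral_norm.trans ?_
  rw [VectorMeasure.variation_restrict measurableSet_Ioc]
  exact mul_le_of_le_one_left (integral_nonneg fun _ => norm_nonneg _)
    (ContinuousLinearMap.opNorm_mul_le ℝ ℂ)

theorem integralCLM_eq_of_eq_zero (hT : 0 ≤ T) (ν : VectorMeasure ℝ ℂ) {b c : ℝ} (hbc : b ≤ c) (hc : c ≤ T) (y : C(ℝ, ℂ))
    (hy : ∀ x ∈ Icc b c, y x = 0) :
    integralCLM hT ν (Icc 0 b) (restr T y) = integralCLM hT ν (Icc 0 c) (restr T y) := by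
  rw [integralCLM_restr hT ν (Icc_subset_Icc_right (hbc.trans hc)) y fun x _ => rfl,
    integralCLM_restr hT ν (Icc_subset_Icc_right hc) y fun x _ => rfl]
  refine (VectorMeasure.setIntegral_eq_of_subset_of_forall_sdiff_eq_zero measurableSet_Icc
    measurableSet_Icc (Icc_subset_Icc_right hbc) fun x hx => hy x ⟨?_, hx.1.2⟩).symm
  by_contra h
  exact hx.2 ⟨hx.1.1, (not_le.1 h).le⟩

end

theorem stieltjesIntegral_eq {T : ℝ} (hT : 0 ≤ T) {σ : ℝ → ℂ} (hσ : BoundedVariationOn σ (Icc 0 T))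
    (Y : C(ℝ, ℂ)) {y : ℝ → ℂ} (hy : EqOn y Y (Icc 0 T)) :
    stieltjesIntegral T σ y
      = integralCLM hT (boundedVariationOn_clamp hT hσ).vectorMeasure (Icc 0 T) (restr T Y) := by
  rw [integralCLM_restr hT _ Subset.rfl Y hy, stieltjesIntegral,
    dif_pos (boundedVariationOn_clamp hT hσ)]

/-- The mass of a point is right limit minus left limit. The clamped function is constant to the
left of 0 and equals `σ` just to the right. -/
theorem vectorMeasure_clamp_singleton {T : ℝ} (hT : 0 < T) {σ : ℝ → ℂ}
    (hσ : BoundedVariationOn σ (Icc 0 T)) :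
    (boundedVariationOn_clamp hT.le hσ).vectorMeasure {0} = jumpAtZero σ := by
  set hb := boundedVariationOn_clamp hT.le hσ
  have hl : Function.leftLim (clamp T σ) 0 = σ 0 := by
    refine leftLim_eq_of_tendsto ?_
    refine tendsto_const_nhds.congr' ?_
    filter_upwards [self_mem_nhdsWithin] with x hx
    rw [clamp, max_eq_left (min_le_of_left_le (le_of_lt hx))]
  have hr : Function.rightLim σ 0 = Function.rightLim (clamp T σ) 0 := by
    refine rightLim_eq_of_tendsto ?_
    refine (hb.tendsto_rightLim 0).congr' ?_
    filter_upwards [Ioo_mem_nhdsGT hT] with x hx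
    exact clamp_of_mem (Ioo_subset_Icc_self hx)
  rw [hb.vectorMeasure_singleton, hl, jumpAtZero, hr]

/-! ### Classical solutions -/

section

variable {T : ℝ} {p q : ℝ → ℂ} {z : ℂ}

theorem Sol.derivWithin_eq {k y w : ℝ → ℂ} (h : Sol k y w) (hT : 0 < T) {x : ℝ}
    (hx : x ∈ Icc 0 T) : derivWithin y (Icc 0 T) x = w x :=
  (h.hasDerivAt x).hasDerivWithinAt.derivWithin (uniqueDiffOn_Icc hT x hx)

theorem Sol.isSolution {y w : ℝ → ℂ} (h : Sol (potential T p q z) y w) (hT : 0 < T) :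
    IsSolution T p q z y where
  differentiableOn := fun x _ => (h.hasDerivAt x).differentiableAt.differentiableWithinAt
  absolutelyContinuous := by
    refine (h.prim_w.ac 0 T).of_dist_le fun x hx t ht => ?_
    rw [uIcc_of_le hT.le] at hx ht
    rw [h.derivWithin_eq hT hx, h.derivWithin_eq hT ht]
  equation := by
    rw [ae_restrict_iff' measurableSet_Ioo]
    filter_upwards [h.prim_w.ae_hasDerivAt] with x hx hxT
    rw [potential, indicator_of_mem hxT] at hx
    refine hx.congr_of_eventuallyEq ?_
    filter_upwards [Ioo_mem_nhds hxT.1 hxT.2] with t ht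
    exact h.derivWithin_eq hT (Ioo_subset_Icc_self ht)

/-- Extend y' by constants and integrate it. The right side of the equation is integrable because it
is almost everywhere the derivative of the absolutely continuous y'. -/
theorem IsSolution.exists_sol {y : ℝ → ℂ} (h : IsSolution T p q z y) (hT : 0 < T) :
    ∃ (Y : C(ℝ, ℂ)) (w : ℝ → ℂ), Sol (potential T p q z) Y w ∧
      ∀ x ∈ Icc 0 T, y x = Y x ∧ derivWithin y (Icc 0 T) x = w x := by
  set g := derivWithin y (Icc 0 T) with hg
  obtain ⟨β, hβ, hgβ⟩ := h.absolutelyContinuous.exists_ae_hasDerivAt hT.le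
  have hα : IntegrableOn (fun x => -((z ^ 2 - 2 * z * p x - q x) * y x)) (Ioo 0 T) := by
    refine MeasureTheory.Integrable.congr hβ ?_
    filter_upwards [hgβ, h.equation] with x h1 h2 using h1.unique h2
  have hw := Prim.clamp hT.le h.absolutelyContinuous hα h.equation
  have hY := Prim.of_integral (fun a b => hw.continuous.intervalIntegrable (μ := volume) a b) (y 0) 0
  have hwg : ∀ x ∈ Icc 0 T, g x = clamp T g x := fun x hx => (clamp_of_mem hx).symm
  have hyY : ∀ x ∈ Icc 0 T, y x = y 0 + ∫ t in (0 : ℝ)..x, clamp T g t := fun x hx => by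
    rw [intervalIntegral.integral_eq_sub_of_hasDerivAt_of_le hx.1
      (h.differentiableOn.continuousOn.mono (Icc_subset_Icc_right hx.2)) (fun t ht => ?_)
      (hw.continuous.intervalIntegrable _ _)]
    · ring
    · have htT : t ∈ Ioo 0 T := ⟨ht.1, ht.2.trans_le hx.2⟩
      rw [← hwg t (Ioo_subset_Icc_self htT)]
      exact ((h.differentiableOn t (Ioo_subset_Icc_self htT)).hasDerivWithinAt).hasDerivAt
        (Icc_mem_nhds htT.1 htT.2)
  refine ⟨⟨_, hY.continuous⟩, clamp T g, ⟨hY, hw.congr (Eventually.of_forall fun x => ?_)⟩,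
    fun x hx => ⟨hyY x hx, hwg x hx⟩⟩
  by_cases hx : x ∈ Ioo 0 T
  · simp only [potential, indicator_of_mem hx]
    exact congrArg (fun t => -((z ^ 2 - 2 * z * p x - q x) * t)) (hyY x (Ioo_subset_Icc_self hx))
  · simp [potential, hx]

/-- Existence makes the choice operator return a solution, and expansion in the fundamental system
at 0 makes it unique on the interval. -/
theorem cauchySolution_eqOn {c₀ c₁ : ℂ} (hT : 0 < T) (hp : IntegrableOn p (Ioo 0 T))
    (hq : IntegrableOn q (Ioo 0 T)) (X : SolFamily T p q 0 c₀ c₁) (z : ℂ) :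
    EqOn (cauchySolution T p q z c₀ c₁) (X.y z) (Icc 0 T) := by
  have h0 := left_mem_Icc.2 hT.le
  have hex : ∃ y, IsSolution T p q z y ∧ y 0 = c₀ ∧ derivWithin y (Icc 0 T) 0 = c₁ :=
    ⟨X.y z, (X.sol z).isSolution hT, X.y_base z, by
      rw [(X.sol z).derivWithin_eq hT h0, X.w_base]⟩
  obtain ⟨hs, hc₀, hc₁⟩ := Classical.epsilon_spec hex
  obtain ⟨Y, w, hY, hyY⟩ := hs.exists_sol hT
  obtain ⟨v₁⟩ := nonempty_solFamily hT.le hp hq h0 1 0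
  obtain ⟨v₂⟩ := nonempty_solFamily hT.le hp hq h0 0 1
  intro x hx
  have e1 := (hY.eq_linComb (v₁.sol z) (v₂.sol z) (b := 0) (c := T) (by simp) h0
    (v₁.y_base z) (v₁.w_base z) (v₂.y_base z) (v₂.w_base z) hx).1
  have e2 := ((X.sol z).eq_linComb (v₁.sol z) (v₂.sol z) (b := 0) (c := T) (by simp) h0
    (v₁.y_base z) (v₁.w_base z) (v₂.y_base z) (v₂.w_base z) hx).1
  rw [← (hyY 0 h0).1, ← (hyY 0 h0).2] at e1
  rw [X.y_base, X.w_base] at e2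
  have e3 := (hyY x hx).1
  unfold cauchySolution
  rw [e3, e1, e2]
  congr 1
  · congr 1
  · congr 1

end

/-! ### Spectral data in terms of solutions based at the right end point -/

/-- The functional `y ↦ ∫₀ᵇ y dσ` on `C[0, T]`. -/
noncomputable def stieltjesCLM {T : ℝ} (hT : 0 ≤ T) {σ : ℝ → ℂ}
    (hσ : BoundedVariationOn σ (Icc 0 T)) (b : ℝ) : C(Icc (0 : ℝ) T, ℂ) →L[ℂ] ℂ :=
  integralCLM hT (boundedVariationOn_clamp hT hσ).vectorMeasure (Icc 0 b)

section

variable {T : ℝ} {p q : ℝ → ℂ} {z : ℂ} {σ σ₁ σ₂ y : ℝ → ℂ}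

theorem IsSolution.eqOn_linComb (h : IsSolution T p q z y) (hT : 0 < T) {a : ℝ}
    (ha : a ∈ Icc 0 T) (v₁ : SolFamily T p q a 1 0) (v₂ : SolFamily T p q a 0 1) :
    EqOn y (y a • v₁.y z + derivWithin y (Icc 0 T) a • v₂.y z : C(ℝ, ℂ)) (Icc 0 T) := by
  obtain ⟨Y, w, hY, hyY⟩ := h.exists_sol hT
  intro x hx
  rw [(hyY a ha).1, (hyY a ha).2, (hyY x hx).1]
  exact (hY.eq_linComb (v₁.sol z) (v₂.sol z) (b := 0) (c := T) (by simp) ha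
    (v₁.y_base z) (v₁.w_base z) (v₂.y_base z) (v₂.w_base z) hx).1

theorem IsSolution.stieltjesIntegral_eq (h : IsSolution T p q z y) (hT : 0 < T) {a : ℝ}
    (ha : a ∈ Icc 0 T) (v₁ : SolFamily T p q a 1 0) (v₂ : SolFamily T p q a 0 1)
    (hσ : BoundedVariationOn σ (Icc 0 T)) :
    stieltjesIntegral T σ y = y a * stieltjesCLM hT.le hσ T (restr T (v₁.y z))
      + derivWithin y (Icc 0 T) a * stieltjesCLM hT.le hσ T (restr T (v₂.y z)) := by
  rw [NonlocalPencil.stieltjesIntegral_eq hT.le hσ _ (h.eqOn_linComb hT ha v₁ v₂)]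
  change stieltjesCLM hT.le hσ T (y a • restr T (v₁.y z)
    + derivWithin y (Icc 0 T) a • restr T (v₂.y z)) = _
  rw [map_add, map_smul, map_smul, smul_eq_mul, smul_eq_mul]

theorem SolFamily.stieltjesIntegral_eq {a : ℝ} {c₀ c₁ : ℂ} (v : SolFamily T p q a c₀ c₁)
    (hT : 0 ≤ T) (hσ : BoundedVariationOn σ (Icc 0 T)) (hy : EqOn y (v.y z) (Icc 0 T)) :
    stieltjesIntegral T σ y = stieltjesCLM hT hσ T (restr T (v.y z)) :=
  NonlocalPencil.stieltjesIntegral_eq hT hσ (v.y z) hy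

/-- Changing the fundamental system multiplies the determinant by that of the transition matrix,
here the Wronskian of X₁ and X₂ at T, which is 1. -/
theorem omega_eq (hT : 0 < T) (hp : IntegrableOn p (Ioo 0 T)) (hq : IntegrableOn q (Ioo 0 T))
    (hσ₁ : BoundedVariationOn σ₁ (Icc 0 T)) (hσ₂ : BoundedVariationOn σ₂ (Icc 0 T))
    (v₁ : SolFamily T p q T 1 0) (v₂ : SolFamily T p q T 0 1) :
    omega T σ₁ σ₂ p q z = stieltjesCLM hT.le hσ₁ T (restr T (v₁.y z)) *
        stieltjesCLM hT.le hσ₂ T (restr T (v₂.y z))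
      - stieltjesCLM hT.le hσ₁ T (restr T (v₂.y z)) *
        stieltjesCLM hT.le hσ₂ T (restr T (v₁.y z)) := by
  have h0 := left_mem_Icc.2 hT.le
  have hTT := right_mem_Icc.2 hT.le
  obtain ⟨X⟩ := nonempty_solFamily hT.le hp hq h0 1 0
  obtain ⟨Y⟩ := nonempty_solFamily hT.le hp hq h0 0 1
  have e : ∀ {c₀ c₁ : ℂ} (X : SolFamily T p q 0 c₀ c₁) {σ : ℝ → ℂ}
      (hσ : BoundedVariationOn σ (Icc 0 T)),
      stieltjesIntegral T σ (cauchySolution T p q z c₀ c₁)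
      = X.y z T * stieltjesCLM hT.le hσ T (restr T (v₁.y z))
        + X.w z T * stieltjesCLM hT.le hσ T (restr T (v₂.y z)) := fun X σ hσ => by
    rw [X.stieltjesIntegral_eq hT.le hσ (cauchySolution_eqOn hT hp hq X z),
      ← X.stieltjesIntegral_eq hT.le hσ (fun x _ => rfl),
      ((X.sol z).isSolution hT).stieltjesIntegral_eq hT hTT v₁ v₂ hσ, (X.sol z).derivWithin_eq hT hTT]
  rw [omega, Matrix.det_fin_two_of, X₁, X₂, e X hσ₁, e X hσ₂, e Y hσ₁, e Y hσ₂]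
  linear_combination (stieltjesCLM hT.le hσ₁ T (restr T (v₁.y z)) *
        stieltjesCLM hT.le hσ₂ T (restr T (v₂.y z))
      - stieltjesCLM hT.le hσ₁ T (restr T (v₂.y z)) *
        stieltjesCLM hT.le hσ₂ T (restr T (v₁.y z))) * X.wronskian_eq_one Y z T

/-- A solution with y(T) = 0 is y'(T) v₂, and v₂ itself is nontrivial. -/
theorem mem_spectrum₁_iff (hT : 0 < T) (hσ : BoundedVariationOn σ (Icc 0 T))
    (v₁ : SolFamily T p q T 1 0) (v₂ : SolFamily T p q T 0 1) :
    z ∈ spectrum₁ T σ p q ↔ stieltjesCLM hT.le hσ T (restr T (v₂.y z)) = 0 := by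
  have hTT := right_mem_Icc.2 hT.le
  constructor
  · rintro ⟨y, hy, ⟨x, hx, hyx⟩, hU, hyT⟩
    rw [hy.stieltjesIntegral_eq hT hTT v₁ v₂ hσ, hyT, zero_mul, zero_add] at hU
    refine (mul_eq_zero.1 hU).resolve_left fun h0 => hyx ?_
    rw [hy.eqOn_linComb hT hTT v₁ v₂ hx, hyT, h0]
    simp
  · intro h
    refine ⟨v₂.y z, (v₂.sol z).isSolution hT, ?_, ?_, v₂.y_base z⟩
    · by_contra! hzero
      have h1 : derivWithin (v₂.y z) (Icc 0 T) T = 0 := by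
        rw [derivWithin_congr (f := fun _ => (0 : ℂ)) hzero (hzero T hTT)]
        simp
      rw [(v₂.sol z).derivWithin_eq hT hTT, v₂.w_base] at h1
      exact one_ne_zero h1
    · rw [v₂.stieltjesIntegral_eq hT.le hσ fun x _ => rfl, h]

/-- Off the spectrum the Weyl-type solution is v₂ divided by U₁(v₂). -/
theorem weylM_mul_eq (hT : 0 < T) (hσ₁ : BoundedVariationOn σ₁ (Icc 0 T))
    (hσ₂ : BoundedVariationOn σ₂ (Icc 0 T))
    (v₁ : SolFamily T p q T 1 0) (v₂ : SolFamily T p q T 0 1)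
    (h : stieltjesCLM hT.le hσ₁ T (restr T (v₂.y z)) ≠ 0) :
    weylM T σ₁ σ₂ p q z * stieltjesCLM hT.le hσ₁ T (restr T (v₂.y z))
      = stieltjesCLM hT.le hσ₂ T (restr T (v₂.y z)) := by
  have hTT := right_mem_Icc.2 hT.le
  set D := stieltjesCLM hT.le hσ₁ T (restr T (v₂.y z)) with hD
  have hex : ∃ y, IsSolution T p q z y ∧ stieltjesIntegral T σ₁ y = 1 ∧ y T = 0 := by
    have hs := ((v₂.sol z).linComb (v₂.sol z) D⁻¹ 0).isSolution hT
    refine ⟨_, hs, ?_, ?_⟩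
    · rw [hs.stieltjesIntegral_eq hT hTT v₁ v₂ hσ₁, ((v₂.sol z).linComb (v₂.sol z) D⁻¹ 0).derivWithin_eq
        hT hTT, v₂.y_base, v₂.w_base, ← hD]
      simp [h]
    · simp [v₂.y_base]
  obtain ⟨hy, hU, hyT⟩ := Classical.epsilon_spec hex
  have e1 := hy.stieltjesIntegral_eq hT hTT v₁ v₂ hσ₁
  have e2 := hy.stieltjesIntegral_eq hT hTT v₁ v₂ hσ₂
  rw [hyT, zero_mul, zero_add] at e1 e2
  rw [hU, ← hD] at e1
  rw [weylM, weylSolution, e2]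
  linear_combination (-stieltjesCLM hT.le hσ₂ T (restr T (v₂.y z))) * e1

end

end NonlocalPencil

/-! ### The uniqueness theorem -/

theorem theorem1 (T : ℝ) (hT : 0 < T)
    (σ₁ σ₂ : ℝ → ℂ)
    (hσ₁ : BoundedVariationOn σ₁ (Icc 0 T)) (hσ₂ : BoundedVariationOn σ₂ (Icc 0 T))
    (hσ₁r : ∀ t ∈ Ioo 0 T, ContinuousWithinAt σ₁ (Ici t) t)
    (hσ₂r : ∀ t ∈ Ioo 0 T, ContinuousWithinAt σ₂ (Ici t) t)
    (hH₁ : jumpAtZero σ₁ ≠ 0)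
    (p q pt qt : ℝ → ℂ)
    (hp : AbsolutelyContinuousOnInterval p 0 T) (hq : IntegrableOn q (Ioo 0 T))
    (hpt : AbsolutelyContinuousOnInterval pt 0 T) (hqt : IntegrableOn qt (Ioo 0 T))
    (hint : ∫ x in (0 : ℝ)..T, p x = ∫ x in (0 : ℝ)..T, pt x)
    (hω₀ : ∃ z, omega T σ₁ σ₂ p q z ≠ 0)
    (hS : Disjoint (spectrum₁ T σ₁ p q) {z | omega T σ₁ σ₂ p q z = 0})
    (hM : ∀ z, z ∉ spectrum₁ T σ₁ p q → z ∉ spectrum₁ T σ₁ pt qt →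
      weylM T σ₁ σ₂ p q z = weylM T σ₁ σ₂ pt qt z)
    (hω : ∀ z, omega T σ₁ σ₂ p q z = omega T σ₁ σ₂ pt qt z) :
    (∀ x ∈ Ioo 0 T, p x = pt x) ∧ (∀ᵐ x ∂(volume.restrict (Ioo 0 T)), q x = qt x) := by
  have hTT := right_mem_Icc.2 hT.le
  have ip := hp.integrableOn_Ioo hT.le
  have ipt := hpt.integrableOn_Ioo hT.le
  obtain ⟨v₁⟩ := nonempty_solFamily hT.le ip hq hTT 1 0
  obtain ⟨v₂⟩ := nonempty_solFamily hT.le ip hq hTT 0 1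
  obtain ⟨v₁'⟩ := nonempty_solFamily hT.le ipt hqt hTT 1 0
  obtain ⟨v₂'⟩ := nonempty_solFamily hT.le ipt hqt hTT 0 1
  have hfin := isFiniteMeasure_variation (boundedVariationOn_clamp hT.le hσ₁).vectorMeasure
  have hae : ∀ᵐ x, x ∈ Ioo 0 T → p x = pt x ∧ q x = qt x := by
    refine coeff_eq_of_spectral_data (V := stieltjesCLM hT.le hσ₁)
      (μ := (boundedVariationOn_clamp hT.le hσ₁).vectorMeasure.variation) hT hp hq hpt hqt hint hH₁
      (fun a ha => ?_) (fun b c _ hbc hc y hy => integralCLM_eq_of_eq_zero hT.le _ hbc hc y hy)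
      (stieltjesCLM hT.le hσ₂ T) v₁ v₂ v₁' v₂' (fun z h h' => ?_) (fun z h => ?_) (fun z => ?_)
    · rw [← vectorMeasure_clamp_singleton hT hσ₁]
      exact jumpFunctional_integralCLM hT.le _ ha
    · have e := hM z (fun hz => h ((mem_spectrum₁_iff hT hσ₁ v₁ v₂).1 hz))
        (fun hz => h' ((mem_spectrum₁_iff hT hσ₁ v₁' v₂').1 hz))
      rw [← weylM_mul_eq hT hσ₁ hσ₂ v₁ v₂ h, ← weylM_mul_eq hT hσ₁ hσ₂ v₁' v₂' h', e]
      ring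
    · rw [← omega_eq hT ip hq hσ₁ hσ₂ v₁ v₂]
      exact fun h0 => disjoint_left.1 hS ((mem_spectrum₁_iff hT hσ₁ v₁ v₂).2 h) h0
    · rw [← omega_eq hT ip hq hσ₁ hσ₂ v₁ v₂, ← omega_eq hT ipt hqt hσ₁ hσ₂ v₁' v₂', hω]
  refine ⟨?_, ?_⟩
  -- Continuity upgrades the almost everywhere equality of the first coefficients to every point.
  · have hc : ContinuousOn p (Ioo 0 T) :=
      hp.continuousOn.mono (by rw [uIcc_of_le hT.le]; exact Ioo_subset_Icc_self)
    have hct : ContinuousOn pt (Ioo 0 T) :=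
      hpt.continuousOn.mono (by rw [uIcc_of_le hT.le]; exact Ioo_subset_Icc_self)
    refine Measure.eqOn_open_of_ae_eq (μ := volume) ?_ isOpen_Ioo hc hct
    refine (ae_restrict_iff' measurableSet_Ioo).2 ?_
    filter_upwards [hae] with x hx hxT using (hx hxT).1
  · rw [ae_restrict_iff' measurableSet_Ioo]
    filter_upwards [hae] with x hx hxT using (hx hxT).2
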